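/- Let $\mathbb S=\mathbb R/\mathbb Z$, let $\mathcal P=(0,\tfrac12]\times\mathbb R\times\mathbb R$, and for $r\in(0,\frac12]$ let $W_r(x)=1$ if $\min(x,1-x)\le r$ and $W_r(x)=0$ otherwise ($x\in[0,1]$, regarded as a point of $\mathbb S$). For $p=(r,\lambda,\mu)$ and $\Psi:\mathbb S\to\mathbb R/2\pi\mathbb Z$ put \begin{align*} F(\Psi,p)(x)&=\int_{\mathbb S} W_r(x-y)\sin(\Psi(y)-\Psi(x))\,dy-\int_{\mathbb S} W_r(y)\sin\Psi(y)\,dy\\ &\quad+\lambda\Big[\int_{\mathbb S^2} W_r(z+y-2x)\sin(\Psi(z)+\Psi(y)-2\Psi(x))\,dy\,dz-\int_{\mathbb S^2} W_r(z+y)\sin(\Psi(z)+\Psi(y))\,dy\,dz\Big]\\ &\quad+\mu\Big[\int_{\mathbb S^3} W_r(z-y+w-x)\sin(\Psi(z)-\Psi(y)+\Psi(w)-\Psi(x))\,dw\,dy\,dz-\int_{\mathbb S^3} W_r(z-y+w)\sin(\Psi(z)-\Psi(y)+\Psi(w))\,dw\,dy\,dz\Big]. \end{align*} Let $X=H^1_0$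 be the space of $f\in H^1(\mathbb S,\mathbb R)$ with $f(0)=0$ (continuous representatives), with norm $(\|f\|_{L^2}^2+\|Df\|_{L^2}^2)^{1/2}$. For $q\in\mathbb N$ put $F^q(v,p)=F(\Psi^q+v,p)$, $\Psi^q(x)=2\pi qx$. Let $u_k(x)=\sin(2\pi kx)$, $w_k(x)=1-\cos(2\pi kx)$, $\hat W_r(0)=4r$, $\hat W_r(k)=\frac{2\sin(2\pi kr)}{\pi k}$ for $k\in\mathbb Z\setminus\{0\}$, and $$c_1(q,k,p)=\tfrac14\big(\hat W_r(q-k)+\hat W_r(q+k)-2\hat W_r(q)-(4\lambda+2\mu)\hat W_r(q)\big).$$ Let $\ell\ge1$, $\delta>0$, and let $p:(-\delta,\delta)\to\operatorname{int}\mathcal P$ be a smooth curve, $p_0=p(0)$, such that (i) $c_1(q,\ell,p_0)=0$, and for some $\epsilon>0$, $c_1(q,k,p(s))\notin(-\epsilon,\epsilon)$ for all $s\in(-\delta,\delta)$ and all $k\ge1$, $k\ne\ell$; (ii) for every $s\in(-\delta,\delta)$ the sequence $(c_1(q,k,p(s)))_k$ does not accumulate at $c_1(q,\ell,p(s))$;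 (iii) $\frac{d}{ds}c_1(q,\ell,p(s))\ne0$ at $s=0$. Let $N=\operatorname{span}\{u_\ell,w_\ell\}$, let $R$ be the closed span in $X$ of $\{u_k,w_k:k\ge1,\ k\neq\ell\}$, and let $Q$ be the projection of $X=N\oplus R$ onto $N$ along $R$. Call $\psi$ a reduction function if it is defined for $(v,p)\in N\times\mathcal P$ near $(0,p_0)$, takes values in $R$, satisfies $\psi(0,p_0)=0$, and, for $(v,p)\in N\times\mathcal P$ near $(0,p_0)$, $y=\psi(v,p)$ is the unique solution of $(I-Q)F^q(v+y,p)=0$ in some fixed ball $\{y\in R:\|y\|<\rho\}$. For such a $\psi$ and for $(a,b)\in\mathbb R^2$ and $s$ near the origin let $\Phi(v,p)=QF^q(v+\psi(v,p),p)$ and $$\hat\Phi((a,b),s)=\Big(2\int_{\mathbb S}\sin(2\pi\ell x)\,\Phi(au_\ell+bw_\ell,p(s))(x)\,dx,\ -2\int_{\mathbb S}\cos(2\pi\ell x)\,\Phi(au_\ell+bw_\ell,p(s))(x)\,dx\Big).$$ For $\phi\in\mathbb S$ let $A_\phi=\begin{pmatrix}\cos(2\pi\ell\phi)&\sin(2\pi\ell\phi)\\-\sin(2\pi\ell\phi)&\cos(2\pi\ell\phi)\end{pmatrix}$.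 Then a reduction function exists, and for every reduction function there are a neighborhood $U$ of the origin in $\mathbb R^2$ that is invariant under all $A_\phi$, a $\delta'\in(0,\delta]$, and a function $\hat h:U\times(-\delta',\delta')\to\mathbb R$ such that for all $(a,b)\in U$, $s\in(-\delta',\delta')$ and $\phi\in\mathbb S$ $$\hat\Phi((a,b),s)=\hat h((a,b),s)\,(a,b),\qquad \hat h(A_\phi(a,b),s)=\hat h((a,b),s).$$ Consequently, with $h(a,s)$ the first component of $\hat\Phi((a,0),s)$, a point $x\in U$ satisfies $\hat\Phi(x,s)=0$ if and only if $x=A_\phi(a,0)$ for some $\phi\in\mathbb S$ and some $a$ with $(a,0)\in U$ and $h(a,s)=0$. -/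

import Mathlib

open Set Filter Topology MeasureTheory
open scoped Real ContDiff Matrix

noncomputable section

namespace TwistedStates

/-! ### The nonlocal Kuramoto model with higher-order interactions

The ring is `UnitAddCircle = ℝ / ℤ` with Lebesgue measure of total mass one, the phase space of an
oscillator is `Real.Angle = ℝ / 2πℤ`.  A parameter is a triple `p = (r, lam, mu)`. -/

/-- The parameter space `(0, 1/2] × ℝ × ℝ`. -/
def paramSpace : Set (ℝ × ℝ × ℝ) := {p | 0 < p.1 ∧ p.1 ≤ 1 / 2}

/-- The coupling kernel.  The norm on `UnitAddCircle` is the distance to `0` along the circle,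
i.e. `min x (1 - x)` for a representative `x ∈ [0, 1]`. -/
def W (r : ℝ) (x : UnitAddCircle) : ℝ := if ‖x‖ ≤ r then 1 else 0

/-- The right-hand side of the evolution equation of the phase differences. -/
def F (Ψ : UnitAddCircle → Real.Angle) (p : ℝ × ℝ × ℝ) (x : UnitAddCircle) : ℝ :=
  ((∫ y : UnitAddCircle, W p.1 (x - y) * (Ψ y - Ψ x).sin)
      - ∫ y : UnitAddCircle, W p.1 y * (Ψ y).sin)
  + p.2.1 *
    ((∫ z : UnitAddCircle, ∫ y : UnitAddCircle,
        W p.1 (z + y - 2 • x) * (Ψ z + Ψ y - 2 • Ψ x).sin)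
      - ∫ z : UnitAddCircle, ∫ y : UnitAddCircle, W p.1 (z + y) * (Ψ z + Ψ y).sin)
  + p.2.2 *
    ((∫ z : UnitAddCircle, ∫ y : UnitAddCircle, ∫ w : UnitAddCircle,
        W p.1 (z - y + w - x) * (Ψ z - Ψ y + Ψ w - Ψ x).sin)
      - ∫ z : UnitAddCircle, ∫ y : UnitAddCircle, ∫ w : UnitAddCircle,
        W p.1 (z - y + w) * (Ψ z - Ψ y + Ψ w).sin)

lemma twist_periodic (k : ℕ) :
    Function.Periodic (fun t : ℝ => ((2 * π * k * t : ℝ) : Real.Angle)) 1 := by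
  intro t
  have h : (2 * π * k * (t + 1) : ℝ) = 2 * π * k * t + k * (2 * π) := by ring
  change ((2 * π * k * (t + 1) : ℝ) : Real.Angle) = ((2 * π * k * t : ℝ) : Real.Angle)
  rw [h, Real.Angle.coe_add, Real.Angle.natCast_mul_eq_nsmul, Real.Angle.coe_two_pi, smul_zero,
    add_zero]

/-- The `k`-twisted state `x ↦ 2πkx`, a map from the ring to the phase space. -/
def twist (k : ℕ) : UnitAddCircle → Real.Angle := (twist_periodic k).lift

/-- `F^q(v, p) = F(Ψ^q + v, p)`: the right-hand side for a perturbation `v` of the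
`q`-twisted state. -/
def Fq (q : ℕ) (v : UnitAddCircle → ℝ) (p : ℝ × ℝ × ℝ) : UnitAddCircle → ℝ :=
  F (fun x => twist q x + (v x : Real.Angle)) p

/-! ### The space `H¹₀(𝕊)` -/

/-- `g` is a weak derivative of `f` on the circle; test functions are the smooth functions on the
circle. -/
def IsWeakDeriv (f g : UnitAddCircle → ℝ) : Prop :=
  ∀ φ φ' : UnitAddCircle → ℝ, ContDiff ℝ ∞ (fun t : ℝ => φ t) →
    (∀ t : ℝ, HasDerivAt (fun t : ℝ => φ t) (φ' t) t) →
    ∫ x, f x * φ' x = - ∫ x, g x * φ x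

/-- Membership in `H¹₀`: continuous (representative of an) `H¹` function vanishing at `0`. -/
structure MemH10 (f : UnitAddCircle → ℝ) : Prop where
  continuous : Continuous f
  zero : f 0 = 0
  weakDeriv : ∃ g : UnitAddCircle → ℝ, MemLp g 2 volume ∧ IsWeakDeriv f g

open Classical in
/-- A square-integrable weak derivative (unique almost everywhere) where there is one. -/
def weakDeriv (f : UnitAddCircle → ℝ) : UnitAddCircle → ℝ :=
  if h : ∃ g : UnitAddCircle → ℝ, MemLp g 2 volume ∧ IsWeakDeriv f g then h.choose else 0

/-- The norm of `H¹₀`. -/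
def h1norm (f : UnitAddCircle → ℝ) : ℝ :=
  √((∫ x, f x ^ 2) + ∫ x, weakDeriv f x ^ 2)

/-- `u_k(x) = sin (2πkx)`. -/
def u (k : ℕ) : UnitAddCircle → ℝ := fun x => (twist k x).sin

/-- `w_k(x) = 1 - cos (2πkx)`. -/
def w (k : ℕ) : UnitAddCircle → ℝ := fun x => 1 - (twist k x).cos

/-! ### Eigenvalues of the linearization -/

/-- The Fourier coefficients of the coupling kernel. -/
def What (r : ℝ) (k : ℤ) : ℝ :=
  if k = 0 then 4 * r else 2 * Real.sin (2 * π * k * r) / (π * k)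

/-- The eigenvalue of the linearization at the `q`-twisted state for the modes `u_k`, `w_k`. -/
def c1 (q k : ℕ) (p : ℝ × ℝ × ℝ) : ℝ :=
  1 / 4 * (What p.1 ((q : ℤ) - k) + What p.1 ((q : ℤ) + k) - 2 * What p.1 q
    - (4 * p.2.1 + 2 * p.2.2) * What p.1 q)

/-! ### Lyapunov–Schmidt reduction -/

/-- `N = Z₀ = span {u_ℓ, w_ℓ}`. -/
def N (ℓ : ℕ) : Submodule ℝ (UnitAddCircle → ℝ) := Submodule.span ℝ {u ℓ, w ℓ}

/-- `R = X₀`: the closure in `H¹₀` of the span of all `u_k`, `w_k` with `k ≥ 1`, `k ≠ ℓ`. -/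
def R (ℓ : ℕ) : Set (UnitAddCircle → ℝ) :=
  {f | MemH10 f ∧ ∀ ε > 0,
    ∃ g ∈ Submodule.span ℝ {e : UnitAddCircle → ℝ | ∃ k : ℕ, 1 ≤ k ∧ k ≠ ℓ ∧ (e = u k ∨ e = w k)},
      h1norm (f - g) < ε}

open Classical in
/-- The projection onto `N` along `R` on the space `H¹₀ = R ⊕ N`. -/
def Q (ℓ : ℕ) (f : UnitAddCircle → ℝ) : UnitAddCircle → ℝ :=
  if h : ∃ n ∈ N ℓ, f - n ∈ R ℓ then h.choose else 0

/-- `ψ` is a function `(v, p) ↦ ψ(v, p) ∈ R`, defined for `(v, p) ∈ N × 𝒫` near `(0, p₀)`, with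
`ψ(0, p₀) = 0`, such that near `(0, 0, p₀)` the equation `(I - Q) F^q(v + y, p) = 0` for `y ∈ R` has
`y = ψ(v, p)` as its unique solution.  The values of `ψ` away from `(0, p₀)` are irrelevant. -/
def IsReduction (q ℓ : ℕ) (p₀ : ℝ × ℝ × ℝ)
    (ψ : (UnitAddCircle → ℝ) → (ℝ × ℝ × ℝ) → (UnitAddCircle → ℝ)) : Prop :=
  ψ 0 p₀ = 0 ∧
  ∃ ε > 0, ∃ ρ > 0, ∃ V ∈ 𝓝 p₀, V ⊆ paramSpace ∧
    ∀ v ∈ N ℓ, h1norm v < ε → ∀ p ∈ V,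
      (ψ v p ∈ R ℓ ∧ h1norm (ψ v p) < ρ ∧
        Fq q (v + ψ v p) p - Q ℓ (Fq q (v + ψ v p) p) = 0) ∧
      ∀ y ∈ R ℓ, h1norm y < ρ → Fq q (v + y) p - Q ℓ (Fq q (v + y) p) = 0 → y = ψ v p

/-- `Φ(v, p) = Q F^q(v + ψ(v, p), p)`. -/
def Phi (q ℓ : ℕ) (ψ : (UnitAddCircle → ℝ) → (ℝ × ℝ × ℝ) → (UnitAddCircle → ℝ))
    (v : UnitAddCircle → ℝ) (p : ℝ × ℝ × ℝ) : UnitAddCircle → ℝ :=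
  Q ℓ (Fq q (v + ψ v p) p)

/-- The functional `z₁*`. -/
def zStar1 (ℓ : ℕ) (f : UnitAddCircle → ℝ) : ℝ := 2 * ∫ x, (twist ℓ x).sin * f x

/-- The functional `z₂*`. -/
def zStar2 (ℓ : ℕ) (f : UnitAddCircle → ℝ) : ℝ := -2 * ∫ x, (twist ℓ x).cos * f x

/-- The reduced map in the coordinates `(a, b) = (x 0, x 1)`, along a curve `p` of parameters. -/
def PhiHat (q ℓ : ℕ) (ψ : (UnitAddCircle → ℝ) → (ℝ × ℝ × ℝ) → (UnitAddCircle → ℝ))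
    (p : ℝ → ℝ × ℝ × ℝ) (x : Fin 2 → ℝ) (s : ℝ) : Fin 2 → ℝ :=
  ![zStar1 ℓ (Phi q ℓ ψ (x 0 • u ℓ + x 1 • w ℓ) (p s)),
    zStar2 ℓ (Phi q ℓ ψ (x 0 • u ℓ + x 1 • w ℓ) (p s))]

/-- The rotation matrix `A_φ`. -/
def A (ℓ : ℕ) (φ : UnitAddCircle) : Matrix (Fin 2) (Fin 2) ℝ :=
  !![(twist ℓ φ).cos, (twist ℓ φ).sin; -(twist ℓ φ).sin, (twist ℓ φ).cos]

end TwistedStates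

end

noncomputable section

namespace TwistedStates

section

open AddCircle

/-! ### Fourier analysis on the unit circle -/

/-! The proof is a Lyapunov–Schmidt reduction that keeps the O(2)-symmetry of the model. Up to a
constant, the linearization of `Fq` at the twisted state is the Fourier multiplier n ↦ c1(q, |n|, p)
(`hasDerivAt_field`). At p₀ the gap condition makes it boundedly invertible off the modes 0 and ±ℓ,
and the constant mode is fixed by the value at 0. A contraction argument (`exists_unique_zero_near`,
`lyapunovSchmidt_real`) then solves the complementary equation uniquely for small v and p near p₀.

`Fq` commutes with the normalized translations v ↦ v(· + φ) - v(φ) and with the reflection v ↦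
-v(-·), because it has the form G(x) - G(0), where G depends on phase differences only, with an even
kernel and an odd coupling function. Both symmetries preserve N and R, so by uniqueness they commute
with ψ near the origin, and hence with Φ (`phi_equivariant`). On N they act by A_φ and by (a, b) ↦
(a, -b). A planar map equivariant under these sends the a-axis, the fixed line of the reflection,
into itself, and every point can be rotated into that axis; so the map multiplies each vector by a
function of its radius (`radial_of_equivariant`).

The analysis takes place in the complex space `H1`, a Banach algebra: there v ↦ exp(iv) is analytic,
and the interaction integrals become products, convolutions, dilations and multipliers (`ev_field`).
Identities between linear operators are checked on characters (`clm_ext`). The equivalence of norms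
(`h1norm_le_norm`, `norm_le_h1norm`) and `mem_R_iff` carry the results back to real functions with
weak derivatives. -/

lemma volume_eq_haar : (volume : Measure UnitAddCircle) = haarAddCircle := by
  simp [AddCircle.volume_eq_smul_haarAddCircle]

/-- Continuous complex functions on the circle. -/
abbrev C0 := C(UnitAddCircle, ℂ)

/-- Square-integrable complex functions on the circle. -/
abbrev L2 := Lp ℂ 2 (haarAddCircle : Measure UnitAddCircle)

/-- Characters of the circle. -/
abbrev ch (n : ℤ) : C0 := fourier n

/-- The `n`-th Fourier coefficient on `L²`. -/
def coefL2 (n : ℤ) : L2 →L[ℂ] ℂ := innerSL ℂ (fourierLp 2 n : L2)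

lemma coefL2_apply (n : ℤ) (g : L2) : coefL2 n g = fourierCoeff g n := by
  rw [← fourierBasis_repr, HilbertBasis.repr_apply_apply, coe_fourierBasis]
  rfl

lemma norm_coefL2_le (n : ℤ) (g : L2) : ‖coefL2 n g‖ ≤ ‖g‖ := by
  have h := norm_inner_le_norm (𝕜 := ℂ) (fourierLp 2 n : L2) g
  rwa [orthonormal_fourier.1 n, one_mul] at h

lemma L2_ext {g g' : L2} (h : ∀ n, coefL2 n g = coefL2 n g') : g = g' := by
  apply fourierBasis.repr.injective
  ext n
  simpa [fourierBasis_repr, coefL2_apply] using h n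

lemma hasSum_L2 (g : L2) : HasSum (fun n => coefL2 n g • (fourierLp 2 n : L2)) g := by
  simpa only [coefL2_apply] using hasSum_fourier_series_L2 g

lemma hasSum_sq_coefL2 (g : L2) : HasSum (fun n => ‖coefL2 n g‖ ^ 2) (‖g‖ ^ 2) := by
  have h := hasSum_sq_fourierCoeff g
  simp only [← coefL2_apply] at h
  convert h using 1
  have h2 := congr_arg RCLike.re (L2.inner_def (𝕜 := ℂ) g g)
  rw [← integral_re] at h2
  · simp only [← norm_sq_eq_re_inner] at h2
    exact h2
  · exact L2.integrable_inner g g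

/-- The inclusion of continuous functions into `L²`. -/
abbrev toL2 : C0 →L[ℂ] L2 := ContinuousMap.toLp 2 haarAddCircle ℂ

/-- The `n`-th Fourier coefficient on continuous functions. -/
def coefC (n : ℤ) : C0 →L[ℂ] ℂ := coefL2 n ∘L toL2

lemma coefC_apply (n : ℤ) (f : C0) : coefC n f = fourierCoeff f n := by
  rw [coefC, ContinuousLinearMap.comp_apply, coefL2_apply, fourierCoeff_toLp]

lemma coefC_ch (n m : ℤ) : coefC n (ch m) = if n = m then 1 else 0 := by
  rw [coefC_apply, fourierCoeff_fourier, Pi.single_apply]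

lemma coefL2_ch (n m : ℤ) : coefL2 n (fourierLp 2 m : L2) = if n = m then 1 else 0 := by
  have := orthonormal_iff_ite.1 (orthonormal_fourier (T := (1 : ℝ))) n m
  exact this

lemma norm_C0_toL2_le (f : C0) : ‖toL2 f‖ ≤ ‖f‖ := by
  have h : ‖toL2 f‖ ≤ _ := Lp.norm_le_of_ae_bound (f := toL2 f) (norm_nonneg f) (by
    filter_upwards [ContinuousMap.coeFn_toLp (p := 2) (𝕜 := ℂ) haarAddCircle f] with x hx
    rw [hx]
    exact f.norm_coe_le_norm x)
  simpa [measureUnivNNReal] using h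

lemma norm_coefC_le (n : ℤ) (f : C0) : ‖coefC n f‖ ≤ ‖f‖ :=
  (norm_coefL2_le n _).trans (norm_C0_toL2_le f)

lemma C0_ext {f f' : C0} (h : ∀ n, coefC n f = coefC n f') : f = f' := by
  have h1 : toL2 f = toL2 f' := L2_ext h
  exact ContinuousMap.toLp_injective (p := 2) (𝕜 := ℂ) haarAddCircle h1

lemma hasSum_C0_of_summable {f : C0} (h : Summable fun n => coefC n f) :
    HasSum (fun n => coefC n f • ch n) f := by
  simp only [coefC_apply] at h ⊢
  exact hasSum_fourier_series_of_summable h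

lemma memLp_mul (f : C0) (g : L2) : MemLp (fun x => f x * g x) 2 haarAddCircle := by
  refine (Lp.memLp g).of_le_mul (c := ‖f‖) ?_ ?_
  · exact f.continuous.aestronglyMeasurable.mul (Lp.aestronglyMeasurable g)
  · filter_upwards with x
    rw [norm_mul]
    gcongr
    exact f.norm_coe_le_norm x

/-- Multiplication of an `L²` function by a continuous function. -/
def mulL2 : C0 →L[ℂ] L2 →L[ℂ] L2 :=
  LinearMap.mkContinuous₂
    (LinearMap.mk₂ ℂ (fun f g => (memLp_mul f g).toLp _)
      (fun f f' g => by
        rw [← MemLp.toLp_add]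
        exact MemLp.toLp_congr _ _ (.of_forall fun x => add_mul _ _ _))
      (fun c f g => by
        rw [← MemLp.toLp_const_smul]
        exact MemLp.toLp_congr _ _ (.of_forall fun x => by simp [mul_assoc]))
      (fun f g g' => by
        rw [← MemLp.toLp_add]
        refine MemLp.toLp_congr _ _ ?_
        filter_upwards [Lp.coeFn_add g g'] with x hx
        exact (congrArg (f x * ·) hx).trans (mul_add _ _ _))
      (fun c f g => by
        rw [← MemLp.toLp_const_smul]
        refine MemLp.toLp_congr _ _ ?_
        filter_upwards [Lp.coeFn_smul c g] with x hx
        exact (congrArg (f x * ·) hx).trans (mul_left_comm _ _ _)))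
    1 (fun f g => by
      rw [one_mul]
      refine Lp.norm_le_mul_norm_of_ae_le_mul ?_
      filter_upwards [MemLp.coeFn_toLp (memLp_mul f g)] with x hx
      simp only [LinearMap.mk₂_apply]
      rw [hx, norm_mul]
      gcongr
      exact f.norm_coe_le_norm x)

lemma coeFn_mulL2 (f : C0) (g : L2) : mulL2 f g =ᵐ[haarAddCircle] fun x => f x * g x :=
  MemLp.coeFn_toLp (memLp_mul f g)

lemma norm_mulL2_le (f : C0) (g : L2) : ‖mulL2 f g‖ ≤ ‖f‖ * ‖g‖ := by
  refine Lp.norm_le_mul_norm_of_ae_le_mul ?_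
  filter_upwards [coeFn_mulL2 f g] with x hx
  rw [hx, norm_mul]
  gcongr
  exact f.norm_coe_le_norm x

lemma coefL2_mulL2_ch (n m : ℤ) (g : L2) : coefL2 n (mulL2 (ch m) g) = coefL2 (n - m) g := by
  rw [coefL2_apply, coefL2_apply, fourierCoeff_congr_ae (coeFn_mulL2 _ _)]
  unfold fourierCoeff
  congr 1
  ext x
  rw [show -(n - m) = -n + m by ring, fourier_add]
  simp [mul_assoc]

lemma mulL2_toL2 (f f' : C0) : mulL2 f (toL2 f') = toL2 (f * f') := by
  refine Lp.ext ?_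
  filter_upwards [coeFn_mulL2 f (toL2 f'), ContinuousMap.coeFn_toLp (p := 2) (𝕜 := ℂ) haarAddCircle f',
    ContinuousMap.coeFn_toLp (p := 2) (𝕜 := ℂ) haarAddCircle (f * f')] with x h1 h2 h3
  rw [h1, h2, h3]; rfl

lemma coefC_mul_ch (n m : ℤ) (f : C0) : coefC n (ch m * f) = coefC (n - m) f := by
  rw [coefC, ContinuousLinearMap.comp_apply, ← mulL2_toL2, coefL2_mulL2_ch]
  rfl

end

section

open AddCircle

/-! ### The algebra of complex `H¹` functions on the circle -/

/-- `g` is the derivative of `f`, expressed through Fourier coefficients. -/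
def IsDeriv (f : C0) (g : L2) : Prop := ∀ n : ℤ, coefL2 n g = 2 * π * Complex.I * n * coefC n f

lemma IsDeriv.unique {f : C0} {g g' : L2} (h : IsDeriv f g) (h' : IsDeriv f g') : g = g' :=
  L2_ext fun n => (h n).trans (h' n).symm

lemma isDeriv_ch (n : ℤ) : IsDeriv (ch n) ((2 * π * Complex.I * n : ℂ) • (fourierLp 2 n : L2)) := by
  intro m
  rw [map_smul, coefL2_ch, coefC_ch]
  split_ifs with h <;> simp [h]

/-- The terms of the weighted square sum that defines the `H¹` norm of a coefficient sequence. -/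
def wsq (a : ℤ → ℂ) (n : ℤ) : ℝ := (1 + (n : ℝ) ^ 2) * ‖a n‖ ^ 2

lemma wsq_nonneg (a : ℤ → ℂ) (n : ℤ) : 0 ≤ wsq a n := by unfold wsq; positivity

lemma summable_inv_one_add_sq : Summable fun n : ℤ => (1 + (n : ℝ) ^ 2)⁻¹ := by
  have h : Summable fun n : ℤ => (((n : ℝ) ^ 2)⁻¹) := by
    simpa using (Real.summable_one_div_int_pow (p := 2)).2 one_lt_two
  refine (summable_of_hasFiniteSupport (f := fun n : ℤ => if n = 0 then (1 : ℝ) else 0) ?_).add h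
    |>.of_nonneg_of_le (fun n => by positivity) (fun n => ?_)
  · exact (Set.finite_singleton (0 : ℤ)).subset (by intro n; simp)
  · by_cases hn : n = 0
    · simp [hn]
    · have : (0 : ℝ) < (n : ℝ) ^ 2 := by positivity
      simp only [hn, if_false, zero_add]
      gcongr
      linarith

/-- The constant of the embedding of `H¹` into the Wiener algebra. -/
def wienerConst : ℝ := √(∑' n : ℤ, (1 + (n : ℝ) ^ 2)⁻¹)

lemma wienerConst_nonneg : 0 ≤ wienerConst := Real.sqrt_nonneg _

/-- Cauchy–Schwarz for (1 + n²)^(-1/2) and (1 + n²)^(1/2)|a n|. This is the Sobolev embedding into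
absolutely convergent Fourier series. -/
lemma summable_norm_and_tsum_le {a : ℤ → ℂ} (h : Summable (wsq a)) :
    (Summable fun n => ‖a n‖) ∧ ∑' n, ‖a n‖ ≤ wienerConst * √(∑' n, wsq a n) := by
  have key := Real.summable_and_inner_le_Lp_mul_Lq_tsum_of_nonneg
    (f := fun n : ℤ => √((1 + (n : ℝ) ^ 2)⁻¹)) (g := fun n : ℤ => √(wsq a n))
    (p := 2) (q := 2) (by constructor <;> norm_num) (fun n => Real.sqrt_nonneg _)
    (fun n => Real.sqrt_nonneg _)
    (by
      refine summable_inv_one_add_sq.congr fun n => ?_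
      rw [Real.rpow_two, Real.sq_sqrt (by positivity)])
    (by
      refine h.congr fun n => ?_
      rw [Real.rpow_two, Real.sq_sqrt (wsq_nonneg _ _)])
  have e : (fun n : ℤ => √((1 + (n : ℝ) ^ 2)⁻¹) * √(wsq a n)) = fun n => ‖a n‖ := by
    ext n
    rw [← Real.sqrt_mul (by positivity), wsq, inv_mul_cancel_left₀ (by positivity),
      Real.sqrt_sq (norm_nonneg _)]
  rw [e] at key
  refine ⟨key.1, key.2.trans (le_of_eq ?_)⟩
  simp only [← Real.sqrt_eq_rpow, wienerConst, Real.rpow_two]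
  congr 2
  · exact tsum_congr fun n => Real.sq_sqrt (by positivity)
  · exact tsum_congr fun n => Real.sq_sqrt (wsq_nonneg _ _)

lemma IsDeriv.wsq_le {f : C0} {g : L2} (h : IsDeriv f g) (n : ℤ) :
    wsq (fun n => coefC n f) n ≤ ‖coefL2 n (toL2 f)‖ ^ 2 + ‖coefL2 n g‖ ^ 2 := by
  have h1 : ‖coefL2 n g‖ ^ 2 = (2 * π) ^ 2 * (n : ℝ) ^ 2 * ‖coefC n f‖ ^ 2 := by
    rw [h n]
    simp [mul_pow, abs_of_pos Real.pi_pos]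
  have h2 : (1 : ℝ) ≤ (2 * π) ^ 2 := by nlinarith [Real.pi_gt_three]
  rw [h1, wsq, show coefL2 n (toL2 f) = coefC n f from rfl]
  have h3 : 0 ≤ (n : ℝ) ^ 2 * ‖coefC n f‖ ^ 2 := by positivity
  nlinarith

lemma IsDeriv.summable_wsq {f : C0} {g : L2} (h : IsDeriv f g) :
    Summable (wsq fun n => coefC n f) :=
  ((hasSum_sq_coefL2 (toL2 f)).summable.add (hasSum_sq_coefL2 g).summable).of_nonneg_of_le
    (wsq_nonneg _) h.wsq_le

lemma IsDeriv.tsum_wsq_le {f : C0} {g : L2} (h : IsDeriv f g) :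
    ∑' n, wsq (fun n => coefC n f) n ≤ ‖toL2 f‖ ^ 2 + ‖g‖ ^ 2 := by
  have h1 := (hasSum_sq_coefL2 (toL2 f)).add (hasSum_sq_coefL2 g)
  exact h1.tsum_eq ▸ h.summable_wsq.tsum_le_tsum h.wsq_le h1.summable

lemma IsDeriv.hasSum {f : C0} {g : L2} (h : IsDeriv f g) :
    HasSum (fun n => coefC n f • ch n) f :=
  hasSum_C0_of_summable (summable_norm_and_tsum_le h.summable_wsq).1.of_norm

/-- Leibniz rule. Only the first factor is expanded into characters; multiplication by the character
n shifts coefficients, and the identity reduces to k = (k - n) + n. -/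
lemma IsDeriv.mul {f f' : C0} {g g' : L2} (h : IsDeriv f g) (h' : IsDeriv f' g') :
    IsDeriv (f * f') (mulL2 f g' + mulL2 f' g) := by
  intro k
  -- The defect of the Leibniz rule at frequency k is continuous and linear in the pair (f, g). The
  -- Fourier series of f converges uniformly and that of g in L², so it suffices that the defect
  -- vanishes on each term.
  set B : C0 × L2 →L[ℂ] ℂ :=
    coefL2 k ∘L (mulL2.flip g') ∘L ContinuousLinearMap.fst ℂ C0 L2
      + coefL2 k ∘L (mulL2 f') ∘L ContinuousLinearMap.snd ℂ C0 L2
      - (2 * π * Complex.I * k : ℂ) • (coefC k ∘L ((ContinuousLinearMap.mul ℂ C0).flip f')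
        ∘L ContinuousLinearMap.fst ℂ C0 L2) with hB
  have hB' : ∀ x, B x = coefL2 k (mulL2 x.1 g') + coefL2 k (mulL2 f' x.2)
      - (2 * π * Complex.I * k : ℂ) * coefC k (x.1 * f') := fun x => rfl
  have hs : HasSum (fun n => (coefC n f • ch n, coefL2 n g • (fourierLp 2 n : L2))) (f, g) :=
    h.hasSum.prodMk (hasSum_L2 g)
  have hs' := B.hasSum hs
  have h0 : ∀ n, B (coefC n f • ch n, coefL2 n g • (fourierLp 2 n : L2)) = 0 := by
    intro n
    rw [h n]
    have e1 : coefL2 k (mulL2 f' (fourierLp 2 n : L2)) = coefC (k - n) f' := by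
      have : (fourierLp 2 n : L2) = toL2 (ch n) := rfl
      rw [this, mulL2_toL2, mul_comm, ← coefC_mul_ch]
      rfl
    rw [hB']
    simp only [map_smul, smul_mul_assoc, _root_.smul_apply, smul_eq_mul,
      coefL2_mulL2_ch, coefC_mul_ch, e1]
    rw [h' (k - n)]
    push_cast
    ring
  simp only [h0] at hs'
  have := hs'.unique hasSum_zero
  rw [hB'] at this
  rw [map_add]
  linear_combination this

/-- The functions with a square-integrable derivative form a subalgebra of the continuous
functions. -/
def h1Subalgebra : Subalgebra ℂ C0 where
  carrier := {f | ∃ g, IsDeriv f g}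
  mul_mem' := fun ⟨_, h⟩ ⟨_, h'⟩ => ⟨_, h.mul h'⟩
  add_mem' := fun ⟨g, h⟩ ⟨g', h'⟩ => ⟨g + g', fun n => by rw [map_add, map_add, h n, h' n]; ring⟩
  algebraMap_mem' := fun c => ⟨0, fun n => by
    have : algebraMap ℂ C0 c = c • ch 0 := by
      ext x; simp
    rw [this, map_smul, coefC_ch]
    split_ifs with hn <;> simp [hn]⟩

/-- The complex Sobolev space `H¹` of the circle. -/
def H1 : Type := h1Subalgebra

namespace H1

instance : CommRing H1 := inferInstanceAs (CommRing h1Subalgebra)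
instance : Algebra ℂ H1 := inferInstanceAs (Algebra ℂ h1Subalgebra)

/-- The underlying continuous function, as an algebra homomorphism. -/
def toC0 : H1 →ₐ[ℂ] C0 := h1Subalgebra.val

lemma toC0_injective : Function.Injective toC0 := Subtype.val_injective

lemma exists_isDeriv (f : H1) : ∃ g, IsDeriv (toC0 f) g := f.2

/-- The derivative. -/
def D : H1 →ₗ[ℂ] L2 where
  toFun f := f.exists_isDeriv.choose
  map_add' f f' := by
    refine (f + f').exists_isDeriv.choose_spec.unique fun n => ?_
    rw [map_add, f.exists_isDeriv.choose_spec n, f'.exists_isDeriv.choose_spec n, map_add, map_add]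
    ring
  map_smul' c f := by
    refine (c • f).exists_isDeriv.choose_spec.unique fun n => ?_
    rw [RingHom.id_apply, map_smul, f.exists_isDeriv.choose_spec n, map_smul, map_smul, smul_eq_mul,
      smul_eq_mul]
    ring

lemma isDeriv (f : H1) : IsDeriv (toC0 f) (D f) := f.exists_isDeriv.choose_spec

lemma D_eq {f : H1} {g : L2} (h : IsDeriv (toC0 f) g) : D f = g := f.isDeriv.unique h

lemma D_mul (f f' : H1) : D (f * f') = mulL2 (toC0 f) (D f') + mulL2 (toC0 f') (D f) :=
  D_eq (by rw [map_mul]; exact f.isDeriv.mul f'.isDeriv)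

/-- Taking the sup norm of f instead of its L² norm makes the norm submultiplicative with constant
1, straight from the Leibniz rule. `H1` is a type of its own, so the sup norm of the subalgebra is
not inherited. -/
instance : NormedAddCommGroup H1 :=
  AddGroupNorm.toNormedAddCommGroup
    { toFun := fun f => ‖toC0 f‖ + ‖D f‖
      map_zero' := by simp
      add_le' := fun f f' => by
        rw [map_add, map_add]
        linarith [norm_add_le (toC0 f) (toC0 f'), norm_add_le (D f) (D f')]
      neg' := fun f => by rw [map_neg, map_neg, norm_neg, norm_neg]
      eq_zero_of_map_eq_zero' := fun f h => by
        have h1 : ‖toC0 f‖ = 0 := by linarith [norm_nonneg (toC0 f), norm_nonneg (D f)]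
        exact toC0_injective (by rw [norm_eq_zero.1 h1, map_zero]) }

lemma norm_def (f : H1) : ‖f‖ = ‖toC0 f‖ + ‖D f‖ := rfl

instance : NormedCommRing H1 :=
  { (inferInstance : CommRing H1), (inferInstance : NormedAddCommGroup H1) with
    norm_mul_le := fun f f' => by
      simp only [norm_def, D_mul, map_mul]
      have h1 := norm_mul_le (toC0 f) (toC0 f')
      have h2 := norm_add_le (mulL2 (toC0 f) (D f')) (mulL2 (toC0 f') (D f))
      have h3 := norm_mulL2_le (toC0 f) (D f')
      have h4 := norm_mulL2_le (toC0 f') (D f)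
      nlinarith [mul_nonneg (norm_nonneg (D f)) (norm_nonneg (D f'))] }

instance : NormedAlgebra ℂ H1 :=
  { (inferInstance : Algebra ℂ H1) with
    norm_smul_le := fun c f => by
      rw [norm_def, norm_def, map_smul, map_smul, norm_smul, norm_smul, mul_add] }

/-- `toC0` as a continuous linear map. -/
def toC0L : H1 →L[ℂ] C0 :=
  toC0.toLinearMap.mkContinuous 1 fun f => by
    rw [one_mul, norm_def]
    exact le_add_of_nonneg_right (norm_nonneg _)

/-- `D` as a continuous linear map. -/
def DL : H1 →L[ℂ] L2 :=
  D.mkContinuous 1 fun f => by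
    rw [one_mul, norm_def]
    exact le_add_of_nonneg_left (norm_nonneg _)

/-- The derivative is a closed operator: each coefficient identity in `IsDeriv` survives limits that
are uniform in f and L² in g. -/
instance : CompleteSpace H1 := by
  refine Metric.complete_of_cauchySeq_tendsto fun s hs => ?_
  obtain ⟨f, hf⟩ := cauchySeq_tendsto_of_complete (toC0L.uniformContinuous.comp_cauchySeq hs)
  obtain ⟨g, hg⟩ := cauchySeq_tendsto_of_complete (DL.uniformContinuous.comp_cauchySeq hs)
  have hd : IsDeriv f g := fun n => by
    refine tendsto_nhds_unique (((coefL2 n).continuous.tendsto g).comp hg) ?_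
    refine ((((coefC n).continuous.tendsto f).comp hf).const_mul _).congr fun k => ?_
    exact ((s k).isDeriv n).symm
  let F : H1 := ⟨f, g, hd⟩
  have hF : D F = g := D_eq hd
  refine ⟨F, ?_⟩
  rw [tendsto_iff_norm_sub_tendsto_zero] at hf hg ⊢
  have := hf.add hg
  rw [add_zero] at this
  refine this.congr fun k => ?_
  rw [norm_def, map_sub, map_sub, hF]
  rfl

end H1

end

section

open AddCircle

namespace H1

/-! ### Fourier coefficients of `H¹` functions -/

/-- The `n`-th Fourier coefficient. -/
def coef (n : ℤ) : H1 →L[ℂ] ℂ := coefC n ∘L toC0L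

lemma coef_def (n : ℤ) (f : H1) : coef n f = coefC n (toC0 f) := rfl

lemma ext_coef {f f' : H1} (h : ∀ n, coef n f = coef n f') : f = f' :=
  toC0_injective (C0_ext h)

/-- Evaluation at a point. -/
def ev (x : UnitAddCircle) : H1 →L[ℂ] ℂ := ContinuousMap.evalCLM ℂ x ∘L toC0L

lemma ev_def (x : UnitAddCircle) (f : H1) : ev x f = toC0 f x := rfl

lemma ext_ev {f f' : H1} (h : ∀ x, ev x f = ev x f') : f = f' :=
  toC0_injective (ContinuousMap.ext h)

@[simp] lemma ev_mul (x : UnitAddCircle) (f f' : H1) : ev x (f * f') = ev x f * ev x f' := by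
  simp [ev_def]

@[simp] lemma ev_one (x : UnitAddCircle) : ev x (1 : H1) = 1 := by
  simp [ev_def]

lemma continuous_ev (f : H1) : Continuous fun x => ev x f := (toC0 f).continuous

lemma norm_ev_le (x : UnitAddCircle) (f : H1) : ‖ev x f‖ ≤ ‖f‖ :=
  ((toC0 f).norm_coe_le_norm x).trans (le_add_of_nonneg_right (norm_nonneg _))

lemma norm_coef_le (n : ℤ) (f : H1) : ‖coef n f‖ ≤ ‖f‖ :=
  (norm_coefC_le n _).trans (le_add_of_nonneg_right (norm_nonneg _))

/-- The `H¹` function given by a continuous function with its derivative. -/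
def ofDeriv (f : C0) (g : L2) (h : IsDeriv f g) : H1 := ⟨f, g, h⟩

@[simp] lemma toC0_ofDeriv {f : C0} {g : L2} (h : IsDeriv f g) : toC0 (ofDeriv f g h) = f := rfl

lemma D_ofDeriv {f : C0} {g : L2} (h : IsDeriv f g) : D (ofDeriv f g h) = g := D_eq h

/-- The characters as elements of `H¹`. -/
def chr (n : ℤ) : H1 := ofDeriv _ _ (isDeriv_ch n)

@[simp] lemma ev_chr (x : UnitAddCircle) (n : ℤ) : ev x (chr n) = fourier n x := rfl

lemma coef_chr (n m : ℤ) : coef n (chr m) = if n = m then 1 else 0 := coefC_ch n m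

lemma chr_zero : chr 0 = 1 := ext_ev fun x => by simp

lemma D_chr (n : ℤ) : D (chr n) = (2 * π * Complex.I * n : ℂ) • (fourierLp 2 n : L2) :=
  D_eq (isDeriv_ch n)

lemma hasSum_chr (f : H1) : HasSum (fun n => coef n f • chr n) f := by
  have h1 : HasSum (fun n => coef n f • ch n) (toC0 f) := f.isDeriv.hasSum
  have h2 : HasSum (fun n => D (coef n f • chr n)) (D f) := by
    convert hasSum_L2 (D f) using 2 with n
    rw [map_smul, D_chr, f.isDeriv n, smul_smul, mul_comm]
    rfl
  unfold HasSum at *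
  rw [tendsto_iff_norm_sub_tendsto_zero] at *
  have := h1.add h2
  rw [add_zero] at this
  refine this.congr fun s => ?_
  rw [norm_def, map_sub, map_sub, map_sum, map_sum]
  rfl

/-- Fourier series converge in the norm of `H1`, so characters span a dense subspace. The pointwise
formulas for dilation, multiplier and convolution operators below are proved this way. -/
lemma clm_ext {E : Type*} [NormedAddCommGroup E] [NormedSpace ℂ E] {L L' : H1 →L[ℂ] E}
    (h : ∀ n, L (chr n) = L' (chr n)) : L = L' := by
  ext f
  have h1 := L.hasSum (hasSum_chr f)
  have h2 := L'.hasSum (hasSum_chr f)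
  simp only [map_smul, h] at h1 h2
  exact h1.unique h2

lemma summable_wsq (f : H1) : Summable (wsq fun n => coef n f) := f.isDeriv.summable_wsq

lemma sqrt_tsum_wsq_le (f : H1) : √(∑' n, wsq (fun n => coef n f) n) ≤ ‖f‖ := by
  rw [norm_def]
  refine Real.sqrt_le_iff.2 ⟨by positivity, f.isDeriv.tsum_wsq_le.trans ?_⟩
  have := norm_C0_toL2_le (toC0 f)
  nlinarith [norm_nonneg (toL2 (toC0 f)), norm_nonneg (D f), norm_nonneg (toC0 f)]

/-! ### Operators defined by their action on Fourier coefficients -/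

/-- The function is a uniformly convergent series and its derivative comes from Riesz–Fischer. The
constant `wienerConst` pays for the sup norm and 2π for the derivative. -/
lemma exists_ofCoeff {a : ℤ → ℂ} (h : Summable (wsq a)) :
    ∃ f : H1, (∀ n, coef n f = a n) ∧ ‖f‖ ≤ (wienerConst + 2 * π) * √(∑' n, wsq a n) := by
  obtain ⟨hs, hle⟩ := summable_norm_and_tsum_le h
  have hsum : Summable fun n => a n • ch n :=
    Summable.of_norm (by simpa only [norm_smul, fourier_norm, mul_one] using hs)
  have hco : ∀ n, coefC n (∑' m, a m • ch m) = a n := fun n => by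
    rw [(coefC n).map_tsum hsum, tsum_eq_single n]
    · simp [coefC_ch]
    · intro m hm
      simp [coefC_ch, hm.symm]
  have hterm : ∀ n : ℤ, ‖(2 * π * Complex.I * n : ℂ) * a n‖ ^ 2 ≤ (2 * π) ^ 2 * wsq a n := by
    intro n
    simp only [wsq, norm_mul, Complex.norm_I, Complex.norm_intCast, Complex.norm_real,
      Real.norm_eq_abs, abs_of_pos Real.pi_pos, mul_pow, sq_abs, Complex.norm_ofNat]
    have : 0 ≤ 2 ^ 2 * π ^ 2 * ‖a n‖ ^ 2 := by positivity
    nlinarith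
  have hmem : Memℓp (fun n : ℤ => (2 * π * Complex.I * n : ℂ) * a n) 2 := by
    refine memℓp_gen ?_
    simp only [ENNReal.toReal_ofNat, Real.rpow_two]
    exact (h.mul_left _).of_nonneg_of_le (fun n => by positivity) hterm
  let g : L2 := fourierBasis.repr.symm ⟨_, hmem⟩
  have hg : ∀ n, coefL2 n g = (2 * π * Complex.I * n : ℂ) * a n := fun n => by
    rw [coefL2_apply, ← fourierBasis_repr]
    simp [g]
  have hd : IsDeriv (∑' m, a m • ch m) g := fun n => by rw [hg, hco]
  refine ⟨ofDeriv _ g hd, hco, ?_⟩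
  rw [norm_def, add_mul, D_ofDeriv, toC0_ofDeriv]
  gcongr
  · refine (tsum_of_norm_bounded hs.hasSum fun n => ?_).trans hle
    rw [norm_smul, fourier_norm, mul_one]
  · refine le_of_sq_le_sq ?_ (by positivity)
    rw [mul_pow, Real.sq_sqrt (tsum_nonneg (wsq_nonneg a)), ← (hasSum_sq_coefL2 g).tsum_eq,
      ← tsum_mul_left]
    refine (hasSum_sq_coefL2 g).summable.tsum_le_tsum (fun n => ?_) (h.mul_left _)
    rw [hg]
    exact hterm n

/-- The `H¹` function with given coefficients. -/
def ofCoeff (a : ℤ → ℂ) (h : Summable (wsq a)) : H1 := (exists_ofCoeff h).choose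

@[simp] lemma coef_ofCoeff (a : ℤ → ℂ) (h : Summable (wsq a)) (n : ℤ) :
    coef n (ofCoeff a h) = a n := (exists_ofCoeff h).choose_spec.1 n

/-- The constant in the equivalence of the norm of `H¹` and the norm given by the coefficients. -/
def normConst : ℝ := wienerConst + 2 * π

lemma normConst_nonneg : 0 ≤ normConst := by
  have := wienerConst_nonneg
  unfold normConst; positivity

lemma norm_le_sqrt_tsum (f : H1) : ‖f‖ ≤ normConst * √(∑' n, wsq (fun n => coef n f) n) := by
  obtain ⟨f', h1, h2⟩ := exists_ofCoeff f.summable_wsq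
  rwa [ext_coef h1] at h2

lemma norm_le_of_wsq_le {f f' : H1} {C : ℝ} (hC : 0 ≤ C)
    (h : ∀ n, wsq (fun n => coef n f) n ≤ C ^ 2 * wsq (fun n => coef n f') n) :
    ‖f‖ ≤ normConst * C * ‖f'‖ := by
  refine f.norm_le_sqrt_tsum.trans ?_
  rw [mul_assoc]
  gcongr ?_ * ?_
  · exact normConst_nonneg
  refine le_trans ?_ (mul_le_mul_of_nonneg_left f'.sqrt_tsum_wsq_le hC)
  rw [← Real.sqrt_sq hC, ← Real.sqrt_mul (sq_nonneg C), ← tsum_mul_left]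
  exact Real.sqrt_le_sqrt (f.summable_wsq.tsum_le_tsum h (f'.summable_wsq.mul_left _))

/-- Symbols of Fourier multipliers. -/
abbrev Symb := BoundedContinuousFunction ℤ ℂ

lemma wsq_mult_le (c : Symb) (a : ℤ → ℂ) (n : ℤ) :
    wsq (fun n => c n * a n) n ≤ ‖c‖ ^ 2 * wsq a n := by
  simp only [wsq, norm_mul, mul_pow]
  have : ‖c n‖ ^ 2 ≤ ‖c‖ ^ 2 := by
    gcongr
    exact c.norm_coe_le_norm n
  have h : 0 ≤ (1 + (n : ℝ) ^ 2) * ‖a n‖ ^ 2 := by positivity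
  nlinarith

lemma summable_wsq_mult (c : Symb) (f : H1) : Summable (wsq fun n => c n * coef n f) :=
  (f.summable_wsq.mul_left (‖c‖ ^ 2)).of_nonneg_of_le (wsq_nonneg _) (wsq_mult_le c _)

/-- The Fourier multiplier with a given symbol. -/
def mult : Symb →L[ℂ] H1 →L[ℂ] H1 :=
  LinearMap.mkContinuous₂
    (LinearMap.mk₂ ℂ (fun c f => ofCoeff _ (summable_wsq_mult c f))
      (fun c c' f => ext_coef fun n => by simp [add_mul])
      (fun r c f => ext_coef fun n => by simp [mul_assoc])
      (fun c f f' => ext_coef fun n => by simp [mul_add])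
      (fun r c f => ext_coef fun n => by simp [mul_left_comm]))
    normConst (fun c f => by
      refine norm_le_of_wsq_le (norm_nonneg c) fun n => ?_
      simp only [LinearMap.mk₂_apply, coef_ofCoeff]
      exact wsq_mult_le c _ n)

@[simp] lemma coef_mult (c : Symb) (f : H1) (n : ℤ) : coef n (mult c f) = c n * coef n f :=
  coef_ofCoeff _ (summable_wsq_mult c f) n

lemma mult_chr (c : Symb) (m : ℤ) : mult c (chr m) = c m • chr m := ext_coef fun n => by
  simp only [coef_mult, coef_chr, map_smul, smul_eq_mul]
  split_ifs with h <;> simp [h]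

/-- The symbol given by the Fourier coefficients of a function. -/
def symbol : H1 →L[ℂ] Symb :=
  LinearMap.mkContinuous
    { toFun := fun f => BoundedContinuousFunction.ofNormedAddCommGroupDiscrete (fun n => coef n f)
        ‖f‖ (fun n => norm_coef_le n f)
      map_add' := fun f f' => by ext n; simp
      map_smul' := fun c f => by ext n; simp }
    1 (fun f => by
      rw [one_mul]
      exact (BoundedContinuousFunction.norm_le (norm_nonneg _)).2 fun n => norm_coef_le n f)

/-- Convolution. -/
def conv : H1 →L[ℂ] H1 →L[ℂ] H1 := mult ∘L symbol

lemma coef_conv (f f' : H1) (n : ℤ) : coef n (conv f f') = coef n f * coef n f' :=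
  coef_mult _ _ _

/-- Pull-back along x ↦ j • x moves the mode n to the mode j * n, so the coefficient sequence is
extended by zero along n ↦ j * n. -/
lemma wsq_extend (j : ℤ) (hj : j ≠ 0) (a : ℤ → ℂ) :
    wsq (Function.extend (j * ·) a 0) =
      Function.extend (j * ·) (fun n => (1 + ((j * n : ℤ) : ℝ) ^ 2) * ‖a n‖ ^ 2) 0 := by
  have hinj : Function.Injective (j * · : ℤ → ℤ) := mul_right_injective₀ hj
  ext m
  by_cases hm : ∃ n, j * n = m
  · obtain ⟨n, rfl⟩ := hm
    have e1 := hinj.extend_apply a 0 n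
    have e2 := hinj.extend_apply (fun n => (1 + ((j * n : ℤ) : ℝ) ^ 2) * ‖a n‖ ^ 2) 0 n
    rw [wsq, e2, e1]
  · rw [wsq, Function.extend_apply' _ _ _ hm, Function.extend_apply' _ _ _ hm]
    simp

lemma extend_term_le (j : ℤ) (hj : j ≠ 0) (a : ℤ → ℂ) (n : ℤ) :
    (1 + ((j * n : ℤ) : ℝ) ^ 2) * ‖a n‖ ^ 2 ≤ (j : ℝ) ^ 2 * wsq a n := by
  have : (1 : ℝ) ≤ (j : ℝ) ^ 2 := by
    exact_mod_cast Int.one_le_abs (pow_ne_zero 2 hj) |>.trans_eq (abs_of_nonneg (sq_nonneg j))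
  rw [wsq]
  push_cast
  have h : 0 ≤ ‖a n‖ ^ 2 := by positivity
  nlinarith

lemma hasSum_wsq_extend (j : ℤ) (hj : j ≠ 0) {a : ℤ → ℂ} (h : Summable (wsq a)) :
    Summable (wsq (Function.extend (j * ·) a 0)) ∧
      ∑' n, wsq (Function.extend (j * ·) a 0) n ≤ (j : ℝ) ^ 2 * ∑' n, wsq a n := by
  have h1 : Summable fun n : ℤ => (1 + ((j * n : ℤ) : ℝ) ^ 2) * ‖a n‖ ^ 2 :=
    (h.mul_left ((j : ℝ) ^ 2)).of_nonneg_of_le (fun n => by positivity) (extend_term_le j hj a)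
  have h2 := (hasSum_extend_zero (mul_right_injective₀ hj)).2 h1.hasSum
  rw [← wsq_extend j hj] at h2
  refine ⟨h2.summable, ?_⟩
  rw [h2.tsum_eq, ← tsum_mul_left]
  exact h1.tsum_le_tsum (extend_term_le j hj a) (h.mul_left _)

/-- The pull-back along `x ↦ j • x`, for `j ≠ 0`. -/
def dil (j : ℤ) (hj : j ≠ 0) : H1 →L[ℂ] H1 :=
  LinearMap.mkContinuous
    { toFun := fun f => ofCoeff _ (hasSum_wsq_extend j hj f.summable_wsq).1
      map_add' := fun f f' => ext_coef fun n => by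
        have hinj : Function.Injective (j * · : ℤ → ℤ) := mul_right_injective₀ hj
        by_cases hn : ∃ m, j * m = n
        · obtain ⟨m, rfl⟩ := hn
          simp only [map_add, coef_ofCoeff]
          rw [hinj.extend_apply, hinj.extend_apply, hinj.extend_apply]
        · simp [Function.extend_apply' _ _ _ hn]
      map_smul' := fun c f => ext_coef fun n => by
        have hinj : Function.Injective (j * · : ℤ → ℤ) := mul_right_injective₀ hj
        by_cases hn : ∃ m, j * m = n
        · obtain ⟨m, rfl⟩ := hn
          simp only [map_smul, coef_ofCoeff, RingHom.id_apply]
          rw [hinj.extend_apply, hinj.extend_apply]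
        · simp [Function.extend_apply' _ _ _ hn] }
    (normConst * |(j : ℝ)|) (fun f => by
      refine (norm_le_sqrt_tsum _).trans ?_
      rw [mul_assoc]
      gcongr ?_ * ?_
      · exact normConst_nonneg
      refine le_trans ?_ (mul_le_mul_of_nonneg_left f.sqrt_tsum_wsq_le (abs_nonneg _))
      rw [← Real.sqrt_sq_eq_abs, ← Real.sqrt_mul (sq_nonneg _)]
      refine Real.sqrt_le_sqrt ?_
      simp only [LinearMap.coe_mk, AddHom.coe_mk, coef_ofCoeff]
      exact (hasSum_wsq_extend j hj f.summable_wsq).2)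

lemma coef_dil (j : ℤ) (hj : j ≠ 0) (f : H1) (n : ℤ) :
    coef n (dil j hj f) = Function.extend (j * ·) (fun n => coef n f) 0 n :=
  coef_ofCoeff _ (hasSum_wsq_extend j hj f.summable_wsq).1 n

lemma dil_chr (j : ℤ) (hj : j ≠ 0) (m : ℤ) : dil j hj (chr m) = chr (j * m) :=
  ext_coef fun n => by
    rw [coef_dil, coef_chr]
    by_cases hn : ∃ k, j * k = n
    · obtain ⟨k, rfl⟩ := hn
      have e := (mul_right_injective₀ hj).extend_apply (fun n => coef n (chr m)) 0 k
      rw [e, coef_chr]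
      simp [hj]
    · rw [Function.extend_apply' _ _ _ hn, if_neg]
      · rfl
      · rintro rfl
        exact hn ⟨m, rfl⟩

lemma ev_dil (j : ℤ) (hj : j ≠ 0) (f : H1) (x : UnitAddCircle) :
    ev x (dil j hj f) = ev (j • x) f := by
  have : ev x ∘L dil j hj = ev (j • x) := clm_ext fun n => by
    simp only [ContinuousLinearMap.comp_apply, dil_chr, ev_chr, fourier_apply, smul_smul, mul_comm]
  exact congrArg (· f) this

lemma summable_wsq_conj (f : H1) :
    Summable (wsq fun n => (starRingEnd ℂ) (coef (-n) f)) := by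
  refine ((Equiv.neg ℤ).summable_iff.2 f.summable_wsq).congr fun n => ?_
  simp [wsq]

/-- Complex conjugation. -/
def cj : H1 →L[ℝ] H1 :=
  LinearMap.mkContinuous
    { toFun := fun f => ofCoeff _ (summable_wsq_conj f)
      map_add' := fun f f' => ext_coef fun n => by simp
      map_smul' := fun c f => ext_coef fun n => by
        simp }
    normConst (fun f => by
      refine (norm_le_sqrt_tsum _).trans ?_
      gcongr ?_ * ?_
      · exact normConst_nonneg
      refine le_trans (le_of_eq ?_) f.sqrt_tsum_wsq_le
      congr 1
      rw [← (Equiv.neg ℤ).tsum_eq]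
      exact tsum_congr fun n => by simp [wsq])

lemma coef_cj (f : H1) (n : ℤ) : coef n (cj f) = (starRingEnd ℂ) (coef (-n) f) :=
  coef_ofCoeff _ f.summable_wsq_conj n

lemma ev_cj (f : H1) (x : UnitAddCircle) : ev x (cj f) = (starRingEnd ℂ) (ev x f) := by
  have h1 := (ev x).hasSum (hasSum_chr (cj f))
  have h2 := ((ev x).hasSum (hasSum_chr f)).map (starRingEnd ℂ) Complex.continuous_conj
  rw [← (Equiv.neg ℤ).hasSum_iff] at h2
  refine h1.unique (h2.congr fun n => ?_)
  simp [coef_cj, ev_chr]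

end H1

end

section

open AddCircle

/-! ### Integral operators on `H¹` -/

lemma measurable_W (r : ℝ) : Measurable (W r) :=
  Measurable.ite (measurableSet_le measurable_norm measurable_const) measurable_const
    measurable_const

lemma abs_W_le (r : ℝ) (x : UnitAddCircle) : |W r x| ≤ 1 := by
  unfold W; split_ifs <;> simp

lemma W_neg (r : ℝ) (x : UnitAddCircle) : W r (-x) = W r x := by simp [W]

lemma integral_exp_symm (r : ℝ) (n : ℤ) :
    ∫ t in (-r)..r, Complex.exp (2 * π * Complex.I * n * t) = (What r n / 2 : ℝ) := by
  by_cases hn : n = 0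
  · simp [hn, What]; ring
  · have hn' : (n : ℂ) ≠ 0 := by exact_mod_cast hn
    have hpi : (π : ℂ) ≠ 0 := by exact_mod_cast Real.pi_ne_zero
    rw [integral_exp_mul_complex (by simp [hn, Complex.I_ne_zero])]
    simp only [What, hn, if_false]
    push_cast
    rw [show (2 * π * Complex.I * n * r : ℂ) = (2 * π * n * r : ℂ) * Complex.I by ring,
      show (2 * π * Complex.I * n * -r : ℂ) = (-(2 * π * n * r) : ℂ) * Complex.I by ring,
      Complex.sin]
    field_simp
    rw [Complex.I_sq]
    ring

lemma integral_W_mul_fourier {r : ℝ} (hr : 0 < r) (hr' : r ≤ 1 / 2) (n : ℤ) :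
    ∫ x : UnitAddCircle, (W r x : ℂ) * fourier n x = (What r n / 2 : ℝ) := by
  rw [← UnitAddCircle.intervalIntegral_preimage (-(1 / 2)), ← integral_exp_symm,
    intervalIntegral.integral_of_le (by norm_num), intervalIntegral.integral_of_le (by linarith)]
  have h1 : Ioc (-r) r = Ioc (-(1 / 2)) (-(1 / 2) + 1) ∩ Ioc (-r) r := by
    rw [eq_comm, inter_eq_right]
    exact Ioc_subset_Ioc (by linarith) (by linarith)
  rw [h1, ← setIntegral_indicator measurableSet_Ioc]
  refine setIntegral_congr_ae measurableSet_Ioc ?_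
  -- The support of the kernel is a closed arc and the interval of integration is half-open; they
  -- differ by the null set {-r}.
  have h2 : ∀ᵐ t : ℝ, t ≠ -r := by simp [ae_iff, measure_singleton]
  filter_upwards [h2] with t ht hmem
  have h3 : ‖(t : UnitAddCircle)‖ = |t| := by
    rw [AddCircle.norm_coe_eq_abs_iff _ one_ne_zero, abs_one]
    exact abs_le.2 ⟨hmem.1.le, by linarith [hmem.2]⟩
  rw [W, h3, fourier_coe_apply]
  by_cases hc : |t| ≤ r
  · rw [if_pos hc, indicator_of_mem (mem_Ioc.2 ⟨lt_of_le_of_ne (abs_le.1 hc).1 ht.symm, (abs_le.1 hc).2⟩)]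
    simp
  · rw [if_neg hc, indicator_of_notMem]
    · simp
    · rintro ⟨h4, h5⟩
      exact hc (abs_le.2 ⟨h4.le, h5⟩)

/-- The factor n from the Lipschitz bound of the sine cancels the 1/n, so the estimate is uniform in
the frequency. This makes the convolution operator continuous in r in operator norm. -/
lemma abs_What_sub_le (r r' : ℝ) (n : ℤ) : |What r n - What r' n| ≤ 4 * |r - r'| := by
  unfold What
  split_ifs with hn
  · rw [← mul_sub, abs_mul, abs_of_pos (by norm_num : (0 : ℝ) < 4)]
  · have h0 : 0 < |(n : ℝ)| := by positivity
    rw [← sub_div, ← mul_sub, abs_div, abs_mul, abs_mul, abs_of_pos Real.pi_pos,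
      div_le_iff₀ (by positivity)]
    have h1 : |Real.sin (2 * π * n * r) - Real.sin (2 * π * n * r')|
        ≤ |2 * π * n * r - 2 * π * n * r'| := by
      have := Real.lipschitzWith_sin.dist_le_mul (2 * π * n * r) (2 * π * n * r')
      simpa [Real.dist_eq] using this
    rw [← mul_sub, abs_mul, abs_mul, abs_mul, abs_of_pos Real.pi_pos] at h1
    simp only [abs_two] at *
    linarith

lemma abs_What_le (r : ℝ) (n : ℤ) : |What r n| ≤ 4 * |r| := by
  have h := abs_What_sub_le r 0 n
  have h0 : What 0 n = 0 := by simp [What]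
  simpa [h0] using h

namespace H1

/-- The symbol of the convolution with the kernel `W r` twisted by a character. -/
def kernelSymb (q : ℕ) (r : ℝ) : Symb :=
  BoundedContinuousFunction.ofNormedAddCommGroupDiscrete
    (fun n => ((What r (q + n) / 2 : ℝ) : ℂ)) (2 * |r|) (fun n => by
      rw [Complex.norm_real, Real.norm_eq_abs, abs_div, abs_two]
      linarith [abs_What_le r (q + n)])

@[simp] lemma kernelSymb_apply (q : ℕ) (r : ℝ) (n : ℤ) :
    kernelSymb q r n = ((What r (q + n) / 2 : ℝ) : ℂ) := rfl

lemma continuous_kernelSymb (q : ℕ) : Continuous (kernelSymb q) := by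
  refine (LipschitzWith.of_dist_le_mul (K := 2) fun r r' => ?_).continuous
  rw [BoundedContinuousFunction.dist_le (by positivity)]
  intro n
  rw [kernelSymb_apply, kernelSymb_apply, Complex.dist_eq, ← Complex.ofReal_sub, Complex.norm_real,
    Real.norm_eq_abs, ← sub_div, abs_div, abs_two, Real.dist_eq, NNReal.coe_ofNat]
  linarith [abs_What_sub_le r r' (q + n)]

/-- The convolution with the kernel `W r`, twisted by a character. -/
def T (q : ℕ) (r : ℝ) : H1 →L[ℂ] H1 := mult (kernelSymb q r)

lemma continuous_T (q : ℕ) : Continuous (T q) := mult.continuous.comp (continuous_kernelSymb q)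

/-- It turns an integral against a fixed kernel into a continuous functional on `H1`, to which
`clm_ext` applies. -/
lemma exists_integral_clm {k : UnitAddCircle → ℂ} (hk : Integrable k) :
    ∃ L : H1 →L[ℂ] ℂ, ∀ f, L f = ∫ y, k y * ev y f := by
  have hi : ∀ f : H1, Integrable fun y => k y * ev y f := fun f =>
    hk.mul_bdd (c := ‖f‖) f.continuous_ev.aestronglyMeasurable
      (.of_forall fun y => norm_ev_le y f)
  refine ⟨LinearMap.mkContinuous
    { toFun := fun f => ∫ y, k y * ev y f
      map_add' := fun f f' => by
        simp only [map_add, mul_add]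
        exact integral_add (hi f) (hi f')
      map_smul' := fun c f => by
        simp only [map_smul, smul_eq_mul, mul_left_comm _ c, RingHom.id_apply]
        exact integral_const_mul c _ } (∫ y, ‖k y‖) (fun f => ?_), fun f => rfl⟩
  rw [← integral_mul_const]
  refine norm_integral_le_of_norm_le (hk.norm.mul_const _) (.of_forall fun y => ?_)
  rw [norm_mul]
  gcongr
  exact norm_ev_le y f

/-- Both sides are continuous in f. On a character, the substitution y ↦ x + y splits off the value
at x and leaves a Fourier coefficient of the kernel, shifted by q because of the factor from the
twisted state. -/
lemma ev_T (q : ℕ) {r : ℝ} (hr : 0 < r) (hr' : r ≤ 1 / 2) (f : H1) (x : UnitAddCircle) :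
    ev x (T q r f) = ∫ y, (W r (x - y) * fourier q (y - x)) * ev y f := by
  have hk : Integrable fun y : UnitAddCircle => (W r (x - y) * fourier q (y - x) : ℂ) := by
    refine Integrable.of_bound (C := 1) ?_ (.of_forall fun y => ?_)
    · refine (Complex.measurable_ofReal.comp
        ((measurable_W r).comp (measurable_const.sub measurable_id))).aestronglyMeasurable.mul ?_
      exact ((fourier (q : ℤ)).continuous.comp (continuous_sub_right x)).aestronglyMeasurable
    · rw [norm_mul, fourier_apply, Circle.norm_coe, mul_one, Complex.norm_real]
      exact abs_W_le _ _
  obtain ⟨L, hL⟩ := exists_integral_clm hk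
  rw [← hL]
  have : ev x ∘L T q r = L := clm_ext fun n => by
    rw [hL, ContinuousLinearMap.comp_apply, T, mult_chr, map_smul, ev_chr,
      ← integral_add_left_eq_self _ x, kernelSymb_apply, ← integral_W_mul_fourier hr hr',
      smul_eq_mul, ← integral_mul_const]
    congr 1
    ext y
    rw [sub_add_cancel_left, W_neg, add_sub_cancel_left, fourier_add]
    simp only [ev_chr, fourier_apply, smul_add, toCircle_add, Circle.coe_mul]
    ring
  exact congrArg (· f) this

lemma coef_eq_integral (f : H1) (n : ℤ) : coef n f = ∫ x, fourier (-n) x * ev x f := by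
  rw [coef_def, coefC_apply, fourierCoeff, ← volume_eq_haar]
  rfl

lemma conv_chr (n : ℤ) (f : H1) : conv (chr n) f = coef n f • chr n := ext_coef fun m => by
  rw [coef_conv, map_smul, coef_chr, smul_eq_mul]
  split_ifs with h <;> simp [h]

lemma ev_conv (f h : H1) (x : UnitAddCircle) :
    ev x (conv f h) = ∫ z, ev (x - z) h * ev z f := by
  have hk : Integrable fun z => ev (x - z) h :=
    Integrable.of_bound (C := ‖h‖)
      (h.continuous_ev.comp (continuous_sub_left x)).aestronglyMeasurable
      (.of_forall fun z => norm_ev_le _ h)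
  obtain ⟨L, hL⟩ := exists_integral_clm hk
  rw [← hL]
  have : ev x ∘L conv.flip h = L := clm_ext fun n => by
    rw [hL, ContinuousLinearMap.comp_apply, ContinuousLinearMap.flip_apply, conv_chr, map_smul,
      ev_chr, ← integral_sub_left_eq_self _ _ x, coef_eq_integral, smul_eq_mul,
      ← integral_mul_const]
    congr 1
    ext z
    rw [sub_sub_cancel]
    simp only [ev_chr, fourier_apply, sub_eq_add_neg, smul_add, smul_neg, toCircle_add,
      Circle.coe_mul, neg_smul]
    ring
  exact congrArg (· f) this

end H1

end

section

open AddCircle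

/-! ### The vector field on `H¹` -/

namespace H1

instance : NormedAlgebra ℚ H1 := NormedAlgebra.restrictScalars ℚ ℂ H1

/-- Evaluation at a point as an algebra homomorphism. -/
def evHom (x : UnitAddCircle) : H1 →ₐ[ℂ] ℂ := (ContinuousMap.evalAlgHom ℂ ℂ x).comp toC0

lemma ev_exp (x : UnitAddCircle) (f : H1) :
    ev x (NormedSpace.exp f) = Complex.exp (ev x f) := by
  rw [Complex.exp_eq_exp_ℂ]
  exact NormedSpace.map_exp (evHom x) (ev x).continuous f

/-- The pairwise interaction. -/
def inter1 (E E' : H1) (T : H1 →L[ℂ] H1) : H1 := E' * T E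

/-- The first higher-order interaction. -/
def inter2 (E E' : H1) (T : H1 →L[ℂ] H1) : H1 :=
  E' * E' * dil 2 two_ne_zero (conv E (T E))

/-- The second higher-order interaction. -/
def inter3 (E E' : H1) (T : H1 →L[ℂ] H1) : H1 :=
  E' * conv E (conv (dil (-1) (by norm_num) E') (T E))

/-- The sum of the interactions. -/
def inter (E E' : H1) (T : H1 →L[ℂ] H1) (lam mu : ℝ) : H1 :=
  inter1 E E' T + lam • inter2 E E' T + mu • inter3 E E' T

/-- Imaginary part. -/
def imag : H1 →L[ℝ] H1 := (-Complex.I / 2 : ℂ) • (ContinuousLinearMap.id ℝ H1 - cj)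

lemma imag_apply (f : H1) : imag f = (-Complex.I / 2 : ℂ) • (f - cj f) := rfl

lemma ev_imag (x : UnitAddCircle) (f : H1) : ev x (imag f) = ((ev x f).im : ℂ) := by
  rw [imag_apply, map_smul, map_sub, ev_cj, Complex.sub_conj, smul_eq_mul]
  push_cast
  linear_combination -((ev x f).im : ℂ) * Complex.I_sq

/-- Subtraction of the value at `0`. -/
def pin : H1 →L[ℂ] H1 := ContinuousLinearMap.id ℂ H1 - (ev 0).smulRight 1

lemma pin_apply (f : H1) : pin f = f - ev 0 f • 1 := rfl

lemma ev_pin (x : UnitAddCircle) (f : H1) : ev x (pin f) = ev x f - ev 0 f := by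
  simp [pin_apply]

/-- The vector field in terms of the perturbation and the parameters. -/
def field (v : H1) (T : H1 →L[ℂ] H1) (lam mu : ℝ) : H1 :=
  pin (imag (inter (NormedSpace.exp (Complex.I • v)) (NormedSpace.exp (-(Complex.I • v))) T lam mu))

end H1

/-! ### Interaction integrals of phases as operators on `H1`. -/

/-- Pairwise interaction of phases. -/
def G1 (Ψ : UnitAddCircle → Real.Angle) (r : ℝ) (x : UnitAddCircle) : ℝ :=
  ∫ y : UnitAddCircle, W r (x - y) * (Ψ y - Ψ x).sin

/-- First higher-order interaction of phases. -/
def G2 (Ψ : UnitAddCircle → Real.Angle) (r : ℝ) (x : UnitAddCircle) : ℝ :=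
  ∫ z : UnitAddCircle, ∫ y : UnitAddCircle, W r (z + y - 2 • x) * (Ψ z + Ψ y - 2 • Ψ x).sin

/-- Second higher-order interaction of phases. -/
def G3 (Ψ : UnitAddCircle → Real.Angle) (r : ℝ) (x : UnitAddCircle) : ℝ :=
  ∫ z : UnitAddCircle, ∫ y : UnitAddCircle, ∫ w : UnitAddCircle,
    W r (z - y + w - x) * (Ψ z - Ψ y + Ψ w - Ψ x).sin

/-- The sum of the interactions of phases. -/
def G (Ψ : UnitAddCircle → Real.Angle) (p : ℝ × ℝ × ℝ) (x : UnitAddCircle) : ℝ :=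
  G1 Ψ p.1 x + p.2.1 * G2 Ψ p.1 x + p.2.2 * G3 Ψ p.1 x

/-- The subtracted integrals are the interactions at x = 0: the phase there vanishes, and evenness
of the kernel handles the pairwise term. This form makes the symmetries of F visible. -/
lemma F_eq_G_sub {Ψ : UnitAddCircle → Real.Angle} (hΨ : Ψ 0 = 0) (p : ℝ × ℝ × ℝ)
    (x : UnitAddCircle) : F Ψ p x = G Ψ p x - G Ψ p 0 := by
  have h1 : ∀ y, W p.1 (0 - y) = W p.1 y := fun y => by rw [zero_sub, W_neg]
  simp only [F, G, G1, G2, G3, hΨ, smul_zero, sub_zero, h1]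
  ring

section Phases

variable (q : ℕ) (v : H1) (vr : UnitAddCircle → ℝ)

/-- The perturbed twisted state. -/
abbrev phase (q : ℕ) (vr : UnitAddCircle → ℝ) (x : UnitAddCircle) : Real.Angle :=
  twist q x + (vr x : Real.Angle)

lemma toCircle_twist (q : ℕ) (x : UnitAddCircle) :
    ((twist q x).toCircle : ℂ) = fourier (q : ℤ) x := by
  induction x using QuotientAddGroup.induction_on with
  | H t =>
    have : twist q (t : UnitAddCircle) = ((2 * π * q * t : ℝ) : Real.Angle) := rfl
    change ((twist q (t : UnitAddCircle)).toCircle : ℂ) = fourier (q : ℤ) (t : UnitAddCircle)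
    rw [this, Real.Angle.toCircle_coe, Circle.coe_exp, fourier_coe_apply]
    congr 1
    push_cast
    ring

lemma sin_eq_im_toCircle (θ : Real.Angle) : θ.sin = ((θ.toCircle : ℂ)).im := by
  simp [Real.Angle.coe_toCircle]

lemma toCircle_coe_real (t : ℝ) :
    (((t : Real.Angle)).toCircle : ℂ) = Complex.exp (Complex.I * t) := by
  rw [Real.Angle.toCircle_coe, Circle.coe_exp, mul_comm]

lemma toCircle_neg_coe_real (t : ℝ) :
    (((t : Real.Angle)).toCircle : ℂ)⁻¹ = Complex.exp (-(Complex.I * t)) := by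
  rw [toCircle_coe_real, Complex.exp_neg]

open H1

/-- `exp (i v)`. -/
abbrev expI (v : H1) : H1 := NormedSpace.exp (Complex.I • v)

/-- `exp (-i v)`. -/
abbrev expNegI (v : H1) : H1 := NormedSpace.exp (-(Complex.I • v))

variable {q v vr}

lemma ev_expI (hv : ∀ x, ev x v = vr x) (x : UnitAddCircle) :
    ev x (expI v) = ((vr x : Real.Angle).toCircle : ℂ) := by
  rw [ev_exp, map_smul, hv, toCircle_coe_real, smul_eq_mul]

lemma ev_expNegI (hv : ∀ x, ev x v = vr x) (x : UnitAddCircle) :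
    ev x (expNegI v) = ((vr x : Real.Angle).toCircle : ℂ)⁻¹ := by
  rw [ev_exp, map_neg, map_smul, hv, toCircle_neg_coe_real, smul_eq_mul]

/-- The innermost integral of each of the three interactions has this form, with θ collecting the
phases of the other oscillators. The twisted state is split as q y = q (y - x) + q x, the first part
going into the kernel of `T`. -/
lemma integral_W_mul_sin (hv : ∀ x, ev x v = vr x) {r : ℝ} (hr : 0 < r) (hr' : r ≤ 1 / 2)
    (x : UnitAddCircle) (θ : Real.Angle) :
    ∫ y, W r (x - y) * (phase q vr y + θ).sin =
      ((θ.toCircle : ℂ) * fourier (q : ℤ) x * ev x (T q r (expI v))).im := by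
  rw [ev_T q hr hr', ← integral_const_mul]
  have hi : Integrable fun y : UnitAddCircle => (θ.toCircle : ℂ) * fourier (q : ℤ) x *
      ((W r (x - y) * fourier q (y - x)) * ev y (expI v)) := by
    refine Integrable.of_bound (C := ‖expI v‖) ?_ (.of_forall fun y => ?_)
    · refine ((((Complex.measurable_ofReal.comp
        ((measurable_W r).comp (measurable_const.sub measurable_id))).aestronglyMeasurable.mul
        ?_).mul (continuous_ev _).aestronglyMeasurable).const_mul _)
      exact ((fourier (q : ℤ)).continuous.comp (continuous_sub_right x)).aestronglyMeasurable
    · simp only [norm_mul, fourier_apply, Circle.norm_coe, mul_one, one_mul, Complex.norm_real]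
      calc _ ≤ 1 * ‖expI v‖ := by
            gcongr
            · exact abs_W_le _ _
            · exact norm_ev_le _ _
        _ = _ := one_mul _
  have := integral_im hi
  simp only [RCLike.im_to_complex] at this
  rw [← this]
  congr 1
  ext y
  rw [ev_expI hv, sin_eq_im_toCircle, Real.Angle.toCircle_add, Real.Angle.toCircle_add,
    Circle.coe_mul, Circle.coe_mul, toCircle_twist, ← Complex.im_ofReal_mul]
  congr 1
  have : (fourier (q : ℤ) y : ℂ) = fourier (q : ℤ) (y - x) * fourier (q : ℤ) x := by
    rw [fourier_apply, fourier_apply, fourier_apply, ← Circle.coe_mul, ← toCircle_add, ← smul_add,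
      sub_add_cancel]
  rw [this]
  ring

lemma integral_im_conv (c : ℂ) (f h : H1) (x : UnitAddCircle) :
    ∫ z, (c * (ev (x - z) h * ev z f)).im = (c * ev x (conv f h)).im := by
  rw [ev_conv, ← integral_const_mul]
  have hi : Integrable fun z : UnitAddCircle => c * (ev (x - z) h * ev z f) :=
    Integrable.of_bound (C := ‖c‖ * (‖h‖ * ‖f‖))
      (continuous_const.mul ((h.continuous_ev.comp (continuous_sub_left x)).mul
        f.continuous_ev)).aestronglyMeasurable
      (.of_forall fun z => by
        rw [norm_mul, norm_mul]
        gcongr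
        · exact norm_ev_le _ _
        · exact norm_ev_le _ _)
  exact integral_im hi

lemma fourier_mul_cancel (q : ℤ) (x y : UnitAddCircle) :
    (fourier q x : ℂ) * fourier q y = fourier q (x + y) := by
  rw [fourier_apply, fourier_apply, fourier_apply, ← Circle.coe_mul, ← toCircle_add, ← smul_add]

lemma G1_eq (hv : ∀ x, ev x v = vr x) {r : ℝ} (hr : 0 < r) (hr' : r ≤ 1 / 2)
    (x : UnitAddCircle) :
    G1 (phase q vr) r x = (ev x (inter1 (expI v) (expNegI v) (T q r))).im := by
  simp only [G1, sub_eq_add_neg _ (phase q vr x)]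
  rw [integral_W_mul_sin hv hr hr', inter1, ev_mul, ev_expNegI hv]
  congr 2
  rw [Real.Angle.toCircle_neg, Real.Angle.toCircle_add, Circle.coe_inv, Circle.coe_mul,
    toCircle_twist, mul_inv, mul_right_comm, inv_mul_cancel₀, one_mul]
  rw [fourier_apply]
  exact Circle.coe_ne_zero _

lemma fourier_ne_zero (n : ℤ) (x : UnitAddCircle) : (fourier n x : ℂ) ≠ 0 := by
  rw [fourier_apply]
  exact Circle.coe_ne_zero _

/-- By evenness of the kernel the inner integral is `T` at the point 2x - z, so the outer one is a
convolution at 2x; this explains the dilation by 2. The twisted phases cancel since (2x - z) + z =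
2x. -/
lemma G2_eq (hv : ∀ x, ev x v = vr x) {r : ℝ} (hr : 0 < r) (hr' : r ≤ 1 / 2)
    (x : UnitAddCircle) :
    G2 (phase q vr) r x = (ev x (inter2 (expI v) (expNegI v) (T q r))).im := by
  have h1 : ∀ z, ∫ y : UnitAddCircle, W r (z + y - 2 • x) *
      (phase q vr z + phase q vr y - 2 • phase q vr x).sin
      = ((ev x (expNegI v) * ev x (expNegI v)) *
        (ev (2 • x - z) (T q r (expI v)) * ev z (expI v))).im := by
    intro z
    have e1 : ∀ y, W r (z + y - 2 • x) = W r (2 • x - z - y) := fun y => by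
      rw [← W_neg]; congr 1; abel
    have e2 : ∀ y, phase q vr z + phase q vr y - 2 • phase q vr x
        = phase q vr y + (phase q vr z - 2 • phase q vr x) := fun y => by abel
    simp only [e1, e2]
    rw [integral_W_mul_sin hv hr hr', ev_expNegI hv, ev_expI hv]
    congr 1
    have e3 : (((phase q vr z - 2 • phase q vr x).toCircle : Circle) : ℂ)
        * fourier (q : ℤ) (2 • x - z) = (((vr x : Real.Angle).toCircle : ℂ)⁻¹ *
          ((vr x : Real.Angle).toCircle : ℂ)⁻¹) * ((vr z : Real.Angle).toCircle : ℂ) := by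
      have e4 : (fourier (q : ℤ) (2 • x - z) : ℂ) * fourier (q : ℤ) z
          = fourier (q : ℤ) x * fourier (q : ℤ) x := by
        rw [fourier_mul_cancel, fourier_mul_cancel, sub_add_cancel, two_smul]
      rw [sub_eq_add_neg, two_smul]
      simp only [Real.Angle.toCircle_add, Real.Angle.toCircle_neg, Circle.coe_mul, Circle.coe_inv,
        toCircle_twist]
      have h0 := Circle.coe_ne_zero (vr x : Real.Angle).toCircle
      have h1 := fourier_ne_zero (q : ℤ) x
      field_simp
      linear_combination e4
    rw [e3]
    ring
  simp only [G2, h1]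
  rw [integral_im_conv, inter2, ev_mul, ev_mul, ev_dil]
  rfl

/-- The inner integral is `T` at x - z + y. The substitution y ↦ -y turns the remaining integrals
into two nested convolutions at x, at the cost of reflecting exp(-iv). -/
lemma G3_eq (hv : ∀ x, ev x v = vr x) {r : ℝ} (hr : 0 < r) (hr' : r ≤ 1 / 2)
    (x : UnitAddCircle) :
    G3 (phase q vr) r x = (ev x (inter3 (expI v) (expNegI v) (T q r))).im := by
  set k : H1 := dil (-1) (by norm_num) (expNegI v) with hk
  have hkev : ∀ y, ev y k = ev (-y) (expNegI v) := fun y => by rw [hk, ev_dil, neg_one_smul]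
  have h1 : ∀ z y, ∫ w : UnitAddCircle, W r (z - y + w - x) *
      (phase q vr z - phase q vr y + phase q vr w - phase q vr x).sin
      = ((ev z (expI v) * ev x (expNegI v)) *
        (ev (x - z - -y) (T q r (expI v)) * ev (-y) k)).im := by
    intro z y
    have e1 : ∀ w, W r (z - y + w - x) = W r (x - z - -y - w) := fun w => by
      rw [← W_neg]; congr 1; abel
    have e2 : ∀ w, phase q vr z - phase q vr y + phase q vr w - phase q vr x
        = phase q vr w + (phase q vr z - phase q vr y - phase q vr x) := fun w => by abel
    simp only [e1, e2]
    rw [integral_W_mul_sin hv hr hr', hkev, neg_neg, ev_expNegI hv, ev_expNegI hv, ev_expI hv]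
    congr 1
    have e3 : (((phase q vr z - phase q vr y - phase q vr x).toCircle : Circle) : ℂ)
        * fourier (q : ℤ) (x - z - -y) = ((vr z : Real.Angle).toCircle : ℂ) *
          ((vr x : Real.Angle).toCircle : ℂ)⁻¹ * ((vr y : Real.Angle).toCircle : ℂ)⁻¹ := by
      have e4 : (fourier (q : ℤ) (x - z - -y) : ℂ) * fourier (q : ℤ) z
          = fourier (q : ℤ) x * fourier (q : ℤ) y := by
        rw [fourier_mul_cancel, fourier_mul_cancel]
        congr 1
        abel
      rw [sub_eq_add_neg, sub_eq_add_neg (phase q vr z)]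
      simp only [Real.Angle.toCircle_add, Real.Angle.toCircle_neg, Circle.coe_mul, Circle.coe_inv,
        toCircle_twist]
      have h0 := Circle.coe_ne_zero (vr x : Real.Angle).toCircle
      have h0' := Circle.coe_ne_zero (vr y : Real.Angle).toCircle
      have h1 := fourier_ne_zero (q : ℤ) x
      have h1' := fourier_ne_zero (q : ℤ) y
      field_simp
      linear_combination e4
    rw [e3]
    ring
  have h2 : ∀ z, ∫ y : UnitAddCircle, ((ev z (expI v) * ev x (expNegI v)) *
        (ev (x - z - -y) (T q r (expI v)) * ev (-y) k)).im =
      (ev x (expNegI v) * (ev (x - z) (conv k (T q r (expI v))) * ev z (expI v))).im := by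
    intro z
    rw [integral_neg_eq_self (fun y => ((ev z (expI v) * ev x (expNegI v)) *
        (ev (x - z - y) (T q r (expI v)) * ev y k)).im), integral_im_conv]
    congr 1
    ring
  simp only [G3, h1, h2]
  rw [integral_im_conv, inter3, ev_mul]

lemma ev_field (hv : ∀ x, ev x v = vr x) (h0 : vr 0 = 0) {p : ℝ × ℝ × ℝ} (hp : p ∈ paramSpace)
    (x : UnitAddCircle) : ev x (field v (T q p.1) p.2.1 p.2.2) = Fq q vr p x := by
  have h1 : ∀ x, (ev x (inter (expI v) (expNegI v) (T q p.1) p.2.1 p.2.2)).im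
      = G (phase q vr) p x := fun x => by
    rw [G, G1_eq hv hp.1 hp.2, G2_eq hv hp.1 hp.2, G3_eq hv hp.1 hp.2, inter, map_add, map_add,
      ← Complex.coe_smul, ← Complex.coe_smul, map_smul, map_smul]
    simp
  have hph : phase q vr 0 = 0 := by
    have : twist q 0 = ((2 * π * q * 0 : ℝ) : Real.Angle) := rfl
    rw [phase, h0, this]
    simp
  rw [field, ev_pin, ev_imag, ev_imag, h1, h1]
  rw [Fq, F_eq_G_sub hph]
  push_cast
  rfl

end Phases

end

section

open AddCircle

/-! ### A quantitative implicit function theorem relative to a closed subspace -/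

/-- Zeros of S ∘ f are fixed points of y ↦ y - S (f (v + y, p)). As S inverts the partial derivative
on X, strict differentiability makes this map a contraction of X, uniformly in nearby p. The radius
of uniqueness ρ₀ is fixed before ρ, so the solution can be forced into any smaller ball by shrinking
v and p - p₀. -/
lemma exists_unique_zero_near {E P : Type*} [NormedAddCommGroup E] [NormedSpace ℝ E]
    [CompleteSpace E] [NormedAddCommGroup P] [NormedSpace ℝ P]
    {f : E × P → E} {f' : E × P →L[ℝ] E} {p₀ : P} (hf : HasStrictFDerivAt f f' (0, p₀))
    (X : Submodule ℝ E) (hX : IsClosed (X : Set E)) (S : E →L[ℝ] E)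
    (hS : ∀ y ∈ X, S (f' (y, 0)) = y) :
    ∃ ρ₀ > 0, ∀ ρ > 0, ρ ≤ ρ₀ → ∃ η > 0, ∀ v p, ‖v‖ < η → ‖p - p₀‖ < η → f (0, p) = 0 →
      (∀ y ∈ X, S (f (v + y, p)) ∈ X) →
      (∃ y ∈ X, ‖y‖ < ρ ∧ S (f (v + y, p)) = 0) ∧
      ∀ y₁ ∈ X, ∀ y₂ ∈ X, ‖y₁‖ < ρ₀ → ‖y₂‖ < ρ₀ → S (f (v + y₁, p)) = 0 →
        S (f (v + y₂, p)) = 0 → y₁ = y₂ := by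
  set c : ℝ := (2 * (‖S‖ + 1))⁻¹ with hc
  have hc0 : 0 < c := by positivity
  have hSc : ‖S‖ * c ≤ 1 / 2 := by
    rw [hc, ← div_eq_mul_inv, div_le_iff₀ (by positivity)]
    linarith
  obtain ⟨δ, hδ, hball⟩ := Metric.eventually_nhds_iff_ball.1 (hf.isLittleO.def hc0)
  have hmem : ∀ v y : E, ∀ p : P, ‖v‖ < δ / 2 → ‖y‖ < δ / 2 → ‖p - p₀‖ < δ →
      (v + y, p) ∈ Metric.ball ((0 : E), p₀) δ := by
    intro v y p hv hy hp
    rw [Metric.mem_ball, Prod.dist_eq, max_lt_iff, dist_zero_right, dist_eq_norm]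
    exact ⟨(norm_add_le v y).trans_lt (by linarith), hp⟩
  have hest : ∀ x₁ x₂ : E, ∀ p : P, (x₁, p) ∈ Metric.ball ((0 : E), p₀) δ →
      (x₂, p) ∈ Metric.ball ((0 : E), p₀) δ →
      ‖f (x₁, p) - f (x₂, p) - f' (x₁ - x₂, 0)‖ ≤ c * ‖x₁ - x₂‖ := by
    intro x₁ x₂ p h₁ h₂
    have := hball ((x₁, p), (x₂, p)) (by
      rw [← ball_prod_same]
      exact ⟨h₁, h₂⟩)
    simpa using this
  refine ⟨δ / 2, by positivity, fun ρ hρ hρ' => ?_⟩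
  -- B ‖v‖ bounds the image of y = 0: since f (0, p) = 0, the size of f (v, p) is controlled by v
  -- alone. The summand 1 keeps B positive.
  set B : ℝ := ‖S‖ * (c + ‖f'‖) + 1 with hB
  have hB0 : 0 < B := by positivity
  refine ⟨min (δ / 2) (ρ / 4 / B), by positivity, fun v p hv hp hf0 hSX => ?_⟩
  have hv1 : ‖v‖ < δ / 2 := hv.trans_le (min_le_left _ _)
  have hv2 : ‖v‖ < ρ / 4 / B := hv.trans_le (min_le_right _ _)
  have hp1 : ‖p - p₀‖ < δ := (hp.trans_le (min_le_left _ _)).trans (by linarith)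
  set Θ : E → E := fun y => y - S (f (v + y, p)) with hΘ
  have hlip : ∀ y₁ ∈ X, ∀ y₂ ∈ X, ‖y₁‖ < δ / 2 → ‖y₂‖ < δ / 2 →
      ‖Θ y₁ - Θ y₂‖ ≤ 1 / 2 * ‖y₁ - y₂‖ := by
    intro y₁ h₁ y₂ h₂ hn₁ hn₂
    have e : Θ y₁ - Θ y₂ = -S (f (v + y₁, p) - f (v + y₂, p) - f' (v + y₁ - (v + y₂), 0)) := by
      rw [map_sub, map_sub, add_sub_add_left_eq_sub, hS _ (X.sub_mem h₁ h₂)]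
      change y₁ - S (f (v + y₁, p)) - (y₂ - S (f (v + y₂, p))) = _
      generalize S (f (v + y₁, p)) = a
      generalize S (f (v + y₂, p)) = b
      abel
    rw [e, norm_neg]
    refine (S.le_opNorm _).trans ?_
    calc ‖S‖ * _ ≤ ‖S‖ * (c * ‖v + y₁ - (v + y₂)‖) := by
          gcongr
          exact hest _ _ _ (hmem _ _ _ hv1 hn₁ hp1) (hmem _ _ _ hv1 hn₂ hp1)
      _ = (‖S‖ * c) * ‖y₁ - y₂‖ := by rw [add_sub_add_left_eq_sub]; ring
      _ ≤ _ := by gcongr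
  have hΘX : ∀ y ∈ X, Θ y ∈ X := fun y hy => X.sub_mem hy (hSX y hy)
  have hΘ0 : ‖Θ 0‖ ≤ ρ / 4 := by
    have h1 := hest v 0 p (by simpa using hmem v 0 p hv1 (by simpa using by positivity) hp1)
      (by simpa using hmem 0 0 p (by simpa using by positivity) (by simpa using by positivity) hp1)
    rw [hf0, sub_zero, sub_zero] at h1
    have h2 : ‖f (v, p)‖ ≤ (c + ‖f'‖) * ‖v‖ := by
      have h3 : ‖f' (v, 0)‖ ≤ ‖f'‖ * ‖v‖ := by simpa using f'.le_opNorm (v, 0)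
      calc ‖f (v, p)‖ = ‖(f (v, p) - f' (v, 0)) + f' (v, 0)‖ := by rw [sub_add_cancel]
        _ ≤ _ := (norm_add_le _ _).trans (by linarith)
    have h4 : Θ 0 = -S (f (v, p)) := by simp [hΘ]
    rw [h4, norm_neg]
    calc ‖S (f (v, p))‖ ≤ ‖S‖ * ((c + ‖f'‖) * ‖v‖) := (S.le_opNorm _).trans (by gcongr)
      _ ≤ B * ‖v‖ := by rw [hB]; nlinarith [norm_nonneg v]
      _ ≤ B * (ρ / 4 / B) := by gcongr
      _ = ρ / 4 := by field_simp
  refine ⟨?_, ?_⟩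
  -- In the closed ball of radius ρ/2 the contraction contributes at most ρ/4 and the image of 0 at
  -- most ρ/4. Half the radius gives the strict bound ‖y‖ < ρ.
  · set K : Set E := (X : Set E) ∩ Metric.closedBall 0 (ρ / 2) with hK
    have hlt : ∀ y ∈ K, ‖y‖ < δ / 2 := fun y hy => by
      have := mem_closedBall_zero_iff.1 hy.2
      linarith
    have hmaps : MapsTo Θ K K := fun y hy => by
      refine ⟨hΘX y hy.1, mem_closedBall_zero_iff.2 ?_⟩
      have h1 := hlip y hy.1 0 X.zero_mem (hlt y hy) (by simpa using by positivity)
      have h2 := mem_closedBall_zero_iff.1 hy.2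
      rw [sub_zero] at h1
      calc ‖Θ y‖ = ‖(Θ y - Θ 0) + Θ 0‖ := by rw [sub_add_cancel]
        _ ≤ ‖Θ y - Θ 0‖ + ‖Θ 0‖ := norm_add_le _ _
        _ ≤ _ := by linarith
    have hcontr : ContractingWith (1 / 2) (hmaps.restrict Θ K K) := by
      refine ⟨by norm_num, LipschitzWith.of_dist_le_mul fun y₁ y₂ => ?_⟩
      rw [Subtype.dist_eq, Subtype.dist_eq, dist_eq_norm, dist_eq_norm]
      simpa using hlip y₁ y₁.2.1 y₂ y₂.2.1 (hlt _ y₁.2) (hlt _ y₂.2)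
    have h0K : (0 : E) ∈ K := ⟨X.zero_mem, by simpa using by positivity⟩
    obtain ⟨y, hyK, hfix, -⟩ := hcontr.exists_fixedPoint'
      (hX.inter Metric.isClosed_closedBall).isComplete hmaps h0K (edist_ne_top _ _)
    refine ⟨y, hyK.1, ?_, ?_⟩
    · have := mem_closedBall_zero_iff.1 hyK.2
      linarith
    · have h : y - S (f (v + y, p)) = y := hfix
      simpa using h
  · intro y₁ h₁ y₂ h₂ hn₁ hn₂ hz₁ hz₂
    have h := hlip y₁ h₁ y₂ h₂ hn₁ hn₂
    simp only [hΘ, hz₁, hz₂, sub_zero] at h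
    have h0 : ‖y₁ - y₂‖ = 0 := by linarith [norm_nonneg (y₁ - y₂)]
    exact sub_eq_zero.1 (norm_eq_zero.1 h0)

namespace H1

/-! ### Smoothness and linearization of the vector field -/

/-- The vector field as a function of the perturbation and the parameters jointly. -/
def fieldJoint (x : H1 × (H1 →L[ℂ] H1) × ℝ × ℝ) : H1 := field x.1 x.2.1 x.2.2.1 x.2.2.2

lemma contDiff_exp : ContDiff ℝ 1 (NormedSpace.exp : H1 → H1) :=
  contDiff_iff_contDiffAt.2 fun x => (NormedSpace.exp_analytic (𝕂 := ℝ) x).contDiffAt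

lemma contDiff_apply_clm {V : Type*} [NormedAddCommGroup V] [NormedSpace ℝ V]
    {t : V → H1 →L[ℂ] H1} {e : V → H1} (ht : ContDiff ℝ 1 t) (he : ContDiff ℝ 1 e) :
    ContDiff ℝ 1 fun x => t x (e x) :=
  ((isBoundedBilinearMap_apply (𝕜 := ℂ) (E := H1) (F := H1)).contDiff.restrict_scalars ℝ).comp
    (ht.prodMk he)

lemma contDiff_conv {V : Type*} [NormedAddCommGroup V] [NormedSpace ℝ V]
    {f g : V → H1} (hf : ContDiff ℝ 1 f) (hg : ContDiff ℝ 1 g) :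
    ContDiff ℝ 1 fun x => conv (f x) (g x) :=
  contDiff_apply_clm ((conv.contDiff.restrict_scalars ℝ).comp hf) hg

lemma contDiff_clm {V : Type*} [NormedAddCommGroup V] [NormedSpace ℝ V] (L : H1 →L[ℂ] H1)
    {f : V → H1} (hf : ContDiff ℝ 1 f) : ContDiff ℝ 1 fun x => L (f x) :=
  (L.contDiff.restrict_scalars ℝ).comp hf

/-- The convolution operator itself is the parameter: r ↦ T q r is Lipschitz in operator norm, but
its symbol is not differentiable in r uniformly in the frequency. In terms of the operator, the
field is built from exponentials and bounded multilinear maps. -/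
lemma contDiff_fieldJoint : ContDiff ℝ 1 fieldJoint := by
  have hv : ContDiff ℝ 1 fun x : H1 × (H1 →L[ℂ] H1) × ℝ × ℝ => Complex.I • x.1 :=
    contDiff_fst.const_smul _
  have hE := contDiff_exp.comp hv
  have hE' := contDiff_exp.comp hv.neg
  have hT : ContDiff ℝ 1 fun x : H1 × (H1 →L[ℂ] H1) × ℝ × ℝ => x.2.1 :=
    contDiff_fst.comp contDiff_snd
  have hTE := contDiff_apply_clm hT hE
  have h1 := hE'.mul hTE
  have h2 := (hE'.mul hE').mul (contDiff_clm (dil 2 two_ne_zero) (contDiff_conv hE hTE))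
  have h3 := hE'.mul
    (contDiff_conv hE (contDiff_conv (contDiff_clm (dil (-1) (by norm_num)) hE') hTE))
  have hl : ContDiff ℝ 1 fun x : H1 × (H1 →L[ℂ] H1) × ℝ × ℝ => x.2.2.1 :=
    contDiff_fst.comp (contDiff_snd.comp contDiff_snd)
  have hm : ContDiff ℝ 1 fun x : H1 × (H1 →L[ℂ] H1) × ℝ × ℝ => x.2.2.2 :=
    contDiff_snd.comp (contDiff_snd.comp contDiff_snd)
  exact contDiff_clm pin (imag.contDiff.comp ((h1.add (hl.smul h2)).add (hm.smul h3)))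

lemma dil_one (j : ℤ) (hj : j ≠ 0) : dil j hj 1 = 1 := by
  rw [← chr_zero, dil_chr, mul_zero]

lemma mult_one (c : Symb) : mult c 1 = c 0 • 1 := by rw [← chr_zero, mult_chr]

lemma coef_one (n : ℤ) : coef n (1 : H1) = if n = 0 then 1 else 0 := by
  rw [← chr_zero, coef_chr]

lemma one_conv (f : H1) : conv 1 f = coef 0 f • 1 := by rw [← chr_zero, conv_chr]

lemma conv_one (f : H1) : conv f 1 = coef 0 f • 1 := ext_coef fun n => by
  rw [coef_conv, map_smul, coef_one, smul_eq_mul]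
  split_ifs with h <;> simp [h]

lemma pin_one : pin 1 = 0 := by simp [pin_apply]

lemma imag_smul_one (c : ℂ) : imag (c • 1) = (c.im : ℂ) • 1 :=
  ext_ev fun x => by rw [ev_imag]; simp

lemma pin_imag_smul_one (c : ℂ) : pin (imag (c • 1)) = 0 := by
  rw [imag_smul_one, map_smul, pin_one, smul_zero]

/-- The twisted state is an equilibrium for all parameters: at v = 0 both exponentials are 1, all
the operators preserve constants, and `pin` kills constants. -/
lemma field_zero (T : H1 →L[ℂ] H1) (hT : ∃ c : ℂ, T 1 = c • 1) (lam mu : ℝ) :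
    field 0 T lam mu = 0 := by
  obtain ⟨c, hc⟩ := hT
  have : ∃ d : ℂ, inter (1 : H1) 1 T lam mu = d • 1 := by
    refine ⟨c + lam * c + mu * c, ?_⟩
    simp only [inter, inter1, inter2, inter3, hc, one_conv, map_smul, dil_one, coef_one, one_mul,
      if_true, one_smul, mul_one, add_smul, mul_smul, Complex.coe_smul]
  obtain ⟨d, hd⟩ := this
  rw [field, smul_zero, neg_zero, NormedSpace.exp_zero, hd, pin_imag_smul_one]

end H1

end

/-! ### Spectrum of the linearization and inversion off the critical modes. -/

section

open AddCircle

namespace H1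

/-- The eigenvalues of the linearization, indexed by all integers. -/
def eig (q : ℕ) (p : ℝ × ℝ × ℝ) (n : ℤ) : ℝ :=
  1 / 4 * (What p.1 ((q : ℤ) - n) + What p.1 ((q : ℤ) + n) - 2 * What p.1 q
    - (4 * p.2.1 + 2 * p.2.2) * What p.1 q)

lemma eig_natCast (q k : ℕ) (p : ℝ × ℝ × ℝ) : eig q p k = c1 q k p := rfl

lemma eig_neg (q : ℕ) (p : ℝ × ℝ × ℝ) (n : ℤ) : eig q p (-n) = eig q p n := by
  simp only [eig, sub_neg_eq_add, ← sub_eq_add_neg]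
  ring

lemma abs_eig_le (q : ℕ) (p : ℝ × ℝ × ℝ) (n : ℤ) :
    |eig q p n| ≤ (4 + |4 * p.2.1 + 2 * p.2.2|) * |p.1| := by
  have h1 := abs_What_le p.1 (q - n)
  have h2 := abs_What_le p.1 (q + n)
  have h3 := abs_What_le p.1 q
  have h4 : |(4 * p.2.1 + 2 * p.2.2) * What p.1 q| ≤ |4 * p.2.1 + 2 * p.2.2| * (4 * |p.1|) := by
    rw [abs_mul]; gcongr
  rw [abs_le] at *
  constructor <;> (unfold eig; linarith [h1.1, h1.2, h2.1, h2.2, h3.1, h3.2, h4.1, h4.2])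

/-- The symbol of the linearization. -/
def linSymb (q : ℕ) (p : ℝ × ℝ × ℝ) : Symb :=
  BoundedContinuousFunction.ofNormedAddCommGroupDiscrete (fun n => (eig q p n : ℂ)) _ fun n => by
    rw [Complex.norm_real, Real.norm_eq_abs]
    exact abs_eig_le q p n

@[simp] lemma linSymb_apply (q : ℕ) (p : ℝ × ℝ × ℝ) (n : ℤ) : linSymb q p n = eig q p n := rfl

lemma hasDerivAt_conv {f g : ℝ → H1} {f' g' : H1} {t : ℝ} (hf : HasDerivAt f f' t)
    (hg : HasDerivAt g g' t) :
    HasDerivAt (fun s => conv (f s) (g s)) (conv (f t) g' + conv f' (g t)) t := by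
  have h := ((conv.bilinearRestrictScalars ℝ).isBoundedBilinearMap.hasFDerivAt
    (f t, g t)).comp_hasDerivAt t (hf.prodMk hg)
  exact h

lemma hasDerivAt_clm (L : H1 →L[ℂ] H1) {f : ℝ → H1} {f' : H1} {t : ℝ} (hf : HasDerivAt f f' t) :
    HasDerivAt (fun s => L (f s)) (L f') t :=
  ((L.restrictScalars ℝ).hasFDerivAt).comp_hasDerivAt t hf

lemma T_one (q : ℕ) (r : ℝ) : T q r 1 = ((What r q / 2 : ℝ) : ℂ) • 1 := by
  rw [T, mult_one, kernelSymb_apply, add_zero]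

lemma imag_I_smul (f : H1) : imag (Complex.I • f) = (1 / 2 : ℂ) • (f + cj f) :=
  ext_ev fun x => by
    rw [ev_imag, map_smul, map_smul, map_add, ev_cj, Complex.add_conj]
    simp

lemma coef_neg_of_cj {y : H1} (hy : cj y = y) (n : ℤ) :
    (starRingEnd ℂ) (coef (-n) y) = coef n y := by rw [← coef_cj, hy]

/-- The symbol of `T` at n is half of the kernel coefficient at q + n and is not even in n. For real
y, the imaginary part of i times a function averages it with its conjugate, which brings in q - n
and produces the even symbol `eig`. -/
lemma imag_linearization (q : ℕ) (p : ℝ × ℝ × ℝ) {y : H1} (hy : cj y = y) :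
    imag (T q p.1 (Complex.I • y)
      - ((What p.1 q / 2 * (1 + 2 * p.2.1 + p.2.2) : ℝ) : ℂ) • (Complex.I • y))
      = mult (linSymb q p) y := by
  rw [map_smul, smul_comm, ← smul_sub, imag_I_smul]
  refine ext_coef fun n => ?_
  simp only [map_smul, map_add, map_sub, coef_cj, coef_mult, T, map_mul, smul_eq_mul,
    coef_neg_of_cj hy, kernelSymb_apply, Complex.conj_ofReal, linSymb_apply, eig]
  rw [← sub_eq_add_neg]
  push_cast
  ring

/-- Product rule at E = E' = 1. Convolution with 1 leaves only a mean, so in the higher-order terms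
all that survives modulo constants is the derivative of the outer factors E': two in `inter2` and
one in `inter3`. The constant d is later removed by `pin`. -/
lemma hasDerivAt_inter {E E' : ℝ → H1} {a : H1} (hE : HasDerivAt E a 0)
    (hE' : HasDerivAt E' (-a) 0) (h1 : E 0 = 1) (h1' : E' 0 = 1) {T : H1 →L[ℂ] H1} {c : ℂ}
    (hT : T 1 = c • 1) (lam mu : ℝ) :
    ∃ d : ℂ, HasDerivAt (fun t => inter (E t) (E' t) T lam mu)
      (T a - (c * (1 + 2 * lam + mu)) • a + d • 1) 0 := by
  have hTE := hasDerivAt_clm T hE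
  have k1 := hE'.fun_mul hTE
  have k2 := (hE'.fun_mul hE').fun_mul
    (hasDerivAt_clm (dil 2 two_ne_zero) (hasDerivAt_conv hE hTE))
  have k3 := hE'.fun_mul
    (hasDerivAt_conv hE (hasDerivAt_conv (hasDerivAt_clm (dil (-1) (by norm_num)) hE') hTE))
  have k := ((k1.fun_add (k2.fun_const_smul lam)).fun_add (k3.fun_const_smul mu))
  refine ⟨lam * (coef 0 (T a) + c * coef 0 a) + mu * (coef 0 (T a) +
    c * coef 0 (dil (-1) (by norm_num) (-a)) + c * coef 0 a), k.congr_deriv ?_⟩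
  simp only [h1, h1', hT, one_conv, conv_one, map_smul, dil_one, coef_one, if_true, one_mul,
    mul_one, map_add, one_smul, mul_smul_comm, ← Complex.coe_smul]
  module

lemma hasDerivAt_field (q : ℕ) (p : ℝ × ℝ × ℝ) {y : H1} (hy : cj y = y) :
    HasDerivAt (fun t : ℝ => field (t • y) (T q p.1) p.2.1 p.2.2) (pin (mult (linSymb q p) y)) 0 := by
  have hE : HasDerivAt (fun t : ℝ => NormedSpace.exp (Complex.I • (t • y))) (Complex.I • y) 0 := by
    have h := hasDerivAt_exp_smul_const (𝕂 := ℝ) (Complex.I • y) (0 : ℝ)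
    rw [zero_smul, NormedSpace.exp_zero, one_mul] at h
    simpa only [smul_comm Complex.I] using h
  have hE' : HasDerivAt (fun t : ℝ => NormedSpace.exp (-(Complex.I • (t • y))))
      (-(Complex.I • y)) 0 := by
    have h := hasDerivAt_exp_smul_const (𝕂 := ℝ) (-(Complex.I • y)) (0 : ℝ)
    rw [zero_smul, NormedSpace.exp_zero, one_mul] at h
    simpa only [smul_comm Complex.I, smul_neg] using h
  obtain ⟨d, hd⟩ := hasDerivAt_inter hE hE' (by simp) (by simp) (T_one q p.1) p.2.1 p.2.2
  have h := hasDerivAt_clm pin (imag.hasFDerivAt.comp_hasDerivAt 0 hd)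
  refine h.congr_deriv ?_
  rw [map_add, map_add, pin_imag_smul_one, add_zero, ← imag_linearization q p hy]
  push_cast
  rfl

/-! ### The equation on the complement of a mode -/

/-- The real-valued functions in `H¹` that vanish at `0` and do not contain the modes `±ℓ`. -/
def compl (ℓ : ℕ) : Submodule ℝ H1 where
  carrier := {f | cj f = f ∧ ev 0 f = 0 ∧ coef ℓ f = 0 ∧ coef (-ℓ) f = 0}
  zero_mem' := by simp
  add_mem' := by
    rintro f g ⟨h1, h2, h3, h4⟩ ⟨k1, k2, k3, k4⟩
    exact ⟨by rw [map_add, h1, k1], by rw [map_add, h2, k2, add_zero],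
      by rw [map_add, h3, k3, add_zero], by rw [map_add, h4, k4, add_zero]⟩
  smul_mem' := by
    rintro c f ⟨h1, h2, h3, h4⟩
    refine ⟨by rw [map_smul, h1], ?_⟩
    rw [← Complex.coe_smul]
    simp [h2, h3, h4]

lemma isClosed_compl (ℓ : ℕ) : IsClosed (compl ℓ : Set H1) :=
  (isClosed_eq cj.continuous continuous_id).inter
    ((isClosed_eq (ev 0).continuous continuous_const).inter
      ((isClosed_eq (coef ℓ).continuous continuous_const).inter
        (isClosed_eq (coef (-ℓ)).continuous continuous_const)))

/-- The projection that removes the modes `±ℓ` and keeps the value at `0`. -/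
def proj (ℓ : ℕ) : H1 →L[ℂ] H1 :=
  ContinuousLinearMap.id ℂ H1 - (coef ℓ).smulRight (chr ℓ - 1)
    - (coef (-ℓ)).smulRight (chr (-ℓ) - 1)

lemma proj_apply (ℓ : ℕ) (f : H1) :
    proj ℓ f = f - coef ℓ f • (chr ℓ - 1) - coef (-ℓ) f • (chr (-ℓ) - 1) := rfl

lemma cj_one : cj 1 = 1 := ext_ev fun x => by simp [ev_cj]

lemma cj_chr (n : ℤ) : cj (chr n) = chr (-n) := ext_ev fun x => by simp [ev_cj]

lemma cj_smul (c : ℂ) (f : H1) : cj (c • f) = (starRingEnd ℂ c) • cj f :=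
  ext_ev fun x => by simp [ev_cj]

lemma coef_pin {n : ℤ} (hn : n ≠ 0) (f : H1) : coef n (pin f) = coef n f := by
  simp [pin_apply, coef_one, hn]

lemma cj_pin {f : H1} (hf : cj f = f) : cj (pin f) = pin f := by
  have h : (starRingEnd ℂ) (ev 0 f) = ev 0 f := by rw [← ev_cj, hf]
  rw [pin_apply, map_sub, cj_smul, cj_one, hf, h]

lemma ev_zero_pin (f : H1) : ev 0 (pin f) = 0 := by rw [ev_pin, sub_self]

lemma pin_eq_self {f : H1} (hf : ev 0 f = 0) : pin f = f := by simp [pin_apply, hf]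

lemma proj_mem_compl {ℓ : ℕ} (hℓ : 1 ≤ ℓ) {f : H1} (h1 : cj f = f) (h2 : ev 0 f = 0) :
    proj ℓ f ∈ compl ℓ := by
  have hl : (ℓ : ℤ) ≠ 0 := by omega
  have hl' : (ℓ : ℤ) ≠ -ℓ := by omega
  refine ⟨?_, ?_, ?_, ?_⟩
  · have e1 := coef_neg_of_cj h1 ℓ
    have e2 := coef_neg_of_cj h1 (-ℓ)
    rw [neg_neg] at e2
    simp only [proj_apply, map_sub, cj_smul, cj_chr, cj_one, h1, e1, e2, neg_neg]
    abel
  · simp [proj_apply, h2]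
  · simp [proj_apply, coef_chr, coef_one, Nat.ne_of_gt hℓ]
  · simp [proj_apply, coef_chr, coef_one, Nat.ne_of_gt hℓ]

lemma proj_eq_self {ℓ : ℕ} {f : H1} (hf : f ∈ compl ℓ) : proj ℓ f = f := by
  simp [proj_apply, hf.2.2.1, hf.2.2.2]

/-- A real even symbol acts on the complement, after restoring the value at `0`. -/
lemma pin_mult_mem_compl {ℓ : ℕ} (hℓ : 1 ≤ ℓ) {c : Symb} {m : ℤ → ℝ} (hc : ∀ n, c n = m n)
    (hm : ∀ n, m (-n) = m n) {f : H1} (hf : f ∈ compl ℓ) : pin (mult c f) ∈ compl ℓ := by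
  have hl : (ℓ : ℤ) ≠ 0 := by omega
  have hl' : (-ℓ : ℤ) ≠ 0 := by omega
  refine ⟨cj_pin (ext_coef fun n => ?_), ev_zero_pin _, ?_, ?_⟩
  · rw [coef_cj, coef_mult, coef_mult, map_mul, coef_neg_of_cj hf.1, hc, hc, hm,
      Complex.conj_ofReal]
  · rw [coef_pin hl, coef_mult, hf.2.2.1, mul_zero]
  · rw [coef_pin hl', coef_mult, hf.2.2.2, mul_zero]

/-- On the complement the constant mode is determined by the vanishing at 0, so symbols need to be
inverse to each other only off 0 and ±ℓ. The constant removed by the inner `pin` stays constant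
under the multiplier and dies under the outer one. -/
lemma pin_mult_pin_mult {ℓ : ℕ} {c c' : Symb}
    (h : ∀ n : ℤ, n ≠ 0 → n ≠ ℓ → n ≠ -ℓ → c n * c' n = 1) {f : H1} (hf : f ∈ compl ℓ) :
    pin (mult c (pin (mult c' f))) = f := by
  have e : mult c (mult c' f) = f + ((c 0 * c' 0 - 1) * coef 0 f) • 1 := ext_coef fun n => by
    simp only [coef_mult, map_add, map_smul, coef_one, smul_eq_mul]
    by_cases h0 : n = 0
    · subst h0; simp; ring
    by_cases h1 : n = ℓ
    · rw [if_neg h0, h1, hf.2.2.1]; simp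
    by_cases h2 : n = -ℓ
    · rw [if_neg h0, h2, hf.2.2.2]; simp
    · rw [if_neg h0, ← mul_assoc, h n h0 h1 h2]; simp
  rw [pin_apply (mult c' f), map_sub, map_smul, mult_one, e]
  simp only [map_sub, map_add, map_smul, pin_one, smul_zero, add_zero, sub_zero]
  exact pin_eq_self hf.2.1

/-- The symbol of the inverse of the linearization on the complement. -/
lemma exists_inverse_symbol {q ℓ : ℕ} {p : ℝ × ℝ × ℝ} {ε : ℝ} (hε : 0 < ε)
    (hgap : ∀ k : ℕ, 1 ≤ k → k ≠ ℓ → c1 q k p ∉ Ioo (-ε) ε) :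
    ∃ (c : Symb) (m : ℤ → ℝ), (∀ n, c n = m n) ∧ (∀ n, m (-n) = m n) ∧
      ∀ n : ℤ, n ≠ 0 → n ≠ ℓ → n ≠ -ℓ → c n * linSymb q p n = 1 := by
  classical
  -- The values at 0 and ±ℓ play no role and are set to 0; elsewhere the gap bounds the inverse by
  -- 1/ε.
  set m : ℤ → ℝ := fun n => if n.natAbs = 0 ∨ n.natAbs = ℓ then 0 else (eig q p n)⁻¹ with hm
  have habs : ∀ n : ℤ, eig q p n = c1 q n.natAbs p := fun n => by
    rw [← eig_natCast]
    rcases Int.natAbs_eq n with h | h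
    · rw [← h]
    · conv_lhs => rw [h, eig_neg]
  have hge : ∀ n : ℤ, ¬ (n.natAbs = 0 ∨ n.natAbs = ℓ) → ε ≤ |eig q p n| := fun n hn => by
    push Not at hn
    have := hgap n.natAbs (Nat.one_le_iff_ne_zero.2 hn.1) hn.2
    rw [← habs, mem_Ioo, ← abs_lt, not_lt] at this
    exact this
  have hbound : ∀ n, ‖(m n : ℂ)‖ ≤ ε⁻¹ := fun n => by
    rw [Complex.norm_real, Real.norm_eq_abs]
    simp only [hm]
    split_ifs with hn
    · simpa using hε.le
    · rw [abs_inv]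
      exact inv_anti₀ hε (hge n hn)
  refine ⟨BoundedContinuousFunction.ofNormedAddCommGroupDiscrete (fun n => (m n : ℂ)) _ hbound, m,
    fun n => rfl, fun n => by simp [hm, eig_neg], fun n h0 h1 h2 => ?_⟩
  have hn : ¬ (n.natAbs = 0 ∨ n.natAbs = ℓ) := by omega
  have hne : eig q p n ≠ 0 := abs_pos.1 (hε.trans_le (hge n hn))
  change (m n : ℂ) * (eig q p n : ℂ) = 1
  rw [← Complex.ofReal_mul, hm]
  simp only [if_neg hn]
  rw [inv_mul_cancel₀ hne, Complex.ofReal_one]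

lemma cj_imag (f : H1) : cj (imag f) = imag f := ext_ev fun x => by
  rw [ev_cj, ev_imag, Complex.conj_ofReal]

lemma cj_field (v : H1) (T : H1 →L[ℂ] H1) (lam mu : ℝ) :
    cj (field v T lam mu) = field v T lam mu := cj_pin (cj_imag _)

lemma ev_zero_field (v : H1) (T : H1 →L[ℂ] H1) (lam mu : ℝ) : ev 0 (field v T lam mu) = 0 :=
  ev_zero_pin _

/-- The vector field at parameter values of the model. -/
abbrev vf (q : ℕ) (v : H1) (p : ℝ × ℝ × ℝ) : H1 := field v (T q p.1) p.2.1 p.2.2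

theorem lyapunovSchmidt {q ℓ : ℕ} (hℓ : 1 ≤ ℓ) {p₀ : ℝ × ℝ × ℝ} {ε : ℝ} (hε : 0 < ε)
    (hgap : ∀ k : ℕ, 1 ≤ k → k ≠ ℓ → c1 q k p₀ ∉ Ioo (-ε) ε) :
    ∃ ρ₀ > 0, ∀ ρ > 0, ρ ≤ ρ₀ → ∃ η > 0, ∃ V ∈ 𝓝 p₀, ∀ v : H1, ‖v‖ < η → ∀ p ∈ V,
      (∃ y ∈ compl ℓ, ‖y‖ < ρ ∧ proj ℓ (vf q (v + y) p) = 0) ∧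
      ∀ y₁ ∈ compl ℓ, ∀ y₂ ∈ compl ℓ, ‖y₁‖ < ρ₀ → ‖y₂‖ < ρ₀ →
        proj ℓ (vf q (v + y₁) p) = 0 → proj ℓ (vf q (v + y₂) p) = 0 → y₁ = y₂ := by
  obtain ⟨c, m, hcm, hm, hinv⟩ := exists_inverse_symbol (q := q) hε hgap
  -- Differentiability is needed only in the operator; the actual parameter enters through the
  -- continuous map `par`.
  set par : ℝ × ℝ × ℝ → (H1 →L[ℂ] H1) × ℝ × ℝ := fun p => (T q p.1, p.2) with hpar
  have hparc : Continuous par := ((continuous_T q).comp continuous_fst).prodMk continuous_snd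
  set f : H1 × (H1 →L[ℂ] H1) × ℝ × ℝ → H1 := fun x => proj ℓ (fieldJoint x) with hf
  have hfc : ContDiff ℝ 1 f := contDiff_clm (proj ℓ) contDiff_fieldJoint
  have hstrict := hfc.contDiffAt (x := ((0 : H1), par p₀)) |>.hasStrictFDerivAt one_ne_zero
  set S : H1 →L[ℝ] H1 := (pin ∘L mult c).restrictScalars ℝ with hS
  have hSX : ∀ y ∈ compl ℓ, S y ∈ compl ℓ := fun y hy => pin_mult_mem_compl hℓ hcm hm hy
  have hlin : ∀ y ∈ compl ℓ, S (pin (mult (linSymb q p₀) y)) = y := fun y hy =>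
    pin_mult_pin_mult hinv hy
  -- S also has the linearization as a left inverse, so it is injective on the complement. Hence
  -- zeros of S ∘ f are zeros of f.
  have hS0 : ∀ y ∈ compl ℓ, S y = 0 → y = 0 := fun y hy h => by
    have h1 : pin (mult (linSymb q p₀) (S y)) = y :=
      pin_mult_pin_mult (fun n h0 h1 h2 => by rw [mul_comm]; exact hinv n h0 h1 h2) hy
    rw [← h1, h, map_zero, map_zero]
  have hfX : ∀ v p, proj ℓ (vf q v p) ∈ compl ℓ := fun v p =>
    proj_mem_compl hℓ (cj_field _ _ _ _) (ev_zero_field _ _ _ _)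
  have hderiv : ∀ y ∈ compl ℓ, fderiv ℝ f (0, par p₀) (y, 0) = pin (mult (linSymb q p₀) y) := by
    intro y hy
    have h1 := hasDerivAt_clm (proj ℓ) (hasDerivAt_field q p₀ hy.1)
    rw [proj_eq_self (pin_mult_mem_compl hℓ (linSymb_apply q p₀) (eig_neg q p₀) hy)] at h1
    have h2 : HasDerivAt (fun t : ℝ => (t • y, par p₀)) (y, 0) 0 := by
      have := ((hasDerivAt_id (0 : ℝ)).smul_const y).prodMk (hasDerivAt_const (0 : ℝ) (par p₀))
      simpa using this
    have h3 : HasFDerivAt f (fderiv ℝ f (0, par p₀)) ((0 : ℝ) • y, par p₀) := by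
      rw [zero_smul]; exact hstrict.hasFDerivAt
    have h4 := h3.comp_hasDerivAt (0 : ℝ) h2
    exact HasDerivAt.unique (f := fun t : ℝ => f (t • y, par p₀)) h4 h1
  obtain ⟨ρ₀, hρ₀, H⟩ := exists_unique_zero_near hstrict (compl ℓ) (isClosed_compl ℓ) S
    (fun y hy => by rw [hderiv y hy]; exact hlin y hy)
  refine ⟨ρ₀, hρ₀, fun ρ hρ hρ' => ?_⟩
  obtain ⟨η, hη, H'⟩ := H ρ hρ hρ'
  have hV : {p | ‖par p - par p₀‖ < η} ∈ 𝓝 p₀ := by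
    have h1 : Continuous fun p => ‖par p - par p₀‖ := (hparc.sub continuous_const).norm
    exact (isOpen_lt h1 continuous_const).mem_nhds (by simpa using hη)
  refine ⟨η, hη, _, hV, fun v hv p hp => ?_⟩
  have h0 : f (0, par p) = 0 := by
    have : fieldJoint (0, par p) = 0 := field_zero _ ⟨_, T_one q p.1⟩ _ _
    rw [hf]
    simp only [this, map_zero]
  obtain ⟨⟨y, hy, hyρ, hy0⟩, huniq⟩ := H' v (par p) hv hp h0 fun y _ => hSX _ (hfX _ _)
  refine ⟨⟨y, hy, hyρ, hS0 _ (hfX _ _) hy0⟩, fun y₁ h₁ y₂ h₂ hn₁ hn₂ hz₁ hz₂ => ?_⟩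
  refine huniq y₁ h₁ y₂ h₂ hn₁ hn₂ ?_ ?_
  · change S (proj ℓ (vf q (v + y₁) p)) = 0
    rw [hz₁, map_zero]
  · change S (proj ℓ (vf q (v + y₂) p)) = 0
    rw [hz₂, map_zero]

end H1

end

section

open AddCircle H1

/-! ### Real `H¹` functions and weak derivatives -/

lemma integral_haar {E : Type*} [NormedAddCommGroup E] [NormedSpace ℝ E] (f : UnitAddCircle → E) :
    ∫ x, f x ∂haarAddCircle = ∫ x, f x := by
  rw [volume_eq_haar]

lemma norm_sq_L2 (g : L2) : ‖g‖ ^ 2 = ∫ x : UnitAddCircle, ‖g x‖ ^ 2 := by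
  have h := hasSum_sq_fourierCoeff g
  simp only [← coefL2_apply] at h
  rw [volume_eq_haar]
  exact (hasSum_sq_coefL2 g).unique h

/-- A continuous real function as a continuous complex function. -/
def toComplexC0 (f : UnitAddCircle → ℝ) (hf : Continuous f) : C0 :=
  ⟨fun x => (f x : ℂ), Complex.continuous_ofReal.comp hf⟩

@[simp] lemma toComplexC0_apply (f : UnitAddCircle → ℝ) (hf : Continuous f) (x : UnitAddCircle) :
    toComplexC0 f hf x = (f x : ℂ) := rfl

lemma hasDerivAt_fourier_unit (n : ℤ) (t : ℝ) :
    HasDerivAt (fun s : ℝ => (fourier n (s : UnitAddCircle) : ℂ))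
      (2 * π * Complex.I * n * fourier n (t : UnitAddCircle)) t := by
  simpa using hasDerivAt_fourier (1 : ℝ) n t

lemma hasDerivAt_fourier_re (n : ℤ) (t : ℝ) :
    HasDerivAt (fun s : ℝ => (fourier n (s : UnitAddCircle) : ℂ).re)
      (-(2 * π * n) * (fourier n (t : UnitAddCircle) : ℂ).im) t := by
  have h := Complex.reCLM.hasFDerivAt.comp_hasDerivAt t (hasDerivAt_fourier_unit n t)
  refine h.congr_deriv ?_
  simp

lemma hasDerivAt_fourier_im (n : ℤ) (t : ℝ) :
    HasDerivAt (fun s : ℝ => (fourier n (s : UnitAddCircle) : ℂ).im)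
      (2 * π * n * (fourier n (t : UnitAddCircle) : ℂ).re) t := by
  have h := Complex.imCLM.hasFDerivAt.comp_hasDerivAt t (hasDerivAt_fourier_unit n t)
  refine h.congr_deriv ?_
  simp

lemma contDiff_fourier_unit (n : ℤ) :
    ContDiff ℝ ∞ fun s : ℝ => (fourier n (s : UnitAddCircle) : ℂ) := by
  simp only [fourier_coe_apply]
  have h : ContDiff ℝ ∞ fun s : ℝ => (2 * π * Complex.I * n * s / (1 : ℝ) : ℂ) :=
    (contDiff_const.mul Complex.ofRealCLM.contDiff).div_const _
  exact h.cexp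

lemma contDiff_fourier_re (n : ℤ) :
    ContDiff ℝ ∞ fun s : ℝ => (fourier n (s : UnitAddCircle) : ℂ).re :=
  Complex.reCLM.contDiff.comp (contDiff_fourier_unit n)

lemma contDiff_fourier_im (n : ℤ) :
    ContDiff ℝ ∞ fun s : ℝ => (fourier n (s : UnitAddCircle) : ℂ).im :=
  Complex.imCLM.contDiff.comp (contDiff_fourier_unit n)

lemma integrable_of_memLp_two {g : UnitAddCircle → ℝ} (hg : MemLp g 2 volume) : Integrable g :=
  hg.integrable one_le_two

lemma continuous_fourier_re (n : ℤ) : Continuous fun x : UnitAddCircle => (fourier n x : ℂ).re :=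
  Complex.continuous_re.comp (fourier n).continuous

lemma continuous_fourier_im (n : ℤ) : Continuous fun x : UnitAddCircle => (fourier n x : ℂ).im :=
  Complex.continuous_im.comp (fourier n).continuous

lemma integral_fourier_neg_mul {g : UnitAddCircle → ℝ} (hg : Integrable g) (n : ℤ) :
    ∫ x : UnitAddCircle, (fourier (-n) x : ℂ) * (g x : ℂ) =
      (∫ x, g x * (fourier n x : ℂ).re : ℝ) - Complex.I * (∫ x, g x * (fourier n x : ℂ).im : ℝ) := by
  have hb : ∀ x : UnitAddCircle, ‖(fourier n x : ℂ)‖ ≤ 1 := fun x => by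
    rw [fourier_apply, Circle.norm_coe]
  have h1 : Integrable fun x : UnitAddCircle => g x * (fourier n x : ℂ).re :=
    hg.mul_bdd (c := 1) (continuous_fourier_re n).aestronglyMeasurable
      (.of_forall fun x => (Complex.abs_re_le_norm _).trans (hb x))
  have h2 : Integrable fun x : UnitAddCircle => g x * (fourier n x : ℂ).im :=
    hg.mul_bdd (c := 1) (continuous_fourier_im n).aestronglyMeasurable
      (.of_forall fun x => (Complex.abs_im_le_norm _).trans (hb x))
  rw [← integral_complex_ofReal, ← integral_complex_ofReal, ← integral_const_mul, ← integral_sub]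
  · congr 1
    ext x
    rw [fourier_neg]
    apply Complex.ext <;> simp <;> ring
  · exact h1.ofReal
  · exact h2.ofReal.const_mul _

lemma coefC_toComplexC0 (f : UnitAddCircle → ℝ) (hf : Continuous f) (n : ℤ) :
    coefC n (toComplexC0 f hf) = ∫ x, (fourier (-n) x : ℂ) * (f x : ℂ) := by
  rw [coefC_apply, fourierCoeff, ← volume_eq_haar]
  rfl

/-- A real square-integrable function as an element of the complex `L²` space. -/
def toComplexL2 (g : UnitAddCircle → ℝ) (hg : MemLp g 2 volume) : L2 :=
  MemLp.toLp (fun x => (g x : ℂ)) (volume_eq_haar ▸ hg.ofReal)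

lemma coeFn_toComplexL2 (g : UnitAddCircle → ℝ) (hg : MemLp g 2 volume) :
    toComplexL2 g hg =ᵐ[volume] fun x => (g x : ℂ) := by
  rw [volume_eq_haar]
  exact MemLp.coeFn_toLp _

lemma norm_sq_toComplexL2 (g : UnitAddCircle → ℝ) (hg : MemLp g 2 volume) :
    ‖toComplexL2 g hg‖ ^ 2 = ∫ x, g x ^ 2 := by
  rw [norm_sq_L2]
  refine integral_congr_ae ?_
  filter_upwards [coeFn_toComplexL2 g hg] with x hx
  rw [hx, Complex.norm_real, Real.norm_eq_abs, sq_abs]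

lemma coefL2_toComplexL2 (g : UnitAddCircle → ℝ) (hg : MemLp g 2 volume) (n : ℤ) :
    coefL2 n (toComplexL2 g hg) = ∫ x, (fourier (-n) x : ℂ) * (g x : ℂ) := by
  have h := coeFn_toComplexL2 g hg
  rw [volume_eq_haar] at h
  rw [coefL2_apply, fourierCoeff_congr_ae h, fourierCoeff, ← volume_eq_haar]
  rfl

/-- Test against the real and imaginary parts of the characters. -/
lemma isDeriv_of_isWeakDeriv {f g : UnitAddCircle → ℝ} (hf : Continuous f)
    (hg : MemLp g 2 volume) (h : IsWeakDeriv f g) :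
    IsDeriv (toComplexC0 f hf) (toComplexL2 g hg) := by
  intro n
  have hfi : Integrable f :=
    Integrable.of_bound (C := ‖toComplexC0 f hf‖) hf.aestronglyMeasurable (.of_forall fun x => by
      simpa using (toComplexC0 f hf).norm_coe_le_norm x)
  rw [coefL2_toComplexL2, coefC_toComplexC0, integral_fourier_neg_mul hfi,
    integral_fourier_neg_mul (integrable_of_memLp_two hg)]
  have h1 := h (fun x => (fourier n x : ℂ).re) (fun x => -(2 * π * n) * (fourier n x : ℂ).im)
    (contDiff_fourier_re n) (hasDerivAt_fourier_re n)
  have h2 := h (fun x => (fourier n x : ℂ).im) (fun x => 2 * π * n * (fourier n x : ℂ).re)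
    (contDiff_fourier_im n) (hasDerivAt_fourier_im n)
  simp only [mul_left_comm (f _), integral_const_mul] at h1 h2
  have h1' : ∫ x, g x * (fourier n x : ℂ).re = 2 * π * n * ∫ x, f x * (fourier n x : ℂ).im := by
    linarith
  have h2' : ∫ x, g x * (fourier n x : ℂ).im = -(2 * π * n * ∫ x, f x * (fourier n x : ℂ).re) := by
    linarith
  rw [h1', h2']
  push_cast
  linear_combination (2 * π * n * ((∫ x, f x * (fourier n x : ℂ).im : ℝ) : ℂ)) * Complex.I_sq

/-- Integration by parts over one period; the boundary terms cancel by periodicity. It is needed for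
the test functions. -/
lemma isDeriv_of_hasDerivAt {φ φ' : UnitAddCircle → ℝ} (hφ : Continuous φ) (hφ' : Continuous φ')
    (h : ∀ t : ℝ, HasDerivAt (fun t : ℝ => φ t) (φ' t) t) :
    IsDeriv (toComplexC0 φ hφ) (toL2 (toComplexC0 φ' hφ')) := by
  intro n
  change coefC n (toComplexC0 φ' hφ') = _
  rw [coefC_apply, coefC_apply, fourierCoeff_eq_intervalIntegral _ n 0,
    fourierCoeff_eq_intervalIntegral _ n 0]
  have hc : ∀ (f : UnitAddCircle → ℂ), Continuous f → Continuous fun t : ℝ => f t :=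
    fun f hf => hf.comp (AddCircle.continuous_mk' 1)
  have key := intervalIntegral.integral_mul_deriv_eq_deriv_mul (a := 0) (b := 1)
    (u := fun t : ℝ => (fourier (-n) (t : UnitAddCircle) : ℂ)) (v := fun t : ℝ => (φ t : ℂ))
    (u' := fun t : ℝ => 2 * π * Complex.I * (-n : ℤ) * fourier (-n) (t : UnitAddCircle))
    (v' := fun t : ℝ => (φ' t : ℂ))
    (fun t _ => hasDerivAt_fourier_unit (-n) t) (fun t _ => (h t).ofReal_comp)
    ((continuous_const.mul (hc _ (fourier (-n)).continuous)).intervalIntegrable _ _)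
    ((hc _ (toComplexC0 φ' hφ').continuous).intervalIntegrable _ _)
  have e0 : ((1 : ℝ) : UnitAddCircle) = ((0 : ℝ) : UnitAddCircle) := by
    rw [AddCircle.coe_period]; rfl
  simp only [e0, sub_self, zero_sub, mul_assoc, intervalIntegral.integral_const_mul] at key
  simp only [zero_add, one_div, inv_one, one_smul, smul_eq_mul, toComplexC0_apply]
  rw [key]
  push_cast
  ring

lemma continuous_of_comp_coe {f : UnitAddCircle → ℝ} (h : Continuous fun t : ℝ => f t) :
    Continuous f :=
  QuotientAddGroup.isOpenQuotientMap_mk.isQuotientMap.continuous_iff.2 h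

lemma integral_mulL2 (f : C0) (g : L2) : coefL2 0 (mulL2 f g) = ∫ x, f x * g x := by
  rw [coefL2_apply, fourierCoeff_congr_ae (coeFn_mulL2 f g), fourierCoeff, integral_haar]
  simp

lemma integrable_mulL2 (f : C0) (g : L2) : Integrable fun x : UnitAddCircle => f x * g x := by
  rw [volume_eq_haar]
  exact (memLp_mul f g).integrable one_le_two

/-- The weak identity is the Leibniz rule for F φ at frequency 0, where the coefficient of a
derivative vanishes. -/
lemma isWeakDeriv_re {f : UnitAddCircle → ℝ} {F : H1} (hF : ∀ x, ev x F = f x) :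
    IsWeakDeriv f (fun x => (D F x).re) := by
  intro φ φ' hφ hφ'
  have hc : Continuous φ := continuous_of_comp_coe hφ.continuous
  have hc' : Continuous φ' := continuous_of_comp_coe (by
    have h1 : (fun t : ℝ => φ' t) = deriv fun t : ℝ => φ t := funext fun t => (hφ' t).deriv.symm
    rw [h1]
    exact hφ.continuous_deriv (by simp))
  have hd := isDeriv_of_hasDerivAt hc hc' hφ'
  have key := (F.isDeriv.mul hd) 0
  rw [Int.cast_zero, mul_zero, zero_mul, map_add, mulL2_toL2, integral_mulL2] at key
  have e1 : coefL2 0 (toL2 (toC0 F * toComplexC0 φ' hc')) = ((∫ x, f x * φ' x : ℝ) : ℂ) := by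
    change coefC 0 _ = _
    rw [coefC_apply, fourierCoeff, ← volume_eq_haar, ← integral_complex_ofReal]
    congr 1
    ext x
    simp [← ev_def, hF]
  have e2 := integral_re (integrable_mulL2 (toComplexC0 φ hc) (D F))
  simp only [toComplexC0_apply, RCLike.re_to_complex, Complex.re_ofReal_mul] at e2
  rw [e1] at key
  have := congrArg Complex.re key
  simp only [toComplexC0_apply, Complex.add_re, Complex.ofReal_re, Complex.zero_re] at this
  simp only [mul_comm _ (φ _), e2]
  linarith

lemma memLp_re_L2 (g : L2) : MemLp (fun x => (g x).re) 2 (volume : Measure UnitAddCircle) := by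
  rw [volume_eq_haar]
  exact (Lp.memLp g).re

lemma continuous_of_ev {f : UnitAddCircle → ℝ} {F : H1} (hF : ∀ x, ev x F = f x) :
    Continuous f := by
  have : f = fun x => (ev x F).re := funext fun x => by rw [hF, Complex.ofReal_re]
  rw [this]
  exact Complex.continuous_re.comp F.continuous_ev

lemma memH10_of_ev {f : UnitAddCircle → ℝ} {F : H1} (hF : ∀ x, ev x F = f x) (h0 : f 0 = 0) :
    MemH10 f :=
  ⟨continuous_of_ev hF, h0, _, memLp_re_L2 _, isWeakDeriv_re hF⟩

lemma MemH10.exists_ev {f : UnitAddCircle → ℝ} (hf : MemH10 f) : ∃ F : H1, ∀ x, ev x F = f x := by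
  obtain ⟨g, hg, hw⟩ := hf.weakDeriv
  exact ⟨ofDeriv _ _ (isDeriv_of_isWeakDeriv hf.continuous hg hw), fun x => rfl⟩

/-- Any square-integrable weak derivative has the Fourier coefficients of `D F`, so the one chosen
in `weakDeriv` agrees with it in L². -/
lemma h1norm_eq {f : UnitAddCircle → ℝ} {F : H1} (hF : ∀ x, ev x F = f x) :
    h1norm f = √(‖toL2 (toC0 F)‖ ^ 2 + ‖D F‖ ^ 2) := by
  have hex : ∃ g : UnitAddCircle → ℝ, MemLp g 2 volume ∧ IsWeakDeriv f g :=
    ⟨_, memLp_re_L2 _, isWeakDeriv_re hF⟩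
  have hw : weakDeriv f = hex.choose := dif_pos hex
  have hs := hex.choose_spec
  rw [← hw] at hs
  have hcont := continuous_of_ev hF
  have e : toC0 F = toComplexC0 f hcont := ContinuousMap.ext fun x => hF x
  have hD : D F = toComplexL2 _ hs.1 :=
    D_eq (by rw [e]; exact isDeriv_of_isWeakDeriv hcont hs.1 hs.2)
  rw [h1norm, hD, norm_sq_toComplexL2, norm_sq_L2, e]
  congr 2
  refine integral_congr_ae ?_
  have := ContinuousMap.coeFn_toLp (p := 2) (𝕜 := ℂ) haarAddCircle (toComplexC0 f hcont)
  replace this : ∀ᵐ x ∂(volume : Measure UnitAddCircle), toL2 (toComplexC0 f hcont) x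
      = toComplexC0 f hcont x := by
    rw [volume_eq_haar]
    exact this
  filter_upwards [this] with x hx
  rw [hx, toComplexC0_apply, Complex.norm_real, Real.norm_eq_abs, sq_abs]

lemma h1norm_le_norm {f : UnitAddCircle → ℝ} {F : H1} (hF : ∀ x, ev x F = f x) :
    h1norm f ≤ ‖F‖ := by
  rw [h1norm_eq hF, H1.norm_def]
  refine Real.sqrt_le_iff.2 ⟨by positivity, ?_⟩
  have := norm_C0_toL2_le (toC0 F)
  nlinarith [norm_nonneg (toL2 (toC0 F)), norm_nonneg (D F), norm_nonneg (toC0 F)]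

/-- The sup norm is bounded by the Sobolev embedding. Together with `h1norm_le_norm` this makes the
two norms equivalent, so that smallness can be transferred both ways. -/
lemma norm_le_h1norm {f : UnitAddCircle → ℝ} {F : H1} (hF : ∀ x, ev x F = f x) :
    ‖F‖ ≤ (wienerConst + 1) * h1norm f := by
  rw [h1norm_eq hF, H1.norm_def, add_mul, one_mul]
  have hs := summable_norm_and_tsum_le F.isDeriv.summable_wsq
  gcongr
  · have h1 : ‖∑' n, coefC n (toC0 F) • ch n‖ ≤ ∑' n, ‖coefC n (toC0 F)‖ :=
      tsum_of_norm_bounded hs.1.hasSum fun n => by rw [norm_smul, fourier_norm, mul_one]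
    rw [F.isDeriv.hasSum.tsum_eq] at h1
    refine h1.trans (hs.2.trans ?_)
    gcongr
    · exact wienerConst_nonneg
    · exact F.isDeriv.tsum_wsq_le
  · exact Real.le_sqrt_of_sq_le (by nlinarith [sq_nonneg ‖toL2 (toC0 F)‖])

end

section

open AddCircle H1

/-! ### The decomposition `N ⊕ R` -/

/-- The real part of an `H¹` function. -/
def reMap : H1 →ₗ[ℝ] (UnitAddCircle → ℝ) where
  toFun f := fun x => (ev x f).re
  map_add' f g := by ext x; simp
  map_smul' c f := by ext x; rw [← Complex.coe_smul]; simp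

lemma reMap_apply (f : H1) (x : UnitAddCircle) : reMap f x = (ev x f).re := rfl

lemma ev_of_cj {f : H1} (hf : cj f = f) (x : UnitAddCircle) : ev x f = reMap f x := by
  have h : (starRingEnd ℂ) (ev x f) = ev x f := by rw [← ev_cj, hf]
  exact (Complex.conj_eq_iff_re.1 h).symm

lemma cj_of_ev {f : H1} {v : UnitAddCircle → ℝ} (hf : ∀ x, ev x f = v x) : cj f = f :=
  ext_ev fun x => by rw [ev_cj, hf, Complex.conj_ofReal]

lemma reMap_of_ev {f : H1} {v : UnitAddCircle → ℝ} (hf : ∀ x, ev x f = v x) : reMap f = v :=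
  funext fun x => by rw [reMap_apply, hf, Complex.ofReal_re]

lemma memH10_reMap {f : H1} (hf : cj f = f) (h0 : ev 0 f = 0) : MemH10 (reMap f) :=
  memH10_of_ev (ev_of_cj hf) (by simp [reMap_apply, h0])

lemma u_apply (k : ℕ) (x : UnitAddCircle) : u k x = (fourier (k : ℤ) x : ℂ).im := by
  rw [u, sin_eq_im_toCircle, toCircle_twist]

lemma w_apply (k : ℕ) (x : UnitAddCircle) : w k x = 1 - (fourier (k : ℤ) x : ℂ).re := by
  rw [w, ← toCircle_twist]
  simp [Real.Angle.coe_toCircle]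

/-- The sum of the modes `k` and `-k` of a real function, with value `0` at `0`. -/
def modePair (k : ℕ) (a : ℂ) : H1 :=
  a • (chr k - 1) + (starRingEnd ℂ a) • (chr (-k) - 1)

lemma ev_modePair (k : ℕ) (a : ℂ) (x : UnitAddCircle) :
    ev x (modePair k a) = (((-2 * a.im) • u k + (-2 * a.re) • w k) x : ℝ) := by
  simp only [modePair, map_add, map_smul, map_sub, ev_chr, ev_one, fourier_neg, Pi.add_apply,
    Pi.smul_apply, u_apply, w_apply, smul_eq_mul]
  apply Complex.ext <;> simp <;> ring

lemma ev_modeUW (k : ℕ) (α β : ℝ) (x : UnitAddCircle) :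
    ev x (modePair k (-β / 2 - α / 2 * Complex.I)) = ((α • u k + β • w k) x : ℝ) := by
  rw [ev_modePair]
  congr 3
  simp
  ring_nf

lemma coef_modePair {k : ℕ} (a : ℂ) {n : ℤ} (hn : n ≠ 0) (h1 : n ≠ k) (h2 : n ≠ -k) :
    coef n (modePair k a) = 0 := by
  simp [modePair, coef_chr, coef_one, hn, h1, h2]

lemma coef_modePair_self {k : ℕ} (hk : 1 ≤ k) (a : ℂ) : coef k (modePair k a) = a := by
  have h1 : (k : ℤ) ≠ -k := by omega
  have h2 : k ≠ 0 := by omega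
  simp [modePair, coef_chr, coef_one, h1, h2]

lemma ev_zero_modePair (k : ℕ) (a : ℂ) : ev 0 (modePair k a) = 0 := by
  simp [modePair]

lemma modePair_mem_compl {k ℓ : ℕ} (hℓ : 1 ≤ ℓ) (hk : k ≠ ℓ) (a : ℂ) :
    modePair k a ∈ compl ℓ := by
  have hl : (ℓ : ℤ) ≠ 0 := by omega
  exact ⟨cj_of_ev (ev_modePair k a), ev_zero_modePair k a,
    coef_modePair a hl (by omega) (by omega), coef_modePair a (by omega) (by omega) (by omega)⟩

lemma span_le_map_compl {ℓ : ℕ} (hℓ : 1 ≤ ℓ) :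
    Submodule.span ℝ {e : UnitAddCircle → ℝ | ∃ k : ℕ, 1 ≤ k ∧ k ≠ ℓ ∧ (e = u k ∨ e = w k)} ≤
      (compl ℓ).map reMap := by
  refine Submodule.span_le.2 ?_
  rintro e ⟨k, -, hk, rfl | rfl⟩
  · refine ⟨_, modePair_mem_compl hℓ hk (-(1 / 2) * Complex.I),
      reMap_of_ev fun x => ?_⟩
    rw [ev_modePair]; simp
  · refine ⟨_, modePair_mem_compl hℓ hk (-(1 / 2)),
      reMap_of_ev fun x => ?_⟩
    rw [ev_modePair]; simp

/-- Applying `pin` termwise to the Fourier series makes every partial sum vanish at 0; pairing n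
with -n makes it real, hence a combination of the u_n and w_n with n ≠ ℓ. -/
lemma mem_R_of_mem_compl {ℓ : ℕ} {f : H1} (hf : f ∈ compl ℓ) : reMap f ∈ R ℓ := by
  refine ⟨memH10_reMap hf.1 hf.2.1, fun ε hε => ?_⟩
  have h1 : HasSum (fun n : ℤ => coef n f • (chr n - 1)) f := by
    have := pin.hasSum (hasSum_chr f)
    rw [pin_eq_self hf.2.1] at this
    convert this using 2 with n
    simp [pin_apply]
  have h2 : HasSum (fun n : ℕ => modePair n (coef n f)) f := by
    have := h1.nat_add_neg
    -- Pairing n with -n counts the index 0 twice, but the pinned zero mode vanishes.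
    rw [chr_zero, sub_self, smul_zero, add_zero] at this
    convert this using 2 with n
    have h := coef_neg_of_cj hf.1 (-n)
    rw [neg_neg] at h
    rw [modePair, h]
  obtain ⟨s, hs⟩ := ((Metric.tendsto_nhds.1 h2) ε hε).exists
  set g : UnitAddCircle → ℝ := ∑ n ∈ s, ((-2 * (coef n f).im) • u n + (-2 * (coef n f).re) • w n)
    with hg
  refine ⟨g, Submodule.sum_mem _ fun n _ => ?_, ?_⟩
  · by_cases hn : n = 0
    · have hu : u 0 = 0 := funext fun x => by simp [u_apply]
      have hw : w 0 = 0 := funext fun x => by simp [w_apply]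
      rw [hn, hu, hw, smul_zero, smul_zero, add_zero]
      exact Submodule.zero_mem _
    by_cases hn' : n = ℓ
    · rw [hn', hf.2.2.1]
      simp
    · exact Submodule.add_mem _
        (Submodule.smul_mem _ _ (Submodule.subset_span ⟨n, by omega, hn', .inl rfl⟩))
        (Submodule.smul_mem _ _ (Submodule.subset_span ⟨n, by omega, hn', .inr rfl⟩))
  · have h3 : ∀ x, ev x (f - ∑ n ∈ s, modePair n (coef n f)) = (reMap f - g) x := fun x => by
      rw [map_sub, map_sum, ev_of_cj hf.1, Pi.sub_apply, Complex.ofReal_sub, hg, Finset.sum_apply,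
        Complex.ofReal_sum]
      simp only [ev_modePair]
    refine (h1norm_le_norm h3).trans_lt ?_
    rwa [dist_comm, dist_eq_norm] at hs

/-- The coefficients at ±ℓ vanish on the span and are continuous for the `h1norm`, so they vanish on
its closure. -/
lemma mem_R_iff {ℓ : ℕ} (hℓ : 1 ≤ ℓ) {f : UnitAddCircle → ℝ} :
    f ∈ R ℓ ↔ ∃ F ∈ compl ℓ, reMap F = f := by
  refine ⟨fun hf => ?_, ?_⟩
  · obtain ⟨F, hF⟩ := hf.1.exists_ev
    have key : ∀ n : ℤ, (∀ G ∈ compl ℓ, coef n G = 0) → coef n F = 0 := fun n hn => by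
      by_contra hne
      have hpos : 0 < ‖coef n F‖ := norm_pos_iff.2 hne
      have hK : 0 < wienerConst + 1 := by linarith [wienerConst_nonneg]
      obtain ⟨g, hg, hlt⟩ := hf.2 (‖coef n F‖ / (wienerConst + 1)) (by positivity)
      obtain ⟨Gg, hG, rfl⟩ := span_le_map_compl hℓ hg
      have h1 : ∀ x, ev x (F - Gg) = (f - reMap Gg) x := fun x => by
        rw [map_sub, hF, ev_of_cj hG.1, Pi.sub_apply, Complex.ofReal_sub]
      have h2 := norm_coef_le n (F - Gg)
      rw [map_sub, hn _ hG, sub_zero] at h2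
      have h3 := h2.trans (norm_le_h1norm h1)
      rw [lt_div_iff₀ hK] at hlt
      linarith
    exact ⟨F, ⟨cj_of_ev hF, by rw [hF, hf.1.zero, Complex.ofReal_zero],
      key _ fun G hG => hG.2.2.1, key _ fun G hG => hG.2.2.2⟩, reMap_of_ev hF⟩
  · rintro ⟨F, hF, rfl⟩
    exact mem_R_of_mem_compl hF

lemma mem_N_iff {ℓ : ℕ} {f : UnitAddCircle → ℝ} :
    f ∈ N ℓ ↔ ∃ α β : ℝ, α • u ℓ + β • w ℓ = f := Submodule.mem_span_pair

lemma exists_ev_of_mem_N {ℓ : ℕ} {f : UnitAddCircle → ℝ} (hf : f ∈ N ℓ) :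
    ∃ a : ℂ, ∀ x, ev x (modePair ℓ a) = f x := by
  obtain ⟨α, β, rfl⟩ := mem_N_iff.1 hf
  exact ⟨_, ev_modeUW ℓ α β⟩

lemma eq_zero_of_mem_N_of_mem_R {ℓ : ℕ} (hℓ : 1 ≤ ℓ) {f : UnitAddCircle → ℝ} (hN : f ∈ N ℓ)
    (hR : f ∈ R ℓ) : f = 0 := by
  obtain ⟨a, ha⟩ := exists_ev_of_mem_N hN
  obtain ⟨F, hF, rfl⟩ := (mem_R_iff hℓ).1 hR
  have h1 : modePair ℓ a = F := ext_ev fun x => by rw [ha, ev_of_cj hF.1]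
  have h2 : a = 0 := by rw [← coef_modePair_self hℓ a, h1, hF.2.2.1]
  rw [← h1, h2]
  simp [modePair]

lemma R_sub_mem {ℓ : ℕ} (hℓ : 1 ≤ ℓ) {f g : UnitAddCircle → ℝ} (hf : f ∈ R ℓ) (hg : g ∈ R ℓ) :
    f - g ∈ R ℓ := by
  obtain ⟨F, hF, rfl⟩ := (mem_R_iff hℓ).1 hf
  obtain ⟨H, hH, rfl⟩ := (mem_R_iff hℓ).1 hg
  rw [← map_sub]
  exact mem_R_of_mem_compl (Submodule.sub_mem _ hF hH)

lemma Q_eq {ℓ : ℕ} (hℓ : 1 ≤ ℓ) {f n : UnitAddCircle → ℝ} (hn : n ∈ N ℓ) (hf : f - n ∈ R ℓ) :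
    Q ℓ f = n := by
  have hex : ∃ n ∈ N ℓ, f - n ∈ R ℓ := ⟨n, hn, hf⟩
  have hQ : Q ℓ f = hex.choose := dif_pos hex
  rw [hQ]
  have h1 := hex.choose_spec
  have h2 := R_sub_mem hℓ hf h1.2
  rw [sub_sub_sub_cancel_left] at h2
  exact sub_eq_zero.1 (eq_zero_of_mem_N_of_mem_R hℓ (Submodule.sub_mem _ h1.1 hn) h2)

lemma proj_decomp {ℓ : ℕ} {F : H1} (hF : cj F = F) :
    F - proj ℓ F = modePair ℓ (coef ℓ F) := by
  have h := coef_neg_of_cj hF (-ℓ)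
  rw [neg_neg] at h
  rw [proj_apply, modePair, h]
  abel

lemma sub_Q_eq {ℓ : ℕ} (hℓ : 1 ≤ ℓ) {F : H1} (h1 : cj F = F) (h0 : ev 0 F = 0) :
    Q ℓ (reMap F) ∈ N ℓ ∧ reMap F - Q ℓ (reMap F) = reMap (proj ℓ F) := by
  have hN : reMap (modePair ℓ (coef ℓ F)) ∈ N ℓ := by
    rw [reMap_of_ev (ev_modePair ℓ _)]
    exact mem_N_iff.2 ⟨_, _, rfl⟩
  have hd : reMap F - reMap (modePair ℓ (coef ℓ F)) = reMap (proj ℓ F) := by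
    rw [← proj_decomp h1, ← map_sub, sub_sub_cancel]
  have hQ : Q ℓ (reMap F) = reMap (modePair ℓ (coef ℓ F)) :=
    Q_eq hℓ hN (by rw [hd]; exact mem_R_of_mem_compl (proj_mem_compl hℓ h1 h0))
  rw [hQ]
  exact ⟨hN, hd⟩

lemma reMap_eq_zero_iff {F : H1} (h1 : cj F = F) : reMap F = 0 ↔ F = 0 := by
  refine ⟨fun h => ext_ev fun x => ?_, fun h => by rw [h, map_zero]⟩
  rw [ev_of_cj h1, h, map_zero]
  simp

lemma Fq_eq_reMap {q : ℕ} {V : H1} {v : UnitAddCircle → ℝ} (hV : ∀ x, ev x V = v x)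
    (h0 : v 0 = 0) {p : ℝ × ℝ × ℝ} (hp : p ∈ paramSpace) : Fq q v p = reMap (vf q V p) :=
  (reMap_of_ev fun x => ev_field hV h0 hp x).symm

/-- The equation of the Lyapunov–Schmidt reduction. -/
def RedEq (q ℓ : ℕ) (v : UnitAddCircle → ℝ) (p : ℝ × ℝ × ℝ) : Prop :=
  Fq q v p - Q ℓ (Fq q v p) = 0

lemma redEq_iff {q ℓ : ℕ} (hℓ : 1 ≤ ℓ) {V : H1} {v : UnitAddCircle → ℝ}
    (hV : ∀ x, ev x V = v x) (h0 : v 0 = 0) {p : ℝ × ℝ × ℝ} (hp : p ∈ paramSpace) :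
    RedEq q ℓ v p ↔ proj ℓ (vf q V p) = 0 := by
  have h1 : cj (vf q V p) = vf q V p := cj_field _ _ _ _
  have h2 : ev 0 (vf q V p) = 0 := ev_zero_field _ _ _ _
  rw [RedEq, Fq_eq_reMap hV h0 hp, (sub_Q_eq hℓ h1 h2).2,
    reMap_eq_zero_iff (proj_mem_compl hℓ h1 h2).1]

lemma Fq_decomp {q ℓ : ℕ} (hℓ : 1 ≤ ℓ) {v : UnitAddCircle → ℝ} (hv : MemH10 v)
    {p : ℝ × ℝ × ℝ} (hp : p ∈ paramSpace) :
    Q ℓ (Fq q v p) ∈ N ℓ ∧ Fq q v p - Q ℓ (Fq q v p) ∈ R ℓ := by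
  obtain ⟨V, hV⟩ := hv.exists_ev
  have h1 : cj (vf q V p) = vf q V p := cj_field _ _ _ _
  have h2 : ev 0 (vf q V p) = 0 := ev_zero_field _ _ _ _
  rw [Fq_eq_reMap hV hv.zero hp]
  refine ⟨(sub_Q_eq hℓ h1 h2).1, ?_⟩
  rw [(sub_Q_eq hℓ h1 h2).2]
  exact mem_R_of_mem_compl (proj_mem_compl hℓ h1 h2)

lemma memH10_of_mem_N {ℓ : ℕ} {v : UnitAddCircle → ℝ} (hv : v ∈ N ℓ) : MemH10 v := by
  obtain ⟨a, ha⟩ := exists_ev_of_mem_N hv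
  refine memH10_of_ev ha ?_
  have := ha 0
  rw [ev_zero_modePair] at this
  exact_mod_cast this.symm

lemma MemH10.add {f g : UnitAddCircle → ℝ} (hf : MemH10 f) (hg : MemH10 g) : MemH10 (f + g) := by
  obtain ⟨F, hF⟩ := hf.exists_ev
  obtain ⟨H, hH⟩ := hg.exists_ev
  exact memH10_of_ev (F := F + H) (fun x => by simp [hF, hH]) (by simp [hf.zero, hg.zero])

/-- Radii are divided by `wienerConst + 1` to pass from the `h1norm` to the norm of `H1`. The
solution lies in a ball as small as desired while uniqueness holds in a fixed one; `phi_equivariant`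
depends on this. -/
theorem lyapunovSchmidt_real {q ℓ : ℕ} (hℓ : 1 ≤ ℓ) {p₀ : ℝ × ℝ × ℝ}
    (hp₀ : p₀ ∈ interior paramSpace) {ε : ℝ} (hε : 0 < ε)
    (hgap : ∀ k : ℕ, 1 ≤ k → k ≠ ℓ → c1 q k p₀ ∉ Ioo (-ε) ε) :
    ∃ ρ₀ > 0, ∀ ρ > 0, ρ ≤ ρ₀ → ∃ η > 0, ∃ V ∈ 𝓝 p₀, V ⊆ paramSpace ∧
      ∀ v ∈ N ℓ, h1norm v < η → ∀ p ∈ V,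
      ∃ y ∈ R ℓ, h1norm y < ρ ∧ RedEq q ℓ (v + y) p ∧
        ∀ y' ∈ R ℓ, h1norm y' < ρ₀ → RedEq q ℓ (v + y') p → y' = y := by
  obtain ⟨ρ₀, hρ₀, H⟩ := lyapunovSchmidt hℓ hε hgap
  have hK : 0 < wienerConst + 1 := by linarith [wienerConst_nonneg]
  have hK1 : 1 ≤ wienerConst + 1 := by linarith [wienerConst_nonneg]
  have hlt : ∀ {f : UnitAddCircle → ℝ} {F : H1} {r : ℝ}, (∀ x, ev x F = f x) →
      h1norm f < r / (wienerConst + 1) → ‖F‖ < r := fun {f F r} hF h => by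
    rw [lt_div_iff₀ hK, mul_comm] at h
    exact (norm_le_h1norm hF).trans_lt h
  refine ⟨ρ₀ / (wienerConst + 1), by positivity, fun ρ hρ hρ' => ?_⟩
  have hρ₁ : ρ ≤ ρ₀ := hρ'.trans (div_le_self hρ₀.le hK1)
  obtain ⟨η, hη, V, hV, H'⟩ := H ρ hρ hρ₁
  refine ⟨η / (wienerConst + 1), by positivity, V ∩ interior paramSpace,
    inter_mem hV (isOpen_interior.mem_nhds hp₀), inter_subset_right.trans interior_subset,
    fun v hv hvη p hp => ?_⟩
  have hpp : p ∈ paramSpace := interior_subset hp.2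
  obtain ⟨a, ha⟩ := exists_ev_of_mem_N hv
  have hv0 := (memH10_of_mem_N hv).zero
  obtain ⟨⟨y, hy, hyρ, hy0⟩, huniq⟩ := H' _ (hlt ha hvη) p hp.1
  have hiff : ∀ y ∈ compl ℓ, RedEq q ℓ (v + reMap y) p ↔
      proj ℓ (vf q (modePair ℓ a + y) p) = 0 := fun y hy => by
    refine redEq_iff hℓ (fun x => ?_) ?_ hpp
    · rw [map_add, ha, ev_of_cj hy.1, Pi.add_apply, Complex.ofReal_add]
    · simp [hv0, reMap_apply, hy.2.1]
  refine ⟨reMap y, mem_R_of_mem_compl hy, (h1norm_le_norm (ev_of_cj hy.1)).trans_lt hyρ,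
    (hiff y hy).2 hy0, fun y' hy' hn hz => ?_⟩
  obtain ⟨Y, hY, rfl⟩ := (mem_R_iff hℓ).1 hy'
  rw [huniq Y hY y hy (hlt (ev_of_cj hY.1) hn) (hyρ.trans_le hρ₁) ((hiff Y hY).1 hz) hy0]

/-- ψ picks the unique solution and is 0 elsewhere. That ψ(0, p₀) = 0 follows from uniqueness, since
y = 0 solves the equation at the twisted state. -/
theorem exists_isReduction {q ℓ : ℕ} (hℓ : 1 ≤ ℓ) {p₀ : ℝ × ℝ × ℝ}
    (hp₀ : p₀ ∈ interior paramSpace) {ε : ℝ} (hε : 0 < ε)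
    (hgap : ∀ k : ℕ, 1 ≤ k → k ≠ ℓ → c1 q k p₀ ∉ Ioo (-ε) ε) :
    ∃ ψ, IsReduction q ℓ p₀ ψ := by
  classical
  obtain ⟨ρ, hρ, H⟩ := lyapunovSchmidt_real (q := q) hℓ hp₀ hε hgap
  obtain ⟨η, hη, V, hV, hVs, H'⟩ := H ρ hρ le_rfl
  set ψ : (UnitAddCircle → ℝ) → (ℝ × ℝ × ℝ) → (UnitAddCircle → ℝ) := fun v p =>
    if h : v ∈ N ℓ ∧ h1norm v < η ∧ p ∈ V then (H' v h.1 h.2.1 p h.2.2).choose else 0 with hψ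
  have hspec : ∀ v ∈ N ℓ, h1norm v < η → ∀ p ∈ V, ψ v p ∈ R ℓ ∧ h1norm (ψ v p) < ρ ∧
      RedEq q ℓ (v + ψ v p) p ∧
        ∀ y' ∈ R ℓ, h1norm y' < ρ → RedEq q ℓ (v + y') p → y' = ψ v p := by
    intro v hv hn p hp
    have e : ψ v p = (H' v hv hn p hp).choose := dif_pos ⟨hv, hn, hp⟩
    rw [e]
    exact (H' v hv hn p hp).choose_spec
  have h0R : (0 : UnitAddCircle → ℝ) ∈ R ℓ :=
    (mem_R_iff hℓ).2 ⟨0, Submodule.zero_mem _, map_zero _⟩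
  have h0n : h1norm (0 : UnitAddCircle → ℝ) ≤ 0 := by
    simpa using h1norm_le_norm (f := 0) (F := 0) (fun x => by simp)
  have hpp : p₀ ∈ paramSpace := interior_subset hp₀
  have hz : RedEq q ℓ (0 + 0) p₀ := by
    refine (redEq_iff hℓ (V := 0) (fun x => by simp) (by simp) hpp).2 ?_
    rw [vf, field_zero _ ⟨_, T_one q p₀.1⟩, map_zero]
  refine ⟨ψ, ?_, η, hη, ρ, hρ, V, hV, hVs, fun v hv hn p hp => ?_⟩
  · exact ((hspec 0 (Submodule.zero_mem _) (h0n.trans_lt hη) p₀ (mem_of_mem_nhds hV)).2.2.2 0 h0R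
      (h0n.trans_lt hρ) hz).symm
  · obtain ⟨h1, h2, h3, h4⟩ := hspec v hv hn p hp
    exact ⟨⟨h1, h2, h3⟩, h4⟩

end

section

open AddCircle H1

/-! ### Symmetries of the vector field -/

/-- Translation of a function, normalized to vanish at `0`. -/
def shift (φ : UnitAddCircle) : (UnitAddCircle → ℝ) →ₗ[ℝ] (UnitAddCircle → ℝ) where
  toFun v := fun x => v (x + φ) - v φ
  map_add' v v' := by ext x; simp; ring
  map_smul' c v := by ext x; simp; ring

/-- The reflection `v ↦ -v(-x)`. -/
def reflect : (UnitAddCircle → ℝ) →ₗ[ℝ] (UnitAddCircle → ℝ) where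
  toFun v := fun x => -v (-x)
  map_add' v v' := by ext x; simp; ring
  map_smul' c v := by ext x; simp

lemma shift_apply (φ : UnitAddCircle) (v : UnitAddCircle → ℝ) (x : UnitAddCircle) :
    shift φ v x = v (x + φ) - v φ := rfl

lemma reflect_apply (v : UnitAddCircle → ℝ) (x : UnitAddCircle) : reflect v x = -v (-x) := rfl

lemma twist_coe (k : ℕ) (t : ℝ) : twist k (t : UnitAddCircle) = ((2 * π * k * t : ℝ) : Real.Angle) :=
  rfl

lemma twist_add (k : ℕ) (x y : UnitAddCircle) : twist k (x + y) = twist k x + twist k y := by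
  induction x using QuotientAddGroup.induction_on with
  | H s =>
    induction y using QuotientAddGroup.induction_on with
    | H t =>
      change twist k ((s + t : ℝ) : UnitAddCircle) = twist k (s : UnitAddCircle) + twist k (t : UnitAddCircle)
      rw [twist_coe, twist_coe, twist_coe, mul_add, Real.Angle.coe_add]

lemma twist_zero (k : ℕ) : twist k 0 = 0 := by
  have := twist_add k 0 0
  simpa using this

lemma twist_neg (k : ℕ) (x : UnitAddCircle) : twist k (-x) = -twist k x := by
  have := twist_add k (-x) x
  rw [neg_add_cancel, twist_zero] at this
  exact eq_neg_of_add_eq_zero_left this.symm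

lemma twist_surjective {k : ℕ} (hk : 1 ≤ k) : Function.Surjective (twist k) := by
  intro θ
  induction θ using Real.Angle.induction_on with
  | _ t =>
    refine ⟨((t / (2 * π * k) : ℝ) : UnitAddCircle), ?_⟩
    have : (0 : ℝ) < k := by exact_mod_cast hk
    rw [twist_coe, mul_div_cancel₀ _ (by positivity)]

/-! ### Translation and reflection equivariance of the interactions. -/

section Equivariance

variable (Ψ : UnitAddCircle → Real.Angle) (r : ℝ) (φ x : UnitAddCircle) (c : Real.Angle)

/-- Translate all integration variables by φ. Phases enter through combinations of total weight
zero, so the constant c cancels; the same holds for the other interactions. -/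
lemma G1_shift : G1 (fun x => Ψ (x + φ) - c) r x = G1 Ψ r (x + φ) := by
  unfold G1
  symm
  rw [← integral_add_right_eq_self _ φ]
  congr 1
  ext y
  rw [add_sub_add_right_eq_sub, sub_sub_sub_cancel_right]

lemma G2_shift : G2 (fun x => Ψ (x + φ) - c) r x = G2 Ψ r (x + φ) := by
  unfold G2
  symm
  rw [← integral_add_right_eq_self _ φ]
  congr 1
  ext z
  rw [← integral_add_right_eq_self _ φ]
  congr 1
  ext y
  congr 2
  · rw [smul_add, two_smul, two_smul]; abel
  · simp only [smul_sub, two_smul]; abel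

lemma G3_shift : G3 (fun x => Ψ (x + φ) - c) r x = G3 Ψ r (x + φ) := by
  unfold G3
  symm
  rw [← integral_add_right_eq_self _ φ]
  congr 1
  ext z
  rw [← integral_add_right_eq_self _ φ]
  congr 1
  ext y
  rw [← integral_add_right_eq_self _ φ]
  congr 1
  ext w
  congr 2
  · abel
  · beta_reduce; abel

lemma G_shift (p : ℝ × ℝ × ℝ) : G (fun x => Ψ (x + φ) - c) p x = G Ψ p (x + φ) := by
  rw [G, G1_shift, G2_shift, G3_shift, G]

/-- Negate the integration variable: the kernel is even and the sine odd. The multiple integrals are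
treated in the same way, one variable at a time. -/
lemma G1_reflect : G1 (fun x => -Ψ (-x)) r x = -G1 Ψ r (-x) := by
  unfold G1
  rw [← integral_neg_eq_self, ← integral_neg]
  congr 1
  ext y
  rw [← W_neg, ← mul_neg, ← Real.Angle.sin_neg]
  congr 2
  · abel
  · simp only [neg_neg]; abel

lemma G2_reflect : G2 (fun x => -Ψ (-x)) r x = -G2 Ψ r (-x) := by
  unfold G2
  rw [← integral_neg_eq_self, ← integral_neg]
  congr 1
  ext z
  rw [← integral_neg_eq_self, ← integral_neg]
  congr 1
  ext y
  rw [← W_neg, ← mul_neg, ← Real.Angle.sin_neg]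
  congr 2
  · rw [smul_neg]; abel
  · simp only [neg_neg, smul_neg]; abel

lemma G3_reflect : G3 (fun x => -Ψ (-x)) r x = -G3 Ψ r (-x) := by
  unfold G3
  rw [← integral_neg_eq_self, ← integral_neg]
  congr 1
  ext z
  rw [← integral_neg_eq_self, ← integral_neg]
  congr 1
  ext y
  rw [← integral_neg_eq_self, ← integral_neg]
  congr 1
  ext w
  rw [← W_neg, ← mul_neg, ← Real.Angle.sin_neg]
  congr 2
  · abel
  · simp only [neg_neg]; abel

lemma G_reflect (p : ℝ × ℝ × ℝ) : G (fun x => -Ψ (-x)) p x = -G Ψ p (-x) := by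
  rw [G, G1_reflect, G2_reflect, G3_reflect, G]
  ring

end Equivariance

lemma phase_zero (q : ℕ) {v : UnitAddCircle → ℝ} (hv : v 0 = 0) : phase q v 0 = 0 := by
  simp [phase, twist_zero, hv]

lemma phase_shift (q : ℕ) (φ : UnitAddCircle) (v : UnitAddCircle → ℝ) :
    phase q (shift φ v) = fun x => phase q v (x + φ) - phase q v φ := by
  ext x
  simp only [phase, shift_apply, twist_add, Real.Angle.coe_sub]
  abel

lemma phase_reflect (q : ℕ) (v : UnitAddCircle → ℝ) :
    phase q (reflect v) = fun x => -phase q v (-x) := by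
  ext x
  simp only [phase, reflect_apply, twist_neg, Real.Angle.coe_neg]
  abel

lemma Fq_eq_G_sub (q : ℕ) {v : UnitAddCircle → ℝ} (hv : v 0 = 0) (p : ℝ × ℝ × ℝ)
    (x : UnitAddCircle) : Fq q v p x = G (phase q v) p x - G (phase q v) p 0 :=
  F_eq_G_sub (phase_zero q hv) p x

lemma Fq_shift (q : ℕ) (φ : UnitAddCircle) {v : UnitAddCircle → ℝ} (hv : v 0 = 0)
    (p : ℝ × ℝ × ℝ) : Fq q (shift φ v) p = shift φ (Fq q v p) := by
  ext x
  rw [shift_apply, Fq_eq_G_sub q hv, Fq_eq_G_sub q hv, Fq_eq_G_sub q (by simp [shift_apply]),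
    phase_shift, G_shift, G_shift, zero_add]
  ring

lemma Fq_reflect (q : ℕ) {v : UnitAddCircle → ℝ} (hv : v 0 = 0)
    (p : ℝ × ℝ × ℝ) : Fq q (reflect v) p = reflect (Fq q v p) := by
  ext x
  rw [reflect_apply, Fq_eq_G_sub q hv, Fq_eq_G_sub q (by simp [reflect_apply, hv]),
    phase_reflect, G_reflect, G_reflect, neg_zero]
  ring

/-! ### Symmetries of the reduction. -/

/-- A symmetry of the Lyapunov–Schmidt reduction. -/
structure IsSymm (q ℓ : ℕ) (C : ℝ) (σ : (UnitAddCircle → ℝ) →ₗ[ℝ] (UnitAddCircle → ℝ)) : Prop where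
  map_N : ∀ v ∈ N ℓ, σ v ∈ N ℓ
  map_R : ∀ y ∈ R ℓ, σ y ∈ R ℓ
  norm_le : ∀ f, MemH10 f → h1norm (σ f) ≤ C * h1norm f
  map_Fq : ∀ v p, v 0 = 0 → Fq q (σ v) p = σ (Fq q v p)

/-- The symbol of a translation. -/
def shiftSymb (φ : UnitAddCircle) : Symb :=
  BoundedContinuousFunction.ofNormedAddCommGroupDiscrete (fun n => (fourier n φ : ℂ)) 1 fun n => by
    rw [fourier_apply, Circle.norm_coe]

lemma ev_mult_shiftSymb (φ x : UnitAddCircle) (f : H1) :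
    ev x (mult (shiftSymb φ) f) = ev (x + φ) f := by
  have : ev x ∘L mult (shiftSymb φ) = ev (x + φ) := clm_ext fun n => by
    rw [ContinuousLinearMap.comp_apply, mult_chr, map_smul, ev_chr, ev_chr, ← fourier_mul_cancel,
      mul_comm]
    rfl
  exact congrArg (· f) this

lemma norm_shiftSymb_le (φ : UnitAddCircle) : ‖shiftSymb φ‖ ≤ 1 :=
  (BoundedContinuousFunction.norm_le zero_le_one).2 fun n => by
    change ‖(fourier n φ : ℂ)‖ ≤ 1
    rw [fourier_apply, Circle.norm_coe]

lemma ev_pin_shift {F : H1} {f : UnitAddCircle → ℝ} (hF : ∀ x, ev x F = f x) (φ x : UnitAddCircle) :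
    ev x (pin (mult (shiftSymb φ) F)) = shift φ f x := by
  rw [ev_pin, ev_mult_shiftSymb, ev_mult_shiftSymb, hF, hF, zero_add, shift_apply,
    Complex.ofReal_sub]

lemma ev_neg_dil {F : H1} {f : UnitAddCircle → ℝ} (hF : ∀ x, ev x F = f x) (x : UnitAddCircle) :
    ev x (-dil (-1) (by norm_num) F) = reflect f x := by
  rw [map_neg, ev_dil, neg_one_smul, hF, reflect_apply, Complex.ofReal_neg]

lemma coef_dil_neg_one (F : H1) (n : ℤ) :
    coef n (dil (-1) (by norm_num) F) = coef (-n) F := by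
  have h := (mul_right_injective₀ (show (-1 : ℤ) ≠ 0 by norm_num)).extend_apply
    (fun n => coef n F) 0 (-n)
  rw [coef_dil]
  simpa using h

lemma mem_R_of_ev {ℓ : ℕ} {F : H1} {f : UnitAddCircle → ℝ} (hF : ∀ x, ev x F = f x)
    (h0 : ev 0 F = 0) (h1 : coef ℓ F = 0) (h2 : coef (-ℓ) F = 0) : f ∈ R ℓ := by
  rw [← reMap_of_ev hF]
  exact mem_R_of_mem_compl ⟨cj_of_ev hF, h0, h1, h2⟩

lemma norm_le_of_lift {σ : (UnitAddCircle → ℝ) →ₗ[ℝ] (UnitAddCircle → ℝ)} {L : H1 → H1} {C : ℝ}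
    (hL : ∀ F, ‖L F‖ ≤ C * ‖F‖) (hC : 0 ≤ C)
    (hσ : ∀ (F : H1) (f : UnitAddCircle → ℝ), (∀ x, ev x F = f x) → ∀ x, ev x (L F) = σ f x)
    (f : UnitAddCircle → ℝ) (hf : MemH10 f) : h1norm (σ f) ≤ C * (wienerConst + 1) * h1norm f := by
  obtain ⟨F, hF⟩ := hf.exists_ev
  calc h1norm (σ f) ≤ ‖L F‖ := h1norm_le_norm (hσ F f hF)
    _ ≤ C * ‖F‖ := hL F
    _ ≤ C * ((wienerConst + 1) * h1norm f) := by gcongr; exact norm_le_h1norm hF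
    _ = _ := by ring

/-- The element of `N` with given coordinates. -/
def comb (ℓ : ℕ) (x : Fin 2 → ℝ) : UnitAddCircle → ℝ := x 0 • u ℓ + x 1 • w ℓ

lemma comb_mem_N (ℓ : ℕ) (x : Fin 2 → ℝ) : comb ℓ x ∈ N ℓ := mem_N_iff.2 ⟨_, _, rfl⟩

lemma exists_comb_of_mem_N {ℓ : ℕ} {f : UnitAddCircle → ℝ} (hf : f ∈ N ℓ) :
    ∃ x, comb ℓ x = f := by
  obtain ⟨α, β, h⟩ := mem_N_iff.1 hf
  exact ⟨![α, β], by simpa [comb] using h⟩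

lemma A_mulVec (ℓ : ℕ) (φ : UnitAddCircle) (x : Fin 2 → ℝ) :
    A ℓ φ *ᵥ x = ![(twist ℓ φ).cos * x 0 + (twist ℓ φ).sin * x 1,
      -(twist ℓ φ).sin * x 0 + (twist ℓ φ).cos * x 1] := by
  ext i
  fin_cases i <;> simp [A, Matrix.mulVec, dotProduct, Fin.sum_univ_two]

lemma shift_comb (ℓ : ℕ) (φ : UnitAddCircle) (x : Fin 2 → ℝ) :
    shift φ (comb ℓ x) = comb ℓ (A ℓ φ *ᵥ x) := by
  ext t
  rw [A_mulVec]
  simp only [comb, shift_apply, Pi.add_apply, Pi.smul_apply, smul_eq_mul, u, w, twist_add,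
    Real.Angle.sin_add, Real.Angle.cos_add, Matrix.cons_val_zero, Matrix.cons_val_one]
  ring

lemma reflect_comb (ℓ : ℕ) (x : Fin 2 → ℝ) :
    reflect (comb ℓ x) = comb ℓ ![x 0, -x 1] := by
  ext t
  simp only [comb, reflect_apply, Pi.add_apply, Pi.smul_apply, smul_eq_mul, u, w, twist_neg,
    Real.Angle.sin_neg, Real.Angle.cos_neg, Matrix.cons_val_zero, Matrix.cons_val_one]
  ring

/-- A normalized translation is not an isometry, since subtracting v(φ) changes the L² norm. Its
bound is nevertheless uniform in φ because the symbol of a translation has modulus 1, so a single C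
serves the whole group. -/
lemma exists_isSymm (q : ℕ) {ℓ : ℕ} (hℓ : 1 ≤ ℓ) :
    ∃ C > 0, (∀ φ, IsSymm q ℓ C (shift φ)) ∧ IsSymm q ℓ C reflect := by
  have hl : (ℓ : ℤ) ≠ 0 := by omega
  have hl' : (-ℓ : ℤ) ≠ 0 := by omega
  set L : H1 →L[ℂ] H1 := dil (-1) (by norm_num) with hL
  set C : ℝ := (‖pin‖ * ‖mult‖ + ‖L‖ + 1) with hC
  have hC0 : 0 < C := by positivity
  have hK : 0 < wienerConst + 1 := by linarith [wienerConst_nonneg]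
  refine ⟨C * (wienerConst + 1), by positivity, fun φ => ⟨?_, ?_, ?_, fun v p hv => Fq_shift q φ hv p⟩,
    ?_, ?_, ?_, fun v p hv => Fq_reflect q hv p⟩
  · intro v hv
    obtain ⟨x, rfl⟩ := exists_comb_of_mem_N hv
    rw [shift_comb]
    exact comb_mem_N _ _
  · intro y hy
    obtain ⟨Y, hY, rfl⟩ := (mem_R_iff hℓ).1 hy
    refine mem_R_of_ev (ev_pin_shift (ev_of_cj hY.1) φ) (ev_zero_pin _) ?_ ?_
    · rw [coef_pin hl, coef_mult, hY.2.2.1, mul_zero]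
    · rw [coef_pin hl', coef_mult, hY.2.2.2, mul_zero]
  · refine norm_le_of_lift (L := fun F => pin (mult (shiftSymb φ) F)) (fun F => ?_) hC0.le
      (fun F f hF => ev_pin_shift hF φ)
    calc ‖pin (mult (shiftSymb φ) F)‖ ≤ ‖pin‖ * (‖mult‖ * 1 * ‖F‖) := by
          refine (pin.le_opNorm _).trans ?_
          gcongr
          refine (mult.le_opNorm₂ _ _).trans ?_
          gcongr
          exact norm_shiftSymb_le φ
      _ = ‖pin‖ * ‖mult‖ * ‖F‖ := by ring
      _ ≤ C * ‖F‖ := by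
          gcongr
          rw [hC, add_assoc]
          exact le_add_of_nonneg_right (by positivity)
  · intro v hv
    obtain ⟨x, rfl⟩ := exists_comb_of_mem_N hv
    rw [reflect_comb]
    exact comb_mem_N _ _
  · intro y hy
    obtain ⟨Y, hY, rfl⟩ := (mem_R_iff hℓ).1 hy
    refine mem_R_of_ev (ev_neg_dil (ev_of_cj hY.1)) ?_ ?_ ?_
    · rw [map_neg, ev_dil, smul_zero, hY.2.1, neg_zero]
    · rw [map_neg, coef_dil_neg_one, hY.2.2.2, neg_zero]
    · rw [map_neg, coef_dil_neg_one, neg_neg, hY.2.2.1, neg_zero]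
  · refine norm_le_of_lift (L := fun F => -L F) (fun F => ?_) hC0.le (fun F f hF => ev_neg_dil hF)
    rw [norm_neg]
    refine (L.le_opNorm F).trans ?_
    gcongr
    rw [hC]
    have : 0 ≤ ‖pin‖ * ‖mult‖ := by positivity
    linarith

/-- If y solves the equation for v, then σ y solves it for σ v, and uniqueness gives σ (ψ v p) = ψ
(σ v) p once σ y lies in the ball of ψ. Continuity of ψ is not part of `IsReduction`; the smallness
of ψ v p comes from the small solution of `lyapunovSchmidt_real`, which uniqueness identifies with
it. -/
theorem phi_equivariant {q ℓ : ℕ} (hℓ : 1 ≤ ℓ) {p₀ : ℝ × ℝ × ℝ}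
    (hp₀ : p₀ ∈ interior paramSpace) {ε : ℝ} (hε : 0 < ε)
    (hgap : ∀ k : ℕ, 1 ≤ k → k ≠ ℓ → c1 q k p₀ ∉ Ioo (-ε) ε)
    {ψ : (UnitAddCircle → ℝ) → (ℝ × ℝ × ℝ) → (UnitAddCircle → ℝ)} (hψ : IsReduction q ℓ p₀ ψ)
    {C : ℝ} (hC : 0 < C) :
    ∃ η > 0, ∃ V ∈ 𝓝 p₀, ∀ v ∈ N ℓ, h1norm v < η → ∀ p ∈ V, Phi q ℓ ψ v p ∈ N ℓ ∧
      ∀ σ, IsSymm q ℓ C σ → Phi q ℓ ψ (σ v) p = σ (Phi q ℓ ψ v p) := by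
  obtain ⟨ρ₀, hρ₀, H⟩ := lyapunovSchmidt_real hℓ hp₀ hε hgap
  obtain ⟨-, ε', hε', ρ, hρ, V, hV, hVs, hred⟩ := hψ
  -- The radius is small enough that both y and σ y, whose norm is at most C times that of y, lie in
  -- the uniqueness ball of ψ.
  obtain ⟨η, hη, V', hV', -, H'⟩ := H (min ρ₀ (min ρ (ρ / C))) (by positivity) (min_le_left _ _)
  refine ⟨min η (min ε' (ε' / C)), by positivity, V ∩ V', inter_mem hV hV', fun v hv hn p hp => ?_⟩
  have hn1 : h1norm v < η := hn.trans_le (min_le_left _ _)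
  have hn2 : h1norm v < ε' := (hn.trans_le (min_le_right _ _)).trans_le (min_le_left _ _)
  have hn3 : h1norm v < ε' / C := (hn.trans_le (min_le_right _ _)).trans_le (min_le_right _ _)
  obtain ⟨y, hy, hyn, hy0, -⟩ := H' v hv hn1 p hp.2
  have hy2 : h1norm y < ρ := (hyn.trans_le (min_le_right _ _)).trans_le (min_le_left _ _)
  have hy3 : h1norm y < ρ / C := (hyn.trans_le (min_le_right _ _)).trans_le (min_le_right _ _)
  have hψv : y = ψ v p := (hred v hv hn2 p hp.1).2 y hy hy2 hy0
  have hvH := memH10_of_mem_N hv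
  have hsum := hvH.add hy.1
  have hdec := Fq_decomp (q := q) hℓ hsum (hVs hp.1)
  refine ⟨by rw [Phi, ← hψv]; exact hdec.1, fun σ hσ => ?_⟩
  have hF : Fq q (σ v + σ y) p = σ (Fq q (v + y) p) := by
    rw [← map_add, hσ.map_Fq _ _ hsum.zero]
  have hQ : Q ℓ (σ (Fq q (v + y) p)) = σ (Q ℓ (Fq q (v + y) p)) :=
    Q_eq hℓ (hσ.map_N _ hdec.1) (by rw [← map_sub]; exact hσ.map_R _ hdec.2)
  have hσv : h1norm (σ v) < ε' := by
    rw [lt_div_iff₀' hC] at hn3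
    exact (hσ.norm_le v hvH).trans_lt hn3
  have hσy : h1norm (σ y) < ρ := by
    rw [lt_div_iff₀' hC] at hy3
    exact (hσ.norm_le y hy.1).trans_lt hy3
  have hψσ : σ y = ψ (σ v) p := by
    refine (hred (σ v) (hσ.map_N v hv) hσv p hp.1).2 (σ y) (hσ.map_R y hy) hσy ?_
    rw [hF, hQ, ← map_sub, show Fq q (v + y) p - Q ℓ (Fq q (v + y) p) = 0 from hy0, map_zero]
  rw [Phi, Phi, ← hψσ, ← hψv, hF, hQ]

/-! ### The reduced map in coordinates -/

/-- The functionals are dual to the basis u_ℓ, w_ℓ: both coordinates are read off the Fourier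
coefficient -b/2 - (a/2) i at ℓ ≥ 1, which does not see the constant part of w_ℓ. -/
lemma zStar_comb {ℓ : ℕ} (hℓ : 1 ≤ ℓ) (x : Fin 2 → ℝ) :
    zStar1 ℓ (comb ℓ x) = x 0 ∧ zStar2 ℓ (comb ℓ x) = x 1 := by
  have hev := ev_modeUW ℓ (x 0) (x 1)
  have h := coef_eq_integral (modePair ℓ (-(x 1) / 2 - (x 0) / 2 * Complex.I)) ℓ
  simp only [hev] at h
  have hi : Integrable (comb ℓ x) :=
    Integrable.of_bound (C := ‖modePair ℓ (-(x 1) / 2 - (x 0) / 2 * Complex.I)‖)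
      (continuous_of_ev hev).aestronglyMeasurable (.of_forall fun t => by
        have := norm_ev_le t (modePair ℓ (-(x 1) / 2 - (x 0) / 2 * Complex.I))
        rw [hev, Complex.norm_real] at this
        exact this)
  have h2 := integral_fourier_neg_mul hi ℓ
  have h3 : (∫ t : UnitAddCircle, (fourier (-(ℓ : ℤ)) t : ℂ) * (comb ℓ x t : ℂ))
      = -(x 1) / 2 - (x 0) / 2 * Complex.I := by
    rw [← coef_modePair_self hℓ (-(x 1) / 2 - (x 0) / 2 * Complex.I), h]
    rfl
  rw [h3] at h2
  have hre := congrArg Complex.re h2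
  have him := congrArg Complex.im h2
  simp at hre him
  have e1 : ∀ t, (twist ℓ t).sin = (fourier (ℓ : ℤ) t : ℂ).im := u_apply ℓ
  have e2 : ∀ t, (twist ℓ t).cos = (fourier (ℓ : ℤ) t : ℂ).re := fun t => by
    have := w_apply ℓ t
    unfold w at this
    linarith
  simp only [zStar1, zStar2, e1, e2, mul_comm _ (comb ℓ x _), fourier_apply, natCast_zsmul]
  constructor <;> linarith

lemma comb_injective {ℓ : ℕ} (hℓ : 1 ≤ ℓ) : Function.Injective (comb ℓ) := by
  intro x y h
  ext i
  fin_cases i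
  · exact (zStar_comb hℓ x).1.symm.trans (h ▸ (zStar_comb hℓ y).1)
  · exact (zStar_comb hℓ x).2.symm.trans (h ▸ (zStar_comb hℓ y).2)

lemma comb_PhiHat {q ℓ : ℕ} (hℓ : 1 ≤ ℓ)
    {ψ : (UnitAddCircle → ℝ) → (ℝ × ℝ × ℝ) → (UnitAddCircle → ℝ)} {p : ℝ → ℝ × ℝ × ℝ}
    {x : Fin 2 → ℝ} {s : ℝ} (h : Phi q ℓ ψ (comb ℓ x) (p s) ∈ N ℓ) :
    comb ℓ (PhiHat q ℓ ψ p x s) = Phi q ℓ ψ (comb ℓ x) (p s) := by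
  obtain ⟨z, hz⟩ := exists_comb_of_mem_N h
  have : PhiHat q ℓ ψ p x s = z := by
    have e : PhiHat q ℓ ψ p x s = ![zStar1 ℓ (comb ℓ z), zStar2 ℓ (comb ℓ z)] := by rw [hz]; rfl
    rw [e, (zStar_comb hℓ z).1, (zStar_comb hℓ z).2]
    ext i
    fin_cases i <;> rfl
  rw [this, hz]

lemma exists_h1norm_comb_le (ℓ : ℕ) :
    ∃ M > 0, ∀ x, h1norm (comb ℓ x) ≤ M * √(x 0 ^ 2 + x 1 ^ 2) := by
  refine ⟨‖chr ℓ - 1‖ + ‖chr (-ℓ) - 1‖ + 1, by positivity, fun x => ?_⟩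
  set a : ℂ := -(x 1) / 2 - (x 0) / 2 * Complex.I with ha
  have hna : ‖a‖ ≤ √(x 0 ^ 2 + x 1 ^ 2) := by
    rw [Complex.norm_eq_sqrt_sq_add_sq]
    refine Real.sqrt_le_sqrt ?_
    simp [ha]
    nlinarith [sq_nonneg (x 0), sq_nonneg (x 1)]
  calc h1norm (comb ℓ x) ≤ ‖modePair ℓ a‖ := h1norm_le_norm (ev_modeUW ℓ (x 0) (x 1))
    _ ≤ ‖a‖ * ‖chr ℓ - 1‖ + ‖a‖ * ‖chr (-ℓ) - 1‖ := by
        refine (norm_add_le _ _).trans ?_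
        rw [norm_smul, norm_smul, RCLike.norm_conj]
    _ = (‖chr ℓ - 1‖ + ‖chr (-ℓ) - 1‖) * ‖a‖ := by ring
    _ ≤ _ := mul_le_mul (by linarith) hna (norm_nonneg _) (by positivity)

lemma exists_polar {ℓ : ℕ} (hℓ : 1 ≤ ℓ) (x : Fin 2 → ℝ) :
    ∃ φ, A ℓ φ *ᵥ ![√(x 0 ^ 2 + x 1 ^ 2), 0] = x := by
  -- A_φ sends (d, 0) to (d cos, -d sin), so the polar angle is taken from the conjugate of x 0 + i
  -- x 1.
  set z : ℂ := ⟨x 0, -x 1⟩ with hz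
  obtain ⟨φ, hφ⟩ := twist_surjective hℓ ((Complex.arg z : ℝ) : Real.Angle)
  refine ⟨φ, ?_⟩
  have hn : ‖z‖ = √(x 0 ^ 2 + x 1 ^ 2) := by rw [Complex.norm_eq_sqrt_sq_add_sq]; simp [hz]
  rw [A_mulVec, hφ, Real.Angle.cos_coe, Real.Angle.sin_coe, ← hn]
  have h1 := Complex.norm_mul_cos_arg z
  have h2 := Complex.norm_mul_sin_arg z
  ext i
  fin_cases i
  · have : z.re = x 0 := rfl
    simp only [Fin.zero_eta, Matrix.cons_val_zero, Matrix.cons_val_one]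
    linarith
  · have : z.im = -x 1 := rfl
    simp
    linarith

/-- A map that is equivariant under all rotations and a reflection is radial. -/
lemma radial_of_equivariant {ℓ : ℕ} (hℓ : 1 ≤ ℓ) {ρ : ℝ} {g : (Fin 2 → ℝ) → Fin 2 → ℝ}
    (hrot : ∀ x, √(x 0 ^ 2 + x 1 ^ 2) < ρ → ∀ φ, g (A ℓ φ *ᵥ x) = A ℓ φ *ᵥ g x)
    (href : ∀ x, √(x 0 ^ 2 + x 1 ^ 2) < ρ → g ![x 0, -x 1] = ![g x 0, -g x 1])
    {x : Fin 2 → ℝ} (hx : √(x 0 ^ 2 + x 1 ^ 2) < ρ) :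
    g x = (g ![√(x 0 ^ 2 + x 1 ^ 2), 0] 0 / √(x 0 ^ 2 + x 1 ^ 2)) • x := by
  -- Points of the axis are fixed by the reflection, so their images lie on the axis.
  have hax : ∀ a : ℝ, √(a ^ 2) < ρ → g ![a, 0] 1 = 0 := fun a ha => by
    have h := congrFun (href ![a, 0] (by simpa using ha)) 1
    simp at h
    linarith
  set d := √(x 0 ^ 2 + x 1 ^ 2) with hd
  have hd0 : 0 ≤ d := Real.sqrt_nonneg _
  have hdd : √(d ^ 2) < ρ := by rwa [Real.sqrt_sq hd0]
  have hdv : √((![d, 0] : Fin 2 → ℝ) 0 ^ 2 + (![d, 0] : Fin 2 → ℝ) 1 ^ 2) < ρ := by simpa using hdd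
  by_cases h0 : d = 0
  · have hx0 : x = ![d, 0] := by
      have hs : x 0 ^ 2 + x 1 ^ 2 = 0 := by
        rwa [hd, Real.sqrt_eq_zero (by positivity)] at h0
      have k0 : x 0 = 0 := by nlinarith [sq_nonneg (x 0), sq_nonneg (x 1)]
      have k1 : x 1 = 0 := by nlinarith [sq_nonneg (x 0), sq_nonneg (x 1)]
      ext i
      fin_cases i
      · simp [k0, h0]
      · simp [k1]
    -- Rotation by π fixes the origin and acts as -1, so g vanishes there; the quotient by the
    -- radius 0 is 0 by convention and causes no harm.
    obtain ⟨φ, hφ⟩ := twist_surjective hℓ (π : Real.Angle)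
    have h1 := congrFun (hrot _ hdv φ) 0
    have e : A ℓ φ *ᵥ ![d, 0] = ![d, 0] := by
      rw [A_mulVec, h0]
      ext i
      fin_cases i <;> simp
    rw [e, A_mulVec, hφ] at h1
    simp [hax d hdd] at h1
    have h2 : g ![d, 0] 0 = 0 := by linarith
    rw [h2, zero_div, zero_smul, hx0]
    ext i
    fin_cases i
    · exact h2
    · exact hax d hdd
  · obtain ⟨φ, hφ⟩ := exists_polar hℓ x
    rw [← hd] at hφ
    have h1 := hrot _ hdv φ
    rw [hφ] at h1
    rw [h1]
    conv_rhs => rw [← hφ]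
    rw [← Matrix.mulVec_smul]
    congr 1
    ext i
    fin_cases i
    · simp [h0]
    · simpa using hax d hdd

lemma sq_add_sq_A_mulVec (ℓ : ℕ) (φ : UnitAddCircle) (x : Fin 2 → ℝ) :
    (A ℓ φ *ᵥ x) 0 ^ 2 + (A ℓ φ *ᵥ x) 1 ^ 2 = x 0 ^ 2 + x 1 ^ 2 := by
  rw [A_mulVec]
  simp only [Matrix.cons_val_zero, Matrix.cons_val_one]
  linear_combination (x 0 ^ 2 + x 1 ^ 2) * Real.Angle.cos_sq_add_sin_sq (twist ℓ φ)

theorem reduced_map_radial {q ℓ : ℕ} (hℓ : 1 ≤ ℓ) {δ : ℝ} (hδ : 0 < δ) {p : ℝ → ℝ × ℝ × ℝ}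
    (hcont : ContinuousAt p 0) (hp₀ : p 0 ∈ interior paramSpace) {ε : ℝ} (hε : 0 < ε)
    (hgap : ∀ k : ℕ, 1 ≤ k → k ≠ ℓ → c1 q k (p 0) ∉ Ioo (-ε) ε)
    {ψ : (UnitAddCircle → ℝ) → (ℝ × ℝ × ℝ) → (UnitAddCircle → ℝ)}
    (hψ : IsReduction q ℓ (p 0) ψ) :
    ∃ ρ > 0, ∃ δ' ∈ Ioc 0 δ, ∀ s ∈ Ioo (-δ') δ', ∀ x : Fin 2 → ℝ, √(x 0 ^ 2 + x 1 ^ 2) < ρ →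
      PhiHat q ℓ ψ p x s =
        (PhiHat q ℓ ψ p ![√(x 0 ^ 2 + x 1 ^ 2), 0] s 0 / √(x 0 ^ 2 + x 1 ^ 2)) • x := by
  obtain ⟨C, hC, hshift, hrefl⟩ := exists_isSymm q hℓ
  obtain ⟨η, hη, V, hV, H⟩ := phi_equivariant hℓ hp₀ hε hgap hψ hC
  obtain ⟨M, hM, hMle⟩ := exists_h1norm_comb_le ℓ
  obtain ⟨δ₁, hδ₁, hball⟩ := Metric.eventually_nhds_iff_ball.1 (hcont.eventually hV)
  refine ⟨η / M, by positivity, min δ δ₁, ⟨by positivity, min_le_left _ _⟩, fun s hs x hx => ?_⟩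
  have hsV : p s ∈ V := hball s (by
    rw [Metric.mem_ball, Real.dist_eq, sub_zero, abs_lt]
    exact ⟨by linarith [hs.1, min_le_right δ δ₁], hs.2.trans_le (min_le_right _ _)⟩)
  have hsmall : ∀ x : Fin 2 → ℝ, √(x 0 ^ 2 + x 1 ^ 2) < η / M → h1norm (comb ℓ x) < η :=
    fun x hx => (hMle x).trans_lt (by rwa [lt_div_iff₀' hM] at hx)
  have hmem := fun x hx => (H _ (comb_mem_N ℓ x) (hsmall x hx) _ hsV).1
  refine radial_of_equivariant (g := fun x => PhiHat q ℓ ψ p x s) hℓ (fun x hx φ => ?_)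
    (fun x hx => ?_) hx
  · apply comb_injective hℓ
    have hx' : √((A ℓ φ *ᵥ x) 0 ^ 2 + (A ℓ φ *ᵥ x) 1 ^ 2) < η / M := by
      rwa [sq_add_sq_A_mulVec]
    rw [comb_PhiHat hℓ (hmem _ hx'), ← shift_comb, ← shift_comb, comb_PhiHat hℓ (hmem _ hx),
      (H _ (comb_mem_N ℓ x) (hsmall x hx) _ hsV).2 _ (hshift φ)]
  · apply comb_injective hℓ
    have hx' : √((![x 0, -x 1] : Fin 2 → ℝ) 0 ^ 2 + (![x 0, -x 1] : Fin 2 → ℝ) 1 ^ 2) < η / M := by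
      simpa using hx
    rw [comb_PhiHat hℓ (hmem _ hx'), ← reflect_comb, ← reflect_comb, comb_PhiHat hℓ (hmem _ hx),
      (H _ (comb_mem_N ℓ x) (hsmall x hx) _ hsV).2 _ hrefl]

end

end TwistedStates

end

/-! ### Radial form and zero set of the reduced map. -/

theorem mainTheorem3 (q ℓ : ℕ) (hℓ : 1 ≤ ℓ) (δ : ℝ) (hδ : 0 < δ) (p : ℝ → ℝ × ℝ × ℝ)
    (hp_smooth : ContDiffOn ℝ ∞ p (Set.Ioo (-δ) δ))
    (hp_mem : ∀ s ∈ Set.Ioo (-δ) δ, p s ∈ interior TwistedStates.paramSpace)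
    (h_zero : TwistedStates.c1 q ℓ (p 0) = 0)
    (h_gap : ∃ ε > 0, ∀ s ∈ Set.Ioo (-δ) δ, ∀ k : ℕ, 1 ≤ k → k ≠ ℓ →
      TwistedStates.c1 q k (p s) ∉ Set.Ioo (-ε) ε)
    (h_isolated : ∀ s ∈ Set.Ioo (-δ) δ,
      ¬ MapClusterPt (TwistedStates.c1 q ℓ (p s)) Filter.atTop
        (fun k : ℕ => TwistedStates.c1 q k (p s)))
    (h_speed : deriv (fun s => TwistedStates.c1 q ℓ (p s)) 0 ≠ 0) :
    (∃ ψ, TwistedStates.IsReduction q ℓ (p 0) ψ) ∧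
    ∀ ψ, TwistedStates.IsReduction q ℓ (p 0) ψ →
      ∃ U ∈ 𝓝 (0 : Fin 2 → ℝ), ∃ δ' ∈ Set.Ioc 0 δ, ∃ h : (Fin 2 → ℝ) → ℝ → ℝ,
        (∀ x ∈ U, ∀ φ, TwistedStates.A ℓ φ *ᵥ x ∈ U) ∧
        ∀ s ∈ Set.Ioo (-δ') δ',
          (∀ x ∈ U, TwistedStates.PhiHat q ℓ ψ p x s = h x s • x) ∧
          (∀ x ∈ U, ∀ φ, h (TwistedStates.A ℓ φ *ᵥ x) s = h x s) ∧
          (∀ x ∈ U, TwistedStates.PhiHat q ℓ ψ p x s = 0 ↔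
            ∃ (a : ℝ) (φ : UnitAddCircle), ![a, 0] ∈ U ∧
              TwistedStates.PhiHat q ℓ ψ p ![a, 0] s 0 = 0 ∧
              x = TwistedStates.A ℓ φ *ᵥ ![a, 0]) := by
  have h0 : (0 : ℝ) ∈ Set.Ioo (-δ) δ := ⟨by linarith, hδ⟩
  obtain ⟨ε, hε, hgap⟩ := h_gap
  have hgap := hgap 0 h0
  have hp₀ := hp_mem 0 h0
  have hcont : ContinuousAt p 0 :=
    hp_smooth.continuousOn.continuousAt (Ioo_mem_nhds h0.1 h0.2)
  refine ⟨TwistedStates.exists_isReduction hℓ hp₀ hε hgap, fun ψ hψ => ?_⟩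
  obtain ⟨ρ, hρ, δ', hδ', hrad⟩ :=
    TwistedStates.reduced_map_radial hℓ hδ hcont hp₀ hε hgap hψ
  have hAU : ∀ x ∈ {x : Fin 2 → ℝ | √(x 0 ^ 2 + x 1 ^ 2) < ρ}, ∀ φ,
      TwistedStates.A ℓ φ *ᵥ x ∈ {x : Fin 2 → ℝ | √(x 0 ^ 2 + x 1 ^ 2) < ρ} := fun x hx φ => by
    rwa [Set.mem_ofPred_eq, TwistedStates.sq_add_sq_A_mulVec]
  refine ⟨{x | √(x 0 ^ 2 + x 1 ^ 2) < ρ}, ?_, δ', hδ', fun x s =>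
    TwistedStates.PhiHat q ℓ ψ p ![√(x 0 ^ 2 + x 1 ^ 2), 0] s 0 / √(x 0 ^ 2 + x 1 ^ 2),
    hAU, fun s hs => ⟨fun x hx => hrad s hs x hx, fun x _ φ => ?_, fun x hx => ⟨fun hx0 => ?_, ?_⟩⟩⟩
  · refine (isOpen_lt (by fun_prop) continuous_const).mem_nhds ?_
    simpa using hρ
  · simp only [TwistedStates.sq_add_sq_A_mulVec]
  · obtain ⟨φ, hφ⟩ := TwistedStates.exists_polar hℓ x
    refine ⟨√(x 0 ^ 2 + x 1 ^ 2), φ, ?_, ?_, hφ.symm⟩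
    · simpa using hx
    · have hr := hrad s hs x hx
      rw [hx0, eq_comm, smul_eq_zero] at hr
      rcases hr with hr | rfl
      · rcases div_eq_zero_iff.1 hr with hr | hr
        · exact hr
        · have hz := hrad s hs ![√(x 0 ^ 2 + x 1 ^ 2), 0] (by simpa using hx)
          rw [hz]
          simp [hr]
      · have : (![√((0 : Fin 2 → ℝ) 0 ^ 2 + (0 : Fin 2 → ℝ) 1 ^ 2), 0] : Fin 2 → ℝ) = 0 := by
          ext i
          fin_cases i <;> simp
        rw [this, hx0, Pi.zero_apply]
  · rintro ⟨a, φ, ha, ha0, rfl⟩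
    have hr := hrad s hs _ hx
    have hr' := hrad s hs _ ha
    simp only [TwistedStates.sq_add_sq_A_mulVec] at hr
    -- The points (a, 0) and A_φ (a, 0) have equal radius and hence the same factor, so Φ̂ at the
    -- second is A_φ applied to Φ̂ at the first. This holds for either sign of a.
    rw [hr, ← Matrix.mulVec_smul, ← hr']
    have hz : TwistedStates.PhiHat q ℓ ψ p ![a, 0] s = 0 := by
      ext i
      fin_cases i
      · exact ha0
      · rw [hr']
        simp
    rw [hz, Matrix.mulVec_zero]
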